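/- Let $d\in\{1,2,3\}$ and let $\Omega\subset\mathbb R^d$ be bounded and open (for instance a polytopal domain with Lipschitz boundary). Let $\mathcal T$ be a finite set of pairwise disjoint open convex polytopes $K\subset\Omega$ (for instance simplices, or convex quadrilaterals/hexahedra with planar facets) with $\overline\Omega=\bigcup_{K\in\mathcal T}\overline K$, and let $\mathcal E_{\rm int}$ be the union of the interior facets $\partial K_1\cap\partial K_2\cap\Omega$, $K_1\ne K_2\in\mathcal T$. On such a facet let $n=n_{K_1}$ be the unit normal pointing from $K_1$ to $K_2$, and put $[\![w]\!]=w|_{K_1}n_{K_1}+w|_{K_2}n_{K_2}$, $\lfloor w\rfloor=w|_{K_1}-w|_{K_2}$, $\{w\}=\tfrac12(w|_{K_1}+w|_{K_2})$; let $h|_K=\operatorname{diam}K$, where on a facet $h$ is any fixed value between its two one-sided values. For $p\in\mathbb N_0$ let $V_p$ be the space of $w_h\in L^2(\Omega)$ such that $w_h|_K$ is a polynomial of total degree at most $p$ for every $K\in\mathcal T$ and $w_h$ has vanishing trace on $\partial\Omega$. For $\sigma,\mu,\tau>0$ and $\psi\in W^{2,\infty}(\Omega)$ put $$a_h(w,v)=\sum_K\int_K\nabla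 w\cdot\nabla v\,dx-\int_{\mathcal E_{\rm int}}\Big([\![w]\!]\cdot\{\nabla v\}+[\![v]\!]\cdot\{\nabla w\}-\tfrac{\sigma}{h}[\![w]\!]\cdot[\![v]\!]\Big)ds,$$ $$b_h(w,v)=\sum_K\int_K w\nabla\psi\cdot\nabla v\,dx-\int_{\mathcal E_{\rm int}}\Big((\nabla\psi\cdot n)\{w\}\lfloor v\rfloor-\tfrac{\mu}{2}|\nabla\psi\cdot n|\lfloor w\rfloor\lfloor v\rfloor\Big)ds,$$ $$\mathcal A_h(w,v)=(w,v)_{L^2(\Omega)}+\tau\big(a_h(w,v)+b_h(w,v)\big),\qquad \|w\|_{\rm sip}^2=\sum_K\|\nabla w\|_{L^2(K)}^2+\int_{\mathcal E_{\rm int}}\tfrac{\sigma}{h}|[\![w]\!]|^2\,ds.$$ Call $\hat\sigma>0$ a coercivity threshold if there is $C>0$ with $a_h(w,w)\ge C\|w\|_{\rm sip}^2$ for all $w\in V_p$ and all $\sigma\ge\hat\sigma$. Then a coercivity threshold exists, and for every coercivity threshold $\hat\sigma$ the following holds. Let $\sigma\ge\hat\sigma$, $\mu>0$, $\tau>0$,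 $\psi\in W^{2,\infty}(\Omega)$, and assume that either $\Delta\psi\le0$ a.e. in $\Omega$ or $\tau\|\Delta\psi\|_{L^\infty(\Omega)}<2$. Let $0\le u_0\in L^\infty(\Omega)$. For each $K\in\mathcal T$ let $\mathcal L_K\subset\overline K$ be a set of Lagrange nodes of degree $p$ (a finite set such that a polynomial of total degree at most $p$ is determined by its values on it), and let $$V_p^+=\{w_h\in V_p:\ 0\le w_h|_K(x)\le\|u_0\|_{L^\infty(\Omega)}\ \text{ for all }x\in\mathcal L_K,\ K\in\mathcal T\}.$$ Let $N\in\mathbb N_0$ and let a discrete initial value $(u_h^0)^+:=u_h^0\in V_p$ be given. Then there are unique $(u_h^n)^+\in V_p^+$, $n=1,\dots,N$, such that for every $n=1,\dots,N$ $$\mathcal A_h\big((u_h^n)^+,\,v_h-(u_h^n)^+\big)\ \ge\ \big((u_h^{n-1})^+,\,v_h-(u_h^n)^+\big)_{L^2(\Omega)}\qquad\text{for all }v_h\in V_p^+ .$$ -/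

import Mathlib

open MeasureTheory
open scoped ContDiff RealInnerProductSpace

noncomputable section

namespace DGDrift

/-- The Euclidean space `ℝ^d`. -/
abbrev E (d : ℕ) := EuclideanSpace ℝ (Fin d)

/-! ### Weak derivatives and the space `W^{2,∞}(Ω)` -/

/-- `g` is a weak `i`-th partial derivative of `f` on the open set `Ω`:
both are locally integrable on `Ω` and `∫_Ω f ∂ᵢφ = - ∫_Ω g φ` for all `φ ∈ C_c^∞(Ω)`. -/
def HasWeakPartial {d : ℕ} (Ω : Set (E d)) (i : Fin d) (f g : E d → ℝ) : Prop :=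
  LocallyIntegrableOn f Ω volume ∧ LocallyIntegrableOn g Ω volume ∧
    ∀ φ : E d → ℝ, ContDiff ℝ ∞ φ → HasCompactSupport φ → tsupport φ ⊆ Ω →
      ∫ x in Ω, f x * fderiv ℝ φ x (EuclideanSpace.single i 1) = - ∫ x in Ω, g x * φ x

/-- Membership in `L^∞(Ω)`. -/
def MemLinf {d : ℕ} (Ω : Set (E d)) (f : E d → ℝ) : Prop :=
  MemLp f ⊤ (volume.restrict Ω)

/-- The norm of `L^∞(Ω)`, as a real number. -/
def normLinf {d : ℕ} (Ω : Set (E d)) (f : E d → ℝ) : ℝ :=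
  (eLpNorm f ⊤ (volume.restrict Ω)).toReal

/-- `ψ ∈ W^{2,∞}(Ω)`: the function and its weak partial derivatives of first and second order
exist and lie in `L^∞(Ω)`. -/
def MemW2inf {d : ℕ} (Ω : Set (E d)) (ψ : E d → ℝ) : Prop :=
  MemLinf Ω ψ ∧ ∀ i, ∃ g, HasWeakPartial Ω i ψ g ∧ MemLinf Ω g ∧
    ∀ j, ∃ h, HasWeakPartial Ω j g h ∧ MemLinf Ω h

open Classical in
/-- The weak partial derivative `∂ᵢf` on `Ω`, as a function. It is determined almost everywhere
in `Ω`; if it has a representative which is continuous on `Ω` (as the first derivatives of a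
`W^{2,∞}` function do), then that representative, which is unique at every point of the open
set `Ω`, is taken, so that its values on facets in `Ω` are meaningful. -/
def weakPartial {d : ℕ} (Ω : Set (E d)) (i : Fin d) (f : E d → ℝ) : E d → ℝ :=
  if h : ∃ g, ContinuousOn g Ω ∧ HasWeakPartial Ω i f g then h.choose
  else if h : ∃ g, HasWeakPartial Ω i f g then h.choose
  else 0

/-- The weak gradient `∇ψ`. -/
def weakGrad {d : ℕ} (Ω : Set (E d)) (ψ : E d → ℝ) (x : E d) : E d :=
  WithLp.toLp 2 fun i => weakPartial Ω i ψ x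

/-- The weak Laplacian `Δψ`. -/
def weakLaplacian {d : ℕ} (Ω : Set (E d)) (ψ : E d → ℝ) (x : E d) : ℝ :=
  ∑ i, weakPartial Ω i (weakPartial Ω i ψ) x

/-! ### Meshes -/

/-- A (nonempty, bounded) open convex polytope: a finite intersection of open half-spaces. All
open simplices and all open convex quadrilaterals and hexahedra with planar facets are of this
form. -/
def IsOpenPolytope {d : ℕ} (K : Set (E d)) : Prop :=
  K.Nonempty ∧ Bornology.IsBounded K ∧
    ∃ s : Finset (E d × ℝ), K = {x | ∀ a ∈ s, ⟪a.1, x⟫ < a.2}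

/-- A subdivision of `Ω` into finitely many pairwise disjoint open polytopal elements whose
closures cover the closure of `Ω`. -/
structure IsMesh {d m : ℕ} (Ω : Set (E d)) (K : Fin m → Set (E d)) : Prop where
  polytope : ∀ i, IsOpenPolytope (K i)
  subset : ∀ i, K i ⊆ Ω
  disjoint : ∀ i j, i ≠ j → Disjoint (K i) (K j)
  cover : closure Ω = ⋃ i, closure (K i)

/-- The surface measure on `(d-1)`-dimensional facets (counting measure if `d = 1`). -/
def surf (d : ℕ) : Measure (E d) := Measure.euclideanHausdorffMeasure (d - 1)

/-- The interior interface between the elements `i` and `j`. Up to sets of surface measure zero,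
the sets `facet Ω K i j` with `i < j` form a partition of the union of all interior facets. -/
def facet {d m : ℕ} (Ω : Set (E d)) (K : Fin m → Set (E d)) (i j : Fin m) : Set (E d) :=
  closure (K i) ∩ closure (K j) ∩ Ω

open Classical in
/-- A unit normal vector of a hyperplane separating `A` and `B`, pointing from `A` to `B`. For
disjoint convex open sets which share a piece of positive surface measure of their boundaries, the
separating hyperplane is unique, and this is the outward unit normal of `A` there. -/
def unitNormal {d : ℕ} (A B : Set (E d)) : E d :=
  if h : ∃ n : E d, ‖n‖ = 1 ∧ ∃ c : ℝ, (∀ x ∈ A, ⟪n, x⟫ ≤ c) ∧ ∀ x ∈ B, c ≤ ⟪n, x⟫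
  then h.choose else 0

/-- `hF i j` is an admissible value on the facet between the elements `i` and `j` of the piecewise
constant mesh size function `h`, `h = diam K` on `K`: it lies between the two one-sided values. -/
def IsFacetMeshSize {d m : ℕ} (K : Fin m → Set (E d)) (hF : Fin m → Fin m → ℝ) : Prop :=
  ∀ i j, min (Metric.diam (K i)) (Metric.diam (K j)) ≤ hF i j ∧
    hF i j ≤ max (Metric.diam (K i)) (Metric.diam (K j))

/-! ### Discontinuous finite element functions -/

/-- Piecewise polynomials, given by one polynomial for each element. The traces on the boundary of
an element are the values of its polynomial there. -/
abbrev PW (d m : ℕ) := Fin m → MvPolynomial (Fin d) ℝ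

/-- The value of a polynomial at a point. -/
def val {d : ℕ} (q : MvPolynomial (Fin d) ℝ) (x : E d) : ℝ :=
  MvPolynomial.eval (fun i => x i) q

/-- The gradient of a polynomial at a point. -/
def grad {d : ℕ} (q : MvPolynomial (Fin d) ℝ) (x : E d) : E d :=
  WithLp.toLp 2 fun i => val (MvPolynomial.pderiv i q) x

/-- The space `V_p`: total degree at most `p` on each element, vanishing trace on `∂Ω`. -/
def V {d m : ℕ} (Ω : Set (E d)) (K : Fin m → Set (E d)) (p : ℕ) : Set (PW d m) :=
  {w | ∀ i, (w i).totalDegree ≤ p ∧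
    ∀ᵐ x ∂((surf d).restrict (closure (K i) ∩ frontier Ω)), val (w i) x = 0}

/-- `L` is a set of Lagrange nodes of degree `p` for the element `K`: finitely many points of the
closed element, such that a polynomial of total degree at most `p` is determined by its values at
these points. -/
def IsLagrangeNodes {d : ℕ} (p : ℕ) (K : Set (E d)) (L : Finset (E d)) : Prop :=
  (∀ x ∈ L, x ∈ closure K) ∧
    ∀ q : MvPolynomial (Fin d) ℝ, q.totalDegree ≤ p → (∀ x ∈ L, val q x = 0) → q = 0

/-- The set `V_p^+` of functions in `V_p` with all nodal values in `[0, M]`. -/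
def Vplus {d m : ℕ} (Ω : Set (E d)) (K : Fin m → Set (E d)) (p : ℕ) (L : Fin m → Finset (E d))
    (M : ℝ) : Set (PW d m) :=
  {w | w ∈ V Ω K p ∧ ∀ i, ∀ x ∈ L i, 0 ≤ val (w i) x ∧ val (w i) x ≤ M}

/-! ### The discrete forms -/

/-- The `L²(Ω)` inner product of piecewise polynomials. -/
def ip {d m : ℕ} (K : Fin m → Set (E d)) (w v : PW d m) : ℝ :=
  ∑ i, ∫ x in K i, val (w i) x * val (v i) x

/-- Sum over all interior facets of the surface integral of `f i j`. -/
def facetSum {d m : ℕ} (Ω : Set (E d)) (K : Fin m → Set (E d))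
    (f : Fin m → Fin m → E d → ℝ) : ℝ :=
  ∑ e : Fin m × Fin m with e.1 < e.2, ∫ x in facet Ω K e.1 e.2, f e.1 e.2 x ∂(surf d)

/-- The scalar jump `w|_{K_i} - w|_{K_j}`. -/
def ujump {d m : ℕ} (w : PW d m) (i j : Fin m) (x : E d) : ℝ := val (w i) x - val (w j) x

/-- The vector jump `w|_{K_i} n_{K_i} + w|_{K_j} n_{K_j}`, where `n_{K_j} = - n_{K_i}`. -/
def jump {d m : ℕ} (K : Fin m → Set (E d)) (w : PW d m) (i j : Fin m) (x : E d) : E d :=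
  val (w i) x • unitNormal (K i) (K j) + val (w j) x • (-unitNormal (K i) (K j))

/-- The average of `w`. -/
def avg {d m : ℕ} (w : PW d m) (i j : Fin m) (x : E d) : ℝ := (val (w i) x + val (w j) x) / 2

/-- The average of `∇w`. -/
def avgGrad {d m : ℕ} (w : PW d m) (i j : Fin m) (x : E d) : E d :=
  (1 / 2 : ℝ) • (grad (w i) x + grad (w j) x)

/-- The symmetric interior penalty form `a_h`. -/
def aForm {d m : ℕ} (Ω : Set (E d)) (K : Fin m → Set (E d)) (hF : Fin m → Fin m → ℝ) (σ : ℝ)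
    (w v : PW d m) : ℝ :=
  (∑ i, ∫ x in K i, ⟪grad (w i) x, grad (v i) x⟫) -
    facetSum Ω K fun i j x =>
      ⟪jump K w i j x, avgGrad v i j x⟫ + ⟪jump K v i j x, avgGrad w i j x⟫ -
        σ / hF i j * ⟪jump K w i j x, jump K v i j x⟫

/-- The upwind form `b_h`. Exchanging the roles of the two elements at a facet changes the sign
of both the normal and the scalar jump, hence does not change the form. -/
def bForm {d m : ℕ} (Ω : Set (E d)) (K : Fin m → Set (E d)) (ψ : E d → ℝ) (μ : ℝ)
    (w v : PW d m) : ℝ :=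
  (∑ i, ∫ x in K i, val (w i) x * ⟪weakGrad Ω ψ x, grad (v i) x⟫) -
    facetSum Ω K fun i j x =>
      ⟪weakGrad Ω ψ x, unitNormal (K i) (K j)⟫ * avg w i j x * ujump v i j x -
        μ / 2 * |⟪weakGrad Ω ψ x, unitNormal (K i) (K j)⟫| * ujump w i j x * ujump v i j x

/-- The form `A_h(w, v) = (w, v) + τ (a_h(w, v) + b_h(w, v))`. -/
def AForm {d m : ℕ} (Ω : Set (E d)) (K : Fin m → Set (E d)) (hF : Fin m → Fin m → ℝ)
    (ψ : E d → ℝ) (σ μ τ : ℝ) (w v : PW d m) : ℝ :=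
  ip K w v + τ * (aForm Ω K hF σ w v + bForm Ω K ψ μ w v)

/-- The square of the interior penalty norm. -/
def sipNormSq {d m : ℕ} (Ω : Set (E d)) (K : Fin m → Set (E d)) (hF : Fin m → Fin m → ℝ) (σ : ℝ)
    (w : PW d m) : ℝ :=
  (∑ i, ∫ x in K i, ‖grad (w i) x‖ ^ 2) +
    facetSum Ω K fun i j x => σ / hF i j * ‖jump K w i j x‖ ^ 2

/-- `σ₀` is a threshold for the coercivity of `a_h` on `V_p`: there is a constant `C > 0` with
`a_h(w, w) ≥ C ‖w‖_sip²` for all `w ∈ V_p` and all penalty parameters `σ ≥ σ₀`. -/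
def IsSIPThreshold {d m : ℕ} (Ω : Set (E d)) (K : Fin m → Set (E d)) (hF : Fin m → Fin m → ℝ)
    (p : ℕ) (σ₀ : ℝ) : Prop :=
  ∃ C > 0, ∀ σ ≥ σ₀, ∀ w ∈ V Ω K p, C * sipNormSq Ω K hF σ w ≤ aForm Ω K hF σ w w

/-- `U 0, …, U N` solves the nodally bound-preserving scheme: `U 0` is the given discrete initial
value, and for `n = 1, …, N` one has `U n ∈ V_p^+` and
`A_h(U n, v - U n) ≥ (U (n-1), v - U n)` for all `v ∈ V_p^+`. -/
def IsSchemeSolution {d m : ℕ} (Ω : Set (E d)) (K : Fin m → Set (E d)) (hF : Fin m → Fin m → ℝ)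
    (ψ : E d → ℝ) (σ μ τ : ℝ) (p : ℕ) (L : Fin m → Finset (E d)) (M : ℝ) (N : ℕ)
    (uh0 : PW d m) (U : Fin (N + 1) → PW d m) : Prop :=
  U 0 = uh0 ∧ ∀ n : Fin N, U n.succ ∈ Vplus Ω K p L M ∧
    ∀ v ∈ Vplus Ω K p L M,
      AForm Ω K hF ψ σ μ τ (U n.succ) (v - U n.succ) ≥ ip K (U n.castSucc) (v - U n.succ)

end DGDrift

end

open Filter Topology
open scoped Convolution

namespace DGDrift

/-! ### Variational inequalities in finite dimension -/

section Stampacchia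

/-! Each time step is a variational inequality for a bilinear form on the finite-dimensional space
`VSub`, over the convex set cut out by the nodal bounds. By Stampacchia's theorem
(`existsUnique_variational_inequality`) it has exactly one solution as soon as `AForm` is positive
definite on V_p, and iterating the solution map gives the whole sequence.

On the diagonal the form is (w,w) + τ a_h(w,w) + τ b_h(w,w). The second term is nonnegative above a
coercivity threshold. For the third, Green's formula for w² on every element, together with the
identity {w}⌊w⌋ = ½⌊w²⌋ on facets, cancels the central flux and leaves (`bForm_self`) b_h(w,w) = -½
∫ Δψ w² + (μ/2) ∫ |∇ψ·n| ⌊w⌋². The upwind term is nonnegative, and (w,w) dominates τ/2 ∫ Δψ w²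
strictly if Δψ ≤ 0 or τ‖Δψ‖ < 2. This is `AForm_self_pos`.

The main work is Green's formula `IsMesh.green` for the field ∇ψ, which is only bounded and
continuous inside Ω with bounded weak derivatives; Ω is an arbitrary bounded open set, and ∇ψ need
not extend to its boundary. `exists_continuousOn_ae_eq` supplies the continuous representative. In
`green_polytope` the weak derivative is tested with w² times a smooth cutoff of the polytope; the
gradient of the cutoff concentrates on thin layers along the faces, whose limits are the face
integrals. At points of ∂Ω the vanishing trace of w replaces the missing limit of ∇ψ. The mesh
lemmas then show that, up to surface measure zero, every face point inside Ω has exactly one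
neighbouring element, with the opposite normal.

A threshold exists by Young's inequality and an inverse trace inequality for gradients; the latter
is a comparison of quadratic forms on a finite-dimensional space (`exists_quadratic_bound`). -/

/-- The operator representing a bilinear form on a finite-dimensional Euclidean space. -/
theorem exists_operator_of_bilinear {H : Type*} [NormedAddCommGroup H] [InnerProductSpace ℝ H]
    [FiniteDimensional ℝ H] (B : H →ₗ[ℝ] H →ₗ[ℝ] ℝ) :
    ∃ A : H →L[ℝ] H, ∀ u v, ⟪A u, v⟫ = B u v := by
  let A : H →ₗ[ℝ] H :=
    { toFun := fun v => (InnerProductSpace.toDual ℝ H).symm (LinearMap.toContinuousLinearMap (B v))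
      map_add' := by intro x y; simp
      map_smul' := by intro c x; simp }
  exact ⟨LinearMap.toContinuousLinearMap A, fun u v => by simp [A]⟩

/-- The minimum of the quadratic form on the compact unit sphere is positive, and homogeneity of
degree two extends the bound. If the sphere is empty the space is trivial and any constant will do.
-/
theorem exists_coercive_const {H : Type*} [NormedAddCommGroup H] [InnerProductSpace ℝ H]
    [FiniteDimensional ℝ H] (A : H →L[ℝ] H) (hA : ∀ v ≠ 0, 0 < ⟪A v, v⟫) :
    ∃ α > 0, ∀ v, α * ‖v‖ ^ 2 ≤ ⟪A v, v⟫ := by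
  rcases (Metric.sphere (0 : H) 1).eq_empty_or_nonempty with h | h
  · refine ⟨1, one_pos, fun v => ?_⟩
    have hv : v = 0 := by
      by_contra hv
      have : ‖v‖⁻¹ • v ∈ Metric.sphere (0 : H) 1 := by
        simp [norm_smul, inv_mul_cancel₀ (norm_ne_zero_iff.2 hv)]
      simp [h] at this
    simp [hv]
  · obtain ⟨u, hu, hmin⟩ := (isCompact_sphere (0 : H) 1).exists_isMinOn h
      (f := fun v => ⟪A v, v⟫) (by fun_prop)
    have hu1 : ‖u‖ = 1 := by simpa using hu
    have hu0 : u ≠ 0 := by rintro rfl; simp at hu1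
    refine ⟨⟪A u, u⟫, hA u hu0, fun v => ?_⟩
    by_cases hv : v = 0
    · simp [hv]
    have hn : ‖v‖ ≠ 0 := norm_ne_zero_iff.2 hv
    have hm : ‖v‖⁻¹ • v ∈ Metric.sphere (0 : H) 1 := by
      simp [norm_smul, inv_mul_cancel₀ hn]
    have := hmin hm
    simp only [Set.mem_ofPred_eq, map_smul, inner_smul_left, inner_smul_right] at this
    simp only [conj_trivial] at this
    calc ⟪A u, u⟫ * ‖v‖ ^ 2 ≤ (‖v‖⁻¹ * (‖v‖⁻¹ * ⟪A v, v⟫)) * ‖v‖ ^ 2 := by gcongr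
      _ = ⟪A v, v⟫ := by field_simp

/-- Existence and uniqueness for variational inequalities (Stampacchia). -/
theorem existsUnique_variational_inequality {H : Type*} [NormedAddCommGroup H]
    [InnerProductSpace ℝ H] [FiniteDimensional ℝ H] (B : H →ₗ[ℝ] H →ₗ[ℝ] ℝ)
    (hB : ∀ v ≠ 0, 0 < B v v) (f : H →ₗ[ℝ] ℝ) {C : Set H} (hne : C.Nonempty)
    (hcl : IsClosed C) (hC : Convex ℝ C) :
    ∃! u, u ∈ C ∧ ∀ v ∈ C, f (v - u) ≤ B u (v - u) := by
  have : CompleteSpace H := FiniteDimensional.complete ℝ H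
  obtain ⟨A, hA⟩ := exists_operator_of_bilinear B
  obtain ⟨α, hα, hco⟩ := exists_coercive_const A (fun v hv => by rw [hA]; exact hB v hv)
  let b : H := (InnerProductSpace.toDual ℝ H).symm (LinearMap.toContinuousLinearMap f)
  have hb : ∀ v, ⟪b, v⟫ = f v := fun v => by simp [b]
  have hproj : ∀ x : H, ∃ y ∈ C, ∀ v ∈ C, ⟪x - y, v - y⟫ ≤ 0 := by
    intro x
    obtain ⟨y, hy, hy'⟩ := exists_norm_eq_iInf_of_complete_convex hne hcl.isComplete hC x
    exact ⟨y, hy, (norm_eq_iInf_iff_real_inner_le_zero hC hy).1 hy'⟩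
  choose P hPC hP using hproj
  -- The metric projection is nonexpansive: add the two obtuse-angle inequalities, each tested with
  -- the other projection.
  have hlip : ∀ x y, ‖P x - P y‖ ≤ ‖x - y‖ := by
    intro x y
    have h1 := hP x (P y) (hPC y)
    have h2 := hP y (P x) (hPC x)
    have h3 : ‖P x - P y‖ ^ 2 ≤ ⟪x - y, P x - P y⟫ := by
      rw [← real_inner_self_eq_norm_sq]
      simp only [inner_sub_left, inner_sub_right] at h1 h2 ⊢
      linarith
    have h4 := real_inner_le_norm (x - y) (P x - P y)
    by_contra! h
    nlinarith [norm_nonneg (x - y), norm_nonneg (P x - P y)]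
  -- Enlarging ‖A‖ by α keeps β positive and gives α ≤ β, so that 1 - α²/β² is nonnegative.
  obtain ⟨β, hβ1, hβα, hβ⟩ : ∃ β : ℝ, 0 < β ∧ α ≤ β ∧ ∀ v, ‖A v‖ ≤ β * ‖v‖ :=
    ⟨‖A‖ + α, by positivity, by linarith [norm_nonneg A], fun v =>
      (A.le_opNorm v).trans (by gcongr; linarith)⟩
  -- This value minimises 1 - 2ρα + ρ²β², the bound for the squared contraction factor of u ↦ u -
  -- ρ(Au - b); the minimum is k².
  let ρ : ℝ := α / β ^ 2
  have hρ : 0 < ρ := by positivity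
  let T : H → H := fun u => P (u - ρ • (A u - b))
  let k : ℝ := Real.sqrt (1 - α ^ 2 / β ^ 2)
  have hk0 : 0 ≤ 1 - α ^ 2 / β ^ 2 := by
    rw [sub_nonneg, div_le_one (by positivity)]; gcongr
  have hk1 : k < 1 := by
    rw [Real.sqrt_lt' one_pos]; simp only [one_pow]
    have : 0 < α ^ 2 / β ^ 2 := by positivity
    linarith
  have hT : ContractingWith ⟨k, Real.sqrt_nonneg _⟩ T := by
    refine ⟨by exact_mod_cast hk1, LipschitzWith.of_dist_le_mul fun u v => ?_⟩
    rw [dist_eq_norm, dist_eq_norm]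
    refine (hlip _ _).trans ?_
    have h1 : u - ρ • (A u - b) - (v - ρ • (A v - b)) = (u - v) - ρ • A (u - v) := by
      rw [map_sub]; module
    rw [h1]
    set w := u - v
    have h2 : ‖w - ρ • A w‖ ^ 2 ≤ (k * ‖w‖) ^ 2 := by
      rw [norm_sub_sq_real, mul_pow, Real.sq_sqrt hk0, norm_smul, inner_smul_right,
        real_inner_comm, Real.norm_of_nonneg hρ.le]
      have h3 := hco w
      have h4 : ‖A w‖ ^ 2 ≤ β ^ 2 * ‖w‖ ^ 2 := by
        rw [← mul_pow]; gcongr; exact hβ w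
      have h5 : ρ * (α * ‖w‖ ^ 2) ≤ ρ * ⟪A w, w⟫ := by gcongr
      have h6 : ρ ^ 2 * ‖A w‖ ^ 2 ≤ ρ ^ 2 * (β ^ 2 * ‖w‖ ^ 2) := by gcongr
      have h7 : ρ ^ 2 * (β ^ 2 * ‖w‖ ^ 2) = α ^ 2 / β ^ 2 * ‖w‖ ^ 2 := by
        simp only [ρ]; field_simp
      have h8 : ρ * (α * ‖w‖ ^ 2) = α ^ 2 / β ^ 2 * ‖w‖ ^ 2 := by
        simp only [ρ]; field_simp
      rw [mul_pow]
      linarith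
    exact abs_le_of_sq_le_sq' h2 (by positivity) |>.2
  have hfix : ∀ u, T u = u ↔ (u ∈ C ∧ ∀ v ∈ C, f (v - u) ≤ B u (v - u)) := by
    have key : ∀ u v, ⟪u - ρ • (A u - b) - u, v - u⟫ = ρ * (f (v - u) - B u (v - u)) := by
      intro u v
      rw [← hA, ← hb, ← inner_sub_left, sub_sub_cancel_left, inner_neg_left, inner_smul_left]
      simp only [conj_trivial, inner_sub_left]; ring
    intro u
    constructor
    · intro h
      refine ⟨h ▸ hPC _, fun v hv => ?_⟩
      have := hP (u - ρ • (A u - b)) v hv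
      rw [show P (u - ρ • (A u - b)) = u from h, key] at this
      nlinarith
    -- Test the projection inequality with u and the variational inequality with the projected
    -- point. Adding the two shows that the distance between these points vanishes.
    · rintro ⟨hu, h⟩
      have h1 := hP (u - ρ • (A u - b)) u hu
      have h2 := h _ (hPC (u - ρ • (A u - b)))
      have h3 : ⟪u - ρ • (A u - b) - u, P (u - ρ • (A u - b)) - u⟫ ≤ 0 := by
        rw [key]; nlinarith
      have h4 : ‖P (u - ρ • (A u - b)) - u‖ ^ 2 ≤ 0 := by
        rw [← real_inner_self_eq_norm_sq]
        simp only [inner_sub_left, inner_sub_right] at h1 h3 ⊢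
        linarith [real_inner_comm u (P (u - ρ • (A u - b)))]
      have h5 : ‖P (u - ρ • (A u - b)) - u‖ = 0 := by nlinarith [norm_nonneg (P (u - ρ • (A u - b)) - u)]
      exact sub_eq_zero.1 (norm_eq_zero.1 h5)
  refine ⟨hT.fixedPoint T, (hfix _).1 hT.fixedPoint_isFixedPt, fun y hy => ?_⟩
  exact hT.fixedPoint_unique ((hfix y).2 hy)

/-- A linear isomorphism of a finite-dimensional space with a Euclidean space. -/
noncomputable def euclideanEquiv (V : Type*) [AddCommGroup V] [Module ℝ V] [FiniteDimensional ℝ V] :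
    EuclideanSpace ℝ (Fin (Module.finrank ℝ V)) ≃ₗ[ℝ] V :=
  (WithLp.linearEquiv 2 ℝ _).trans (Module.finBasis ℝ V).equivFun.symm

/-- The bounds are pulled back to Euclidean coordinates, where they cut out a closed convex set
containing 0 because `0 ≤ M`. This set need not be bounded: positive definiteness supplies
existence. -/
theorem existsUnique_variational_inequality_box {V : Type*} [AddCommGroup V] [Module ℝ V]
    [FiniteDimensional ℝ V] (B : V →ₗ[ℝ] V →ₗ[ℝ] ℝ) (hB : ∀ v ≠ 0, 0 < B v v)
    (f : V →ₗ[ℝ] ℝ) {ι : Type*} (l : ι → V →ₗ[ℝ] ℝ) {M : ℝ} (hM : 0 ≤ M) :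
    ∃! u, (∀ i, 0 ≤ l i u ∧ l i u ≤ M) ∧
      ∀ v, (∀ i, 0 ≤ l i v ∧ l i v ≤ M) → f (v - u) ≤ B u (v - u) := by
  let e := euclideanEquiv V
  let C : Set (EuclideanSpace ℝ (Fin (Module.finrank ℝ V))) :=
    {x | ∀ i, 0 ≤ l i (e x) ∧ l i (e x) ≤ M}
  have hcont : ∀ i, Continuous fun x => l i (e x) := fun i =>
    LinearMap.continuous_of_finiteDimensional ((l i).comp e.toLinearMap)
  have hcl : IsClosed C := by
    simp only [C, Set.ofPred_forall]
    exact isClosed_iInter fun i => (isClosed_le continuous_const (hcont i)).inter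
      (isClosed_le (hcont i) continuous_const)
  have hconv : Convex ℝ C := by
    intro x hx y hy a b ha hb hab i
    simp only [map_add, map_smul, smul_eq_mul]
    have h1 := hx i
    have h2 := hy i
    refine ⟨add_nonneg (mul_nonneg ha h1.1) (mul_nonneg hb h2.1), ?_⟩
    calc a * l i (e x) + b * l i (e y) ≤ a * M + b * M := by
          gcongr
          · exact h1.2
          · exact h2.2
      _ = M := by rw [← add_mul, hab, one_mul]
  obtain ⟨u, ⟨hu, hu'⟩, huniq⟩ := existsUnique_variational_inequality
    (B.compl₁₂ e.toLinearMap e.toLinearMap)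
    (fun v hv => by simpa using hB (e v) (by simpa using hv)) (f.comp e.toLinearMap)
    ⟨0, fun i => by simp [hM]⟩ hcl hconv
  refine ⟨e u, ⟨hu, fun v hv => ?_⟩, fun y hy => ?_⟩
  · have := hu' (e.symm v) (fun i => by simpa using hv i)
    simpa using this
  · have := huniq (e.symm y) ⟨fun i => by simpa using hy.1 i, fun v hv => by
      simpa using hy.2 (e v) hv⟩
    rw [← this]; simp

/-- On a finite-dimensional space every bilinear form is bounded by a positive definite one. -/
theorem exists_quadratic_bound {V : Type*} [AddCommGroup V] [Module ℝ V]
    [FiniteDimensional ℝ V] (Q₁ Q₂ : V →ₗ[ℝ] V →ₗ[ℝ] ℝ) (hQ : ∀ v ≠ 0, 0 < Q₂ v v) :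
    ∃ c ≥ 0, ∀ v, Q₁ v v ≤ c * Q₂ v v := by
  let e := euclideanEquiv V
  obtain ⟨A₁, hA₁⟩ := exists_operator_of_bilinear (Q₁.compl₁₂ e.toLinearMap e.toLinearMap)
  obtain ⟨A₂, hA₂⟩ := exists_operator_of_bilinear (Q₂.compl₁₂ e.toLinearMap e.toLinearMap)
  obtain ⟨α, hα, hco⟩ := exists_coercive_const A₂ (fun v hv => by
    rw [hA₂]; simpa using hQ (e v) (by simpa using hv))
  refine ⟨‖A₁‖ / α, by positivity, fun v => ?_⟩
  have h1 : Q₁ v v = ⟪A₁ (e.symm v), e.symm v⟫ := by simp [hA₁]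
  have h2 : Q₂ v v = ⟪A₂ (e.symm v), e.symm v⟫ := by simp [hA₂]
  rw [h1, h2]
  calc ⟪A₁ (e.symm v), e.symm v⟫ ≤ ‖A₁ (e.symm v)‖ * ‖e.symm v‖ := real_inner_le_norm _ _
    _ ≤ ‖A₁‖ * ‖e.symm v‖ * ‖e.symm v‖ := by gcongr; exact A₁.le_opNorm _
    _ = ‖A₁‖ / α * (α * ‖e.symm v‖ ^ 2) := by field_simp
    _ ≤ _ := by gcongr; exact hco _

end Stampacchia

/-! ### Polynomials -/

section Polynomials

variable {d : ℕ}

theorem val_add (q r : MvPolynomial (Fin d) ℝ) (x : E d) : val (q + r) x = val q x + val r x := by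
  simp [val]

theorem val_mul (q r : MvPolynomial (Fin d) ℝ) (x : E d) : val (q * r) x = val q x * val r x := by
  simp [val]

theorem val_smul (c : ℝ) (q : MvPolynomial (Fin d) ℝ) (x : E d) :
    val (c • q) x = c * val q x := by
  simp [val, MvPolynomial.smul_eval]

theorem grad_apply (q : MvPolynomial (Fin d) ℝ) (x : E d) (k : Fin d) :
    grad q x k = val (MvPolynomial.pderiv k q) x := rfl

theorem grad_add (q r : MvPolynomial (Fin d) ℝ) (x : E d) :
    grad (q + r) x = grad q x + grad r x := by
  ext k; simp [grad_apply, val_add]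

theorem grad_smul (c : ℝ) (q : MvPolynomial (Fin d) ℝ) (x : E d) :
    grad (c • q) x = c • grad q x := by
  ext k; simp [grad_apply, val_smul]

theorem grad_mul_self (q : MvPolynomial (Fin d) ℝ) (x : E d) :
    grad (q * q) x = (2 * val q x) • grad q x := by
  ext k; simp [grad_apply, val_add, val_mul]; ring

theorem contDiff_val (q : MvPolynomial (Fin d) ℝ) : ContDiff ℝ ∞ (val q) := by
  induction q using MvPolynomial.induction_on with
  | C a =>
    have : val (d := d) (MvPolynomial.C a) = fun _ => a := by funext x; simp [val]
    rw [this]; exact contDiff_const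
  | add p q hp hq =>
    have : val (p + q) = fun x => val p x + val q x := funext fun x => val_add p q x
    rw [this]; exact hp.add hq
  | mul_X p i hp =>
    have : val (p * MvPolynomial.X i) = fun x => val p x * x i := by
      funext x; simp [val]
    rw [this]; exact hp.mul (by fun_prop)

theorem continuous_val (q : MvPolynomial (Fin d) ℝ) : Continuous (val q) :=
  (contDiff_val q).continuous

theorem continuous_grad (q : MvPolynomial (Fin d) ℝ) : Continuous (grad q) :=
  (PiLp.continuous_toLp 2 (fun _ : Fin d => ℝ)).comp (continuous_pi fun _ => continuous_val _)

theorem fderiv_val_single (q : MvPolynomial (Fin d) ℝ) (x : E d) (k : Fin d) :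
    fderiv ℝ (val q) x (EuclideanSpace.single k 1) = val (MvPolynomial.pderiv k q) x := by
  have hd : ∀ q : MvPolynomial (Fin d) ℝ, DifferentiableAt ℝ (val q) x := fun q =>
    ((contDiff_val q).differentiable (by simp)) x
  induction q using MvPolynomial.induction_on with
  | C a =>
    have : val (d := d) (MvPolynomial.C a) = fun _ => a := by funext x; simp [val]
    rw [this]; simp [val]
  | add p q hp hq =>
    have : val (p + q) = fun x => val p x + val q x := funext fun x => val_add p q x
    rw [this, fderiv_fun_add (hd p) (hd q)]
    simp [hp, hq, val_add]
  | mul_X p i hp =>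
    have : val (p * MvPolynomial.X i) = fun x => val p x * x i := by
      funext x; simp [val]
    have hx : HasFDerivAt (fun x : E d => x i) (EuclideanSpace.proj i : E d →L[ℝ] ℝ) x :=
      (EuclideanSpace.proj i : E d →L[ℝ] ℝ).hasFDerivAt
    rw [this, ((hd p).hasFDerivAt.fun_mul hx).fderiv]
    by_cases h : k = i
    · subst h; simp [hp, val]
    · simp [hp, val, MvPolynomial.pderiv_X_of_ne (Ne.symm h), Ne.symm h]

/-- An open set contains a cube, and a polynomial vanishing on a product of infinite sets is zero.
-/
theorem eq_zero_of_val_eq_zero_on_open {q : MvPolynomial (Fin d) ℝ} {U : Set (E d)}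
    (hU : IsOpen U) (hne : U.Nonempty) (h : ∀ x ∈ U, val q x = 0) : q = 0 := by
  obtain ⟨x, hx⟩ := hne
  have hU' : IsOpen ((WithLp.toLp 2 : (Fin d → ℝ) → E d) ⁻¹' U) :=
    hU.preimage (PiLp.continuous_toLp 2 _)
  obtain ⟨ε, hε, hball⟩ := Metric.isOpen_iff.1 hU' (WithLp.ofLp x) (by simpa using hx)
  refine MvPolynomial.funext_set (fun i => Set.Ioo (x i - ε) (x i + ε))
    (fun i => Set.Ioo_infinite (by linarith)) fun y hy => ?_
  have : y ∈ Metric.ball (WithLp.ofLp x) ε := by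
    rw [mem_ball_iff_norm, pi_norm_lt_iff hε]
    intro i
    have := hy i trivial
    simp only [Pi.sub_apply, Real.norm_eq_abs, abs_lt]
    constructor <;> linarith [this.1, this.2]
  simpa [val] using h _ (hball this)

theorem integrableOn_of_continuous {f : E d → ℝ} (hf : Continuous f) {s : Set (E d)}
    (hm : MeasurableSet s) (hs : Bornology.IsBounded s) {μ : Measure (E d)} (hμ : μ s ≠ ⊤) : IntegrableOn f s μ := by
  obtain ⟨C, hC⟩ := (Metric.isCompact_of_isClosed_isBounded isClosed_closure
    hs.closure).exists_bound_of_continuousOn hf.continuousOn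
  exact Measure.integrableOn_of_bounded (M := C) hμ hf.aestronglyMeasurable
    (ae_restrict_of_forall_mem hm fun x hx => hC x (subset_closure hx))

end Polynomials

/-! ### Weak derivatives -/

section WeakDerivatives

variable {d : ℕ} {Ω : Set (E d)}

theorem integrable_mul_of_locallyIntegrableOn {f φ : E d → ℝ}
    (hf : LocallyIntegrableOn f Ω volume) (hφ : Continuous φ) (hc : HasCompactSupport φ)
    (hs : tsupport φ ⊆ Ω) : Integrable (fun x => f x * φ x) volume := by
  have h1 : IntegrableOn f (tsupport φ) volume := hf.integrableOn_compact_subset hs hc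
  have h2 : IntegrableOn (fun x => f x * φ x) (tsupport φ) volume :=
    h1.mul_continuousOn hφ.continuousOn hc
  refine (integrableOn_iff_integrable_of_support_subset fun x hx => ?_).1 h2
  exact subset_tsupport φ fun h => hx (by simp [h])

/-- This is the fundamental lemma of the calculus of variations for the difference; test functions
vanish off Ω, so integrals over Ω may be taken over the whole space. -/
theorem HasWeakPartial.ae_eq (hΩ : IsOpen Ω) {i : Fin d} {f g g' : E d → ℝ}
    (h : HasWeakPartial Ω i f g) (h' : HasWeakPartial Ω i f g') :
    g =ᵐ[volume.restrict Ω] g' := by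
  have key := hΩ.ae_eq_zero_of_integral_contDiff_smul_eq_zero (μ := volume)
    (f := fun x => g x - g' x) (h.2.1.sub h'.2.1) (fun φ hφ hc hs => by
      have h1 := h.2.2 φ hφ hc hs
      have h2 := h'.2.2 φ hφ hc hs
      have hz : ∀ k : E d → ℝ, ∫ x in Ω, k x * φ x = ∫ x, k x * φ x := fun k =>
        setIntegral_eq_integral_of_forall_compl_eq_zero fun x hx => by
          rw [image_eq_zero_of_notMem_tsupport (fun h => hx (hs h)), mul_zero]
      rw [hz] at h1 h2
      have i1 := integrable_mul_of_locallyIntegrableOn h.2.1 hφ.continuous hc hs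
      have i2 := integrable_mul_of_locallyIntegrableOn h'.2.1 hφ.continuous hc hs
      have : (fun x => φ x • (g x - g' x)) = fun x => g x * φ x - g' x * φ x := by
        funext x; simp only [smul_eq_mul]; ring
      rw [this, integral_sub i1 i2]
      linarith)
  refine (ae_restrict_iff' hΩ.measurableSet).2 ?_
  filter_upwards [key] with x hx hxΩ
  exact sub_eq_zero.1 (hx hxΩ)

theorem HasWeakPartial.congr_left {i : Fin d} {f f' g : E d → ℝ}
    (h : HasWeakPartial Ω i f g) (hff : f =ᵐ[volume.restrict Ω] f') :
    HasWeakPartial Ω i f' g := by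
  refine ⟨h.1.congr hff, h.2.1, fun φ hφ hc hs => ?_⟩
  rw [← h.2.2 φ hφ hc hs]
  refine integral_congr_ae ?_
  filter_upwards [hff] with x hx
  rw [hx]

theorem HasWeakPartial.congr_right {i : Fin d} {f g g' : E d → ℝ}
    (h : HasWeakPartial Ω i f g) (hgg : g =ᵐ[volume.restrict Ω] g') :
    HasWeakPartial Ω i f g' := by
  refine ⟨h.1, h.2.1.congr hgg, fun φ hφ hc hs => ?_⟩
  rw [h.2.2 φ hφ hc hs]
  congr 1
  refine integral_congr_ae ?_
  filter_upwards [hgg] with x hx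
  rw [hx]

theorem hasWeakPartial_weakPartial {i : Fin d} {f : E d → ℝ} (h : ∃ g, HasWeakPartial Ω i f g) :
    HasWeakPartial Ω i f (weakPartial Ω i f) := by
  unfold weakPartial
  split_ifs with h1
  · exact h1.choose_spec.2
  · exact h.choose_spec

theorem continuousOn_weakPartial {i : Fin d} {f : E d → ℝ}
    (h : ∃ g, ContinuousOn g Ω ∧ HasWeakPartial Ω i f g) :
    ContinuousOn (weakPartial Ω i f) Ω := by
  unfold weakPartial
  rw [dif_pos h]
  exact h.choose_spec.1

theorem norm_le_of_apply_single_le (A : E d →L[ℝ] ℝ) (c : Fin d → ℝ)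
    (h : ∀ j, |A (EuclideanSpace.single j 1)| ≤ c j) : ‖A‖ ≤ ∑ j, c j := by
  have hc : ∀ j, 0 ≤ c j := fun j => (abs_nonneg _).trans (h j)
  refine A.opNorm_le_bound (Finset.sum_nonneg fun j _ => hc j) fun v => ?_
  have hv : v = ∑ j, v j • (EuclideanSpace.single j 1 : E d) := by
    ext k; simp [Finset.sum_apply, Pi.single_apply]
  conv_lhs => rw [hv]
  rw [map_sum, Finset.sum_mul]
  refine (norm_sum_le _ _).trans (Finset.sum_le_sum fun j _ => ?_)
  rw [map_smul, norm_smul, mul_comm, Real.norm_eq_abs]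
  exact mul_le_mul (h j) (PiLp.norm_apply_le v j) (norm_nonneg _) (hc j)

/-- Mollifications of a function with bounded weak derivatives are Lipschitz on small balls. -/
theorem mollification_lipschitz (hΩ : IsOpen Ω) {g : E d → ℝ} {h : Fin d → E d → ℝ}
    {c : Fin d → ℝ} (hg : Integrable (Ω.indicator g) volume)
    (hh : ∀ j, HasWeakPartial Ω j g (h j))
    (hc : ∀ j, ∀ᵐ x ∂(volume.restrict Ω), |h j x| ≤ c j) (φ : ContDiffBump (0 : E d))
    {x₀ : E d} {r : ℝ} (hr : Metric.ball x₀ (2 * r) ⊆ Ω) (hφ : φ.rOut ≤ r) {x y : E d}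
    (hx : x ∈ Metric.ball x₀ r) (hy : y ∈ Metric.ball x₀ r) :
    |(φ.normed volume ⋆[ContinuousLinearMap.lsmul ℝ ℝ, volume] Ω.indicator g) x -
      (φ.normed volume ⋆[ContinuousLinearMap.lsmul ℝ ℝ, volume] Ω.indicator g) y| ≤
      (∑ j, c j) * ‖x - y‖ := by
  set ρ : E d → ℝ := φ.normed volume with hρ
  have hρs : HasCompactSupport ρ := φ.hasCompactSupport_normed
  have hρc : ContDiff ℝ ∞ ρ := φ.contDiff_normed
  -- Convolution is commutative; with the mollifier as the right factor, differentiation falls on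
  -- it.
  have hflip : (ρ ⋆[ContinuousLinearMap.lsmul ℝ ℝ, volume] Ω.indicator g) =
      (Ω.indicator g ⋆[ContinuousLinearMap.lsmul ℝ ℝ, volume] ρ) := by
    funext z
    rw [convolution_lsmul_swap, convolution_lsmul]
    simp only [smul_eq_mul, mul_comm]
  rw [hflip]
  have hder : ∀ z, HasFDerivAt (Ω.indicator g ⋆[ContinuousLinearMap.lsmul ℝ ℝ, volume] ρ)
      ((Ω.indicator g ⋆[(ContinuousLinearMap.lsmul ℝ ℝ).precompR (E d), volume] fderiv ℝ ρ) z)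
      z := fun z => hρs.hasFDerivAt_convolution_right _ hg.locallyIntegrable
        (hρc.of_le (by exact_mod_cast le_top)) z
  rw [← Real.norm_eq_abs]
  refine (convex_ball x₀ r).norm_image_sub_le_of_norm_hasFDerivWithin_le
    (fun z _ => (hder z).hasFDerivWithinAt) (fun z hz => ?_) hy hx
  refine norm_le_of_apply_single_le _ c fun j => ?_
  rw [convolution_precompR_apply _ hg.locallyIntegrable (hρs.fderiv ℝ)
    (hρc.continuous_fderiv (by simp)), convolution_lsmul]
  have hsm : ContDiff ℝ ∞ fun t => ρ (z - t) := hρc.comp (by fun_prop)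
  -- The reflected mollifier is an admissible test function: its support is within r of z, and z is
  -- within r of x₀, while the ball of radius 2r lies in Ω.
  have hts : tsupport (fun t => ρ (z - t)) ⊆ Metric.closedBall z φ.rOut := by
    refine closure_minimal (fun t ht => ?_) Metric.isClosed_closedBall
    have : z - t ∈ Function.support ρ := ht
    rw [φ.support_normed_eq] at this
    rw [Metric.mem_closedBall, dist_comm, dist_eq_norm]
    exact (mem_ball_zero_iff.1 this).le
  have htΩ : tsupport (fun t => ρ (z - t)) ⊆ Ω := by
    refine hts.trans (Set.Subset.trans (fun t ht => ?_) hr)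
    rw [Metric.mem_closedBall] at ht
    rw [Metric.mem_ball] at hz ⊢
    linarith [dist_triangle t z x₀]
  have hcs : HasCompactSupport fun t => ρ (z - t) :=
    (isCompact_closedBall z φ.rOut).of_isClosed_subset (isClosed_tsupport _) hts
  have hfd : ∀ t, fderiv ℝ (fun t => ρ (z - t)) t (EuclideanSpace.single j 1) =
      - fderiv ℝ ρ (z - t) (EuclideanSpace.single j 1) := by
    intro t
    have h1 : HasFDerivAt ρ (fderiv ℝ ρ (z - t)) (z - t) :=
      ((hρc.differentiable (by simp)) _).hasFDerivAt
    have h2 : HasFDerivAt (fun t : E d => z - t) (-ContinuousLinearMap.id ℝ (E d)) t :=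
      (hasFDerivAt_id t).const_sub z
    have h3 : HasFDerivAt (fun t => ρ (z - t)) _ t := h1.comp t h2
    rw [h3.fderiv]; simp
  -- The sign from the reflection cancels the sign of the weak derivative. Hence the j-th derivative
  -- of the mollification is the mollification of `h j`, bounded by `c j` since ρ is nonnegative
  -- with mass one.
  have hint : ∫ t, Ω.indicator g t • fderiv ℝ ρ (z - t) (EuclideanSpace.single j 1) =
      ∫ t in Ω, h j t * ρ (z - t) := by
    have := (hh j).2.2 _ hsm hcs htΩ
    simp only [hfd, mul_neg, integral_neg, neg_inj] at this
    rw [← this, ← integral_indicator hΩ.measurableSet]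
    refine integral_congr_ae (Eventually.of_forall fun t => ?_)
    by_cases ht : t ∈ Ω <;> simp [ht]
  rw [hint]
  have hint1 : ∫ t, ρ (z - t) = 1 := by
    rw [integral_sub_left_eq_self (fun t => ρ t)]; exact φ.integral_normed
  have hint2 : Integrable fun t => ρ (z - t) :=
    hsm.continuous.integrable_of_hasCompactSupport hcs
  have hc0 : 0 ≤ c j ∨ volume.restrict Ω = 0 := by
    by_contra! hcon
    have : (ae (volume.restrict Ω)).NeBot := ae_neBot.2 hcon.2
    obtain ⟨t, ht⟩ := (hc j).exists
    linarith [abs_nonneg (h j t)]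
  calc |∫ t in Ω, h j t * ρ (z - t)| ≤ ∫ t in Ω, c j * ρ (z - t) := by
        rw [← Real.norm_eq_abs]
        refine norm_integral_le_of_norm_le (hint2.const_mul _).integrableOn ?_
        filter_upwards [hc j] with t ht
        rw [norm_mul, Real.norm_eq_abs, Real.norm_of_nonneg (φ.nonneg_normed _)]
        gcongr
        exact φ.nonneg_normed _
    _ = c j * ∫ t in Ω, ρ (z - t) := integral_const_mul _ _
    _ = c j := by
        rw [setIntegral_eq_integral_of_forall_compl_eq_zero, hint1, mul_one]
        exact fun t ht => image_eq_zero_of_notMem_tsupport (f := fun t => ρ (z - t)) (fun h => ht (htΩ h))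

/-- A bounded function with bounded weak partial derivatives has a continuous representative. -/
theorem exists_continuousOn_ae_eq (hΩ : IsOpen Ω) {g : E d → ℝ} {h : Fin d → E d → ℝ}
    {c : Fin d → ℝ} (hg : Integrable (Ω.indicator g) volume)
    (hh : ∀ j, HasWeakPartial Ω j g (h j))
    (hc : ∀ j, ∀ᵐ x ∂(volume.restrict Ω), |h j x| ≤ c j) :
    ∃ g', ContinuousOn g' Ω ∧ g =ᵐ[volume.restrict Ω] g' := by
  -- Inner and outer radius keep the ratio 1/2; a bounded ratio is what makes the mollifications
  -- converge almost everywhere.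
  let φ : ℕ → ContDiffBump (0 : E d) := fun n =>
    ⟨1 / (n + 1 : ℝ) / 2, 1 / (n + 1 : ℝ), by positivity, half_lt_self (by positivity)⟩
  have hφ : Tendsto (fun n => (φ n).rOut) atTop (𝓝 0) := tendsto_one_div_add_atTop_nhds_zero_nat
  have hlim := ContDiffBump.ae_convolution_tendsto_right_of_locallyIntegrable (μ := volume)
    (K := 2) hφ (Eventually.of_forall fun n => by simp only [φ]; linarith) hg.locallyIntegrable
  set S : Set (E d) := {x | Tendsto (fun n => ((φ n).normed volume
    ⋆[ContinuousLinearMap.lsmul ℝ ℝ, volume] Ω.indicator g) x) atTop (𝓝 (Ω.indicator g x))}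
    with hS
  have hdense : Dense S := Measure.dense_of_ae hlim
  have hloc : ∀ x₀ ∈ Ω, ∃ k : E d → ℝ, Continuous k ∧ ∃ r > 0,
      Set.EqOn (Ω.indicator g) k (S ∩ Metric.ball x₀ r) := by
    intro x₀ hx₀
    obtain ⟨r, hr, hball⟩ := Metric.isOpen_iff.1 hΩ x₀ hx₀
    -- The Lipschitz bound of the mollifications does not depend on n, so it passes to the limit on
    -- the convergence set S.
    have hlip : LipschitzOnWith (Real.toNNReal (∑ j, c j)) (Ω.indicator g)
        (S ∩ Metric.ball x₀ (r / 2)) := by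
      refine LipschitzOnWith.of_dist_le_mul fun x hx y hy => ?_
      rw [Real.dist_eq, dist_eq_norm]
      have h1 : |Ω.indicator g x - Ω.indicator g y| ≤ (∑ j, c j) * ‖x - y‖ := by
        refine le_of_tendsto ((hx.1.sub hy.1).abs) ?_
        filter_upwards [hφ.eventually (gt_mem_nhds (half_pos hr))] with n hn
        exact mollification_lipschitz hΩ hg hh hc (φ n) (x₀ := x₀) (r := r / 2)
          (by rwa [mul_div_cancel₀ _ two_ne_zero]) hn.le hx.2 hy.2
      exact h1.trans (by gcongr; exact Real.le_coe_toNNReal _)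
    obtain ⟨k, hk, hk'⟩ := hlip.extend_real
    exact ⟨k, hk.continuous, r / 2, half_pos hr, hk'⟩
  -- The local Lipschitz extension shows that the limit along the dense set S exists at every point
  -- of Ω, also outside S; these limits define the continuous representative.
  have htend : ∀ x ∈ Ω, ∃ k : E d → ℝ, Continuous k ∧
      Tendsto (Ω.indicator g) (𝓝[S] x) (𝓝 (k x)) ∧ (x ∈ S → k x = Ω.indicator g x) := by
    intro x hx
    obtain ⟨k, hk, r, hr, heq⟩ := hloc x hx
    refine ⟨k, hk, ?_, fun hxS => (heq ⟨hxS, Metric.mem_ball_self hr⟩).symm⟩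
    refine ((hk.tendsto x).mono_left nhdsWithin_le_nhds).congr' ?_
    filter_upwards [self_mem_nhdsWithin, nhdsWithin_le_nhds (Metric.ball_mem_nhds x hr)]
      with y hy1 hy2
    exact (heq ⟨hy1, hy2⟩).symm
  refine ⟨extendFrom S (Ω.indicator g), continuousOn_extendFrom
    (fun x _ => hdense x) (fun x hx => ?_), ?_⟩
  · obtain ⟨k, -, hk, -⟩ := htend x hx
    exact ⟨_, hk⟩
  · refine (ae_restrict_iff' hΩ.measurableSet).2 ?_
    filter_upwards [hlim] with x hxS hxΩ
    obtain ⟨k, -, hk, hk'⟩ := htend x hxΩ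
    rw [extendFrom_eq (hdense x) hk, hk' hxS, Set.indicator_of_mem hxΩ]

/-- A violation at one point would persist on a nonempty open set, which has positive volume. -/
theorem forall_abs_le_of_ae {f : E d → ℝ} {C : ℝ} (hΩ : IsOpen Ω) (hf : ContinuousOn f Ω)
    (h : ∀ᵐ x ∂(volume.restrict Ω), |f x| ≤ C) : ∀ x ∈ Ω, |f x| ≤ C := by
  by_contra! hcon
  obtain ⟨x, hx, hxC⟩ := hcon
  have hopen : IsOpen (Ω ∩ (fun y => |f y|) ⁻¹' Set.Ioi C) :=
    hf.abs.isOpen_inter_preimage hΩ isOpen_Ioi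
  have hpos := hopen.measure_pos volume ⟨x, hx, hxC⟩
  rw [ae_restrict_iff' hΩ.measurableSet] at h
  refine hpos.ne' (measure_mono_null (fun y hy => ?_) h)
  simpa using hy

theorem MemLinf.ae_abs_le {f : E d → ℝ} (hf : MemLinf Ω f) :
    ∀ᵐ x ∂(volume.restrict Ω), |f x| ≤ normLinf Ω f := by
  have h1 := ae_le_eLpNormEssSup (f := f) (μ := volume.restrict Ω)
  filter_upwards [h1] with x hx
  rw [normLinf, eLpNorm_exponent_top]
  have hne : eLpNormEssSup f (volume.restrict Ω) ≠ ⊤ := by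
    have := hf.eLpNorm_ne_top; rwa [eLpNorm_exponent_top] at this
  have := ENNReal.toReal_mono hne hx
  simpa using this

theorem MemLinf.integrableOn {f : E d → ℝ} (hΩb : Bornology.IsBounded Ω) (hf : MemLinf Ω f) :
    IntegrableOn f Ω volume := by
  have : IsFiniteMeasure (volume.restrict Ω) := ⟨by
    rw [Measure.restrict_apply_univ]; exact hΩb.measure_lt_top⟩
  exact hf.integrable le_top

/-- The first weak derivatives of a `W^{2,∞}` function are continuous, bounded, and have bounded
weak derivatives. -/
theorem MemW2inf.weakPartial_spec (hΩ : IsOpen Ω) (hΩb : Bornology.IsBounded Ω)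
    {ψ : E d → ℝ} (hψ : MemW2inf Ω ψ) (i : Fin d) :
    ContinuousOn (weakPartial Ω i ψ) Ω ∧ (∃ C, ∀ x ∈ Ω, |weakPartial Ω i ψ x| ≤ C) ∧
      ∀ j, HasWeakPartial Ω j (weakPartial Ω i ψ) (weakPartial Ω j (weakPartial Ω i ψ)) ∧
        MemLinf Ω (weakPartial Ω j (weakPartial Ω i ψ)) := by
  obtain ⟨g, hg, hgL, hj⟩ := hψ.2 i
  choose h hh hhL using hj
  obtain ⟨g', hg', hgg'⟩ := exists_continuousOn_ae_eq hΩ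
    ((integrable_indicator_iff hΩ.measurableSet).2 (hgL.integrableOn hΩb)) hh
    (fun j => (hhL j).ae_abs_le)
  have hw := hasWeakPartial_weakPartial ⟨g, hg⟩
  -- The continuous representative forces the first branch of `weakPartial`, so its values on
  -- facets, which are null sets for volume, are meaningful.
  have hcont := continuousOn_weakPartial ⟨g', hg', hg.congr_right hgg'⟩
  have hgw : g =ᵐ[volume.restrict Ω] weakPartial Ω i ψ := hg.ae_eq hΩ hw
  refine ⟨hcont, ⟨normLinf Ω g, forall_abs_le_of_ae hΩ hcont ?_⟩, fun j => ?_⟩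
  · filter_upwards [hgw, hgL.ae_abs_le] with x hx hx'
    rwa [← hx]
  · have h1 := (hh j).congr_left hgw
    have h2 := hasWeakPartial_weakPartial ⟨h j, h1⟩
    exact ⟨h2, (memLp_congr_ae (h1.ae_eq hΩ h2)).1 (hhL j)⟩

end WeakDerivatives

/-! ### Hyperplanes and the surface measure -/

section Hyperplanes

variable {n : ℕ}

/-- An isometric parametrization of the orthogonal complement of a unit vector. -/
structure IsFrame (a : E (n + 1)) (ι : E n →ₗᵢ[ℝ] E (n + 1)) : Prop where
  norm_eq : ‖a‖ = 1
  inner_eq : ∀ y, ⟪a, ι y⟫ = 0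
  surj : ∀ x, ⟪a, x⟫ = 0 → ∃ y, ι y = x

theorem exists_isFrame {a : E (n + 1)} (ha : ‖a‖ = 1) : ∃ ι, IsFrame a ι := by
  have hfr : Module.finrank ℝ (ℝ ∙ a)ᗮ = n := by
    have : Fact (Module.finrank ℝ (E (n + 1)) = n + 1) := ⟨by simp⟩
    exact Submodule.finrank_orthogonal_span_singleton (by rintro rfl; simp at ha)
  let e : E n ≃ₗᵢ[ℝ] (ℝ ∙ a)ᗮ := ((stdOrthonormalBasis ℝ (ℝ ∙ a)ᗮ).reindex
    (finCongr hfr)).repr.symm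
  refine ⟨(Submodule.subtypeₗᵢ _).comp e.toLinearIsometry, ha, fun y => ?_, fun x hx => ?_⟩
  · exact Submodule.mem_orthogonal_singleton_iff_inner_right.1 (e y).2
  · exact ⟨e.symm ⟨x, Submodule.mem_orthogonal_singleton_iff_inner_right.2 hx⟩, by simp⟩

variable {a : E (n + 1)} {ι : E n →ₗᵢ[ℝ] E (n + 1)}

/-- By Pythagoras the parametrization is a linear isometry of the L² product; equal dimensions make
it an isometric equivalence, which preserves volume. -/
theorem IsFrame.measurePreserving (h : IsFrame a ι) :
    MeasurePreserving (fun z : ℝ × E n => z.1 • a + ι z.2) volume volume := by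
  let T : WithLp 2 (ℝ × E n) →ₗᵢ[ℝ] E (n + 1) :=
    { toLinearMap := ((LinearMap.toSpanSingleton ℝ (E (n + 1)) a).coprod ι.toLinearMap).comp
        (WithLp.linearEquiv 2 ℝ (ℝ × E n)).toLinearMap
      norm_map' := fun z => by
        have h1 : ‖z.fst • a + ι z.snd‖ ^ 2 = ‖z‖ ^ 2 := by
          rw [norm_add_sq_real, WithLp.prod_norm_sq_eq_of_L2, inner_smul_left, h.inner_eq,
            norm_smul, h.norm_eq]
          simp
        have h2 := (sq_eq_sq₀ (norm_nonneg _) (norm_nonneg _)).1 h1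
        simpa using h2 }
  have hfr : Module.finrank ℝ (WithLp 2 (ℝ × E n)) = Module.finrank ℝ (E (n + 1)) := by
    rw [(WithLp.linearEquiv 2 ℝ (ℝ × E n)).finrank_eq]; simp [add_comm]
  have h1 := (T.toLinearIsometryEquiv hfr).measurePreserving
  have h2 := h1.comp (WithLp.volume_preserving_toLp ℝ (E n))
  convert! h2 using 1

theorem IsFrame.inner_param (h : IsFrame a ι) (c : ℝ) (y : E n) : ⟪a, c • a + ι y⟫ = c := by
  rw [inner_add_right, inner_smul_right, h.inner_eq, real_inner_self_eq_norm_sq, h.norm_eq]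
  simp

theorem IsFrame.norm_le (h : IsFrame a ι) (c : ℝ) (y : E n) : ‖y‖ ≤ ‖c • a + ι y‖ := by
  have h1 : ‖c • a + ι y‖ ^ 2 = c ^ 2 + ‖y‖ ^ 2 := by
    rw [norm_add_sq_real, inner_smul_left, h.inner_eq, norm_smul, h.norm_eq]
    simp
  exact abs_le_of_sq_le_sq' (by rw [h1]; nlinarith [sq_nonneg c]) (norm_nonneg _) |>.2

theorem isometry_param (a : E (n + 1)) (ι : E n →ₗᵢ[ℝ] E (n + 1)) (c : ℝ) :
    Isometry fun y => c • a + ι y :=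
  Isometry.of_dist_eq fun x y => by simp

theorem measurableEmbedding_param (a : E (n + 1)) (ι : E n →ₗᵢ[ℝ] E (n + 1)) (c : ℝ) :
    MeasurableEmbedding fun y => c • a + ι y :=
  (isometry_param a ι c).isClosedEmbedding.measurableEmbedding

theorem IsFrame.range_param (h : IsFrame a ι) (c : ℝ) :
    Set.range (fun y => c • a + ι y) = {x | ⟪a, x⟫ = c} := by
  ext x
  constructor
  · rintro ⟨y, rfl⟩
    exact h.inner_param c y
  · intro hx
    obtain ⟨y, hy⟩ := h.surj (x - c • a) (by
      rw [inner_sub_right, inner_smul_right, real_inner_self_eq_norm_sq, h.norm_eq,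
        show ⟪a, x⟫ = c from hx]; simp)
    exact ⟨y, by simp [hy]⟩

/-- Isometries transport Hausdorff measure, and its Euclidean normalisation on `E n` is Lebesgue
measure. Surface integrals over pieces of a hyperplane thus become Lebesgue integrals. -/
theorem IsFrame.surf_restrict (h : IsFrame a ι) (c : ℝ) :
    (surf (n + 1)).restrict {x | ⟪a, x⟫ = c} = volume.map fun y => c • a + ι y := by
  rw [← h.range_param, ← EuclideanSpace.euclideanHausdorffMeasure_eq_volume,
    (isometry_param a ι c).map_euclideanHausdorffMeasure]
  simp [surf]

theorem IsFrame.surf_restrict_subset (h : IsFrame a ι) {c : ℝ} {S : Set (E (n + 1))}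
    (hS : MeasurableSet S) (hSH : S ⊆ {x | ⟪a, x⟫ = c}) :
    (surf (n + 1)).restrict S = (volume.map fun y => c • a + ι y).restrict S := by
  rw [← h.surf_restrict, Measure.restrict_restrict hS, Set.inter_eq_left.2 hSH]

theorem IsFrame.setIntegral_surf (h : IsFrame a ι) {c : ℝ} {S : Set (E (n + 1))}
    (hS : MeasurableSet S) (hSH : S ⊆ {x | ⟪a, x⟫ = c}) (f : E (n + 1) → ℝ) :
    ∫ x in S, f x ∂(surf (n + 1)) = ∫ y, S.indicator f (c • a + ι y) := by
  rw [h.surf_restrict_subset hS hSH, ← integral_indicator hS,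
    (measurableEmbedding_param a ι c).integral_map]

theorem IsFrame.surf_apply (h : IsFrame a ι) {c : ℝ} {S : Set (E (n + 1))}
    (hS : MeasurableSet S) (hSH : S ⊆ {x | ⟪a, x⟫ = c}) :
    surf (n + 1) S = volume ((fun y => c • a + ι y) ⁻¹' S) := by
  rw [← (measurableEmbedding_param a ι c).map_apply, ← Measure.restrict_apply_self,
    h.surf_restrict_subset hS hSH, Measure.restrict_apply_self]

theorem IsFrame.ae_of_ae_surf (h : IsFrame a ι) {c : ℝ} {S : Set (E (n + 1))}
    (hS : MeasurableSet S) {p : E (n + 1) → Prop}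
    (hp : ∀ᵐ x ∂((surf (n + 1)).restrict S), p x) :
    ∀ᵐ y : E n, c • a + ι y ∈ S → p (c • a + ι y) := by
  rw [ae_restrict_iff' hS] at hp
  have h1 := ae_restrict_of_ae (s := {x | ⟪a, x⟫ = c}) hp
  rw [h.surf_restrict] at h1
  exact (measurableEmbedding_param a ι c).ae_map_iff.1 h1

theorem measurableSet_hyperplane (a : E n) (c : ℝ) : MeasurableSet {x : E n | ⟪a, x⟫ = c} :=
  (isClosed_eq (by fun_prop) continuous_const).measurableSet

theorem surf_lt_top_of_bounded {a : E (n + 1)} (ha : ‖a‖ = 1) {c : ℝ} {S : Set (E (n + 1))}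
    (hS : MeasurableSet S) (hSH : S ⊆ {x | ⟪a, x⟫ = c}) (hSb : Bornology.IsBounded S) :
    surf (n + 1) S < ⊤ := by
  obtain ⟨ι, h⟩ := exists_isFrame ha
  rw [h.surf_apply hS hSH]
  exact ((isometry_param a ι c).antilipschitz.isBounded_preimage hSb).measure_lt_top

theorem volume_level_set_eq_zero {n : ℕ} (L : E n →ₗ[ℝ] ℝ) (hL : L ≠ 0) (r : ℝ) :
    volume {y | L y = r} = 0 := by
  have h := Measure.addHaar_affineSubspace (volume : Measure (E n))
    ((AffineSubspace.mk' r (⊥ : Submodule ℝ ℝ)).comap L.toAffineMap) (fun htop => hL ?_)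
  · convert! h using 2
    ext y; simp [sub_eq_zero]
  · have hm : ∀ y, L y = r := fun y => by
      have : y ∈ (AffineSubspace.mk' r (⊥ : Submodule ℝ ℝ)).comap L.toAffineMap := by
        rw [htop]; trivial
      simpa [sub_eq_zero] using this
    ext y
    simpa [hm y] using (hm 0).symm

/-- If b were orthogonal to all directions of the first hyperplane it would be a multiple of a,
hence ±a. So the second hyperplane cuts the first in a proper affine subspace, possibly empty. -/
theorem surf_inter_hyperplanes_eq_zero {a b : E (n + 1)} (ha : ‖a‖ = 1) (hb : ‖b‖ = 1)
    (hab : b ≠ a) (hab' : b ≠ -a) (c r : ℝ) :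
    surf (n + 1) ({x | ⟪a, x⟫ = c} ∩ {x | ⟪b, x⟫ = r}) = 0 := by
  obtain ⟨ι, h⟩ := exists_isFrame ha
  rw [h.surf_apply ((measurableSet_hyperplane a c).inter (measurableSet_hyperplane b r))
    Set.inter_subset_left]
  let L : E n →ₗ[ℝ] ℝ := (innerₗ (E (n + 1)) b).comp ι.toLinearMap
  have hL : L ≠ 0 := by
    intro hL
    obtain ⟨y, hy⟩ := h.surj (b - ⟪a, b⟫ • a) (by
      rw [inner_sub_right, inner_smul_right, real_inner_self_eq_norm_sq, ha]; simp)
    have h1 : ⟪b, ι y⟫ = 0 := by simpa [L] using LinearMap.congr_fun hL y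
    have h2 : ⟪b - ⟪a, b⟫ • a, ι y⟫ = 0 := by
      rw [inner_sub_left, inner_smul_left, h1, h.inner_eq]; simp
    rw [← hy] at h2
    have h3 : b = ⟪a, b⟫ • a := by
      rw [inner_self_eq_zero.1 h2] at hy
      exact sub_eq_zero.1 hy.symm
    have h4 : |⟪a, b⟫| = 1 := by
      have := congrArg norm h3
      rw [norm_smul, ha, hb] at this
      simpa using this.symm
    rcases (abs_eq zero_le_one).1 h4 with h5 | h5 <;> rw [h5] at h3
    · exact hab (by simpa using h3)
    · exact hab' (by simpa using h3)
  refine measure_mono_null (fun y hy => ?_) (volume_level_set_eq_zero L hL (r - c * ⟪b, a⟫))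
  have := hy.2
  simp only [Set.mem_ofPred_eq, inner_add_right, inner_smul_right] at this
  simp only [L, Set.mem_ofPred_eq, LinearMap.comp_apply, innerₗ_apply_apply,
    LinearIsometry.coe_toLinearMap]
  linarith

/-- Scaling of the layers parallel to a hyperplane. -/
theorem IsFrame.integral_layer (h : IsFrame a ι) (c : ℝ) {ε : ℝ} (hε : 0 < ε)
    (F : E (n + 1) → ℝ) :
    ∫ x, F x = ε * ∫ z : ℝ × E n, F ((c - ε * z.1) • a + ι z.2) := by
  -- The map t ↦ c - εt has Jacobian ε; the sign puts t > 0 on the inner side of the hyperplane.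
  let e : ℝ ≃ₜ ℝ := (Homeomorph.mulLeft₀ (-ε) (neg_ne_zero.2 hε.ne')).trans (Homeomorph.addLeft c)
  have he : Measure.map e volume = ENNReal.ofReal ε⁻¹ • (volume : Measure ℝ) := by
    have h1 : (e : ℝ → ℝ) = (fun x => c + x) ∘ fun x => -ε * x := rfl
    rw [h1, ← Measure.map_map (by fun_prop) (by fun_prop),
      Real.map_volume_mul_left (neg_ne_zero.2 hε.ne'), Measure.map_smul, map_add_left_eq_self]
    simp [abs_of_pos hε]
  let S : ℝ × E n ≃ₜ ℝ × E n := e.prodCongr (Homeomorph.refl (E n))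
  have hS : Measure.map S volume = ENNReal.ofReal ε⁻¹ • (volume : Measure (ℝ × E n)) := by
    have h1 : (S : ℝ × E n → ℝ × E n) = Prod.map e id := rfl
    rw [h1, Measure.volume_eq_prod, ← Measure.map_prod_map _ _ e.measurable measurable_id, he,
      Measure.map_id, Measure.prod_smul_left]
  have h2 : ∫ x, F x = ∫ z : ℝ × E n, F (z.1 • a + ι z.2) := by
    have hemb : MeasurableEmbedding fun z : ℝ × E n => z.1 • a + ι z.2 := by
      refine (Continuous.measurableEmbedding (by fun_prop) fun z w hzw => ?_)
      have h1 : z.1 = w.1 := by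
        rw [← h.inner_param z.1 z.2, ← h.inner_param w.1 w.2]; exact congrArg _ hzw
      refine Prod.ext h1 (ι.injective ?_)
      simp only [h1] at hzw
      exact add_left_cancel hzw
    rw [← h.measurePreserving.map_eq, hemb.integral_map]
  have h3 : ∫ z : ℝ × E n, F ((c - ε * z.1) • a + ι z.2) =
      ∫ z, F (z.1 • a + ι z.2) ∂(Measure.map S volume) := by
    rw [S.measurableEmbedding.integral_map]
    refine integral_congr_ae (Eventually.of_forall fun z => ?_)
    have : (S z).1 = c - ε * z.1 := by simp [S, e]; ring
    simp only [this]
    rfl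
  rw [h3, hS, integral_smul_measure, h2, ENNReal.toReal_ofReal (by positivity), smul_eq_mul,
    mul_inv_cancel_left₀ hε.ne']

end Hyperplanes

/-! ### Green's formula on a convex polytope -/

section Green

variable {d n : ℕ}

/-- A smooth transition from `0` on `(-∞, 1]` to `1` on `[2, ∞)`. -/
noncomputable def ramp (t : ℝ) : ℝ := Real.smoothTransition (t - 1)

theorem contDiff_ramp : ContDiff ℝ ∞ ramp :=
  (Real.smoothTransition.contDiff (n := ⊤)).comp (contDiff_id.sub contDiff_const)

theorem ramp_eq_zero {t : ℝ} (h : t ≤ 1) : ramp t = 0 :=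
  Real.smoothTransition.zero_of_nonpos (by linarith)

theorem ramp_eq_one {t : ℝ} (h : 2 ≤ t) : ramp t = 1 :=
  Real.smoothTransition.one_of_one_le (by linarith)

theorem ramp_nonneg (t : ℝ) : 0 ≤ ramp t := Real.smoothTransition.nonneg _

theorem ramp_le_one (t : ℝ) : ramp t ≤ 1 := Real.smoothTransition.le_one _

theorem continuous_deriv_ramp : Continuous (deriv ramp) :=
  contDiff_ramp.continuous_deriv (by simp)

theorem deriv_ramp_eq_zero_left {t : ℝ} (h : t < 1) : deriv ramp t = 0 := by
  have : ramp =ᶠ[𝓝 t] fun _ => 0 := by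
    filter_upwards [gt_mem_nhds h] with s hs using ramp_eq_zero (le_of_lt hs)
  rw [this.deriv_eq, deriv_const]

theorem deriv_ramp_eq_zero_right {t : ℝ} (h : 2 < t) : deriv ramp t = 0 := by
  have : ramp =ᶠ[𝓝 t] fun _ => 1 := by
    filter_upwards [lt_mem_nhds h] with s hs using ramp_eq_one (le_of_lt hs)
  rw [this.deriv_eq, deriv_const]

theorem hasCompactSupport_deriv_ramp : HasCompactSupport (deriv ramp) :=
  HasCompactSupport.intro (isCompact_Icc (a := (1 : ℝ)) (b := 2)) fun t ht => by
    rw [Set.mem_Icc, not_and_or, not_le, not_le] at ht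
    exact ht.elim deriv_ramp_eq_zero_left deriv_ramp_eq_zero_right

theorem integral_deriv_ramp : ∫ t, deriv ramp t = 1 := by
  have h1 : ∫ t, deriv ramp t = ∫ t in (1 : ℝ)..2, deriv ramp t := by
    rw [intervalIntegral.integral_of_le one_le_two, ← integral_Icc_eq_integral_Ioc]
    refine (setIntegral_eq_integral_of_forall_compl_eq_zero fun t ht => ?_).symm
    rw [Set.mem_Icc, not_and_or, not_le, not_le] at ht
    exact ht.elim deriv_ramp_eq_zero_left deriv_ramp_eq_zero_right
  rw [h1, intervalIntegral.integral_deriv_eq_sub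
    (fun t _ => (contDiff_ramp.differentiable (by simp)) t)
    (continuous_deriv_ramp.intervalIntegrable _ _), ramp_eq_one le_rfl, ramp_eq_zero le_rfl, sub_zero]

/-- The open polytope given by finitely many half-spaces. -/
def halfspaces (s : Finset (E d × ℝ)) : Set (E d) := {x | ∀ a ∈ s, ⟪a.1, x⟫ < a.2}

/-- The relatively open face of `halfspaces s` on the hyperplane `a`. -/
def face (s : Finset (E d × ℝ)) (a : E d × ℝ) : Set (E d) :=
  {x | ⟪a.1, x⟫ = a.2 ∧ ∀ b ∈ s, b ≠ a → ⟪b.1, x⟫ < b.2}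

theorem isOpen_halfspaces (s : Finset (E d × ℝ)) : IsOpen (halfspaces s) := by
  have : halfspaces s = ⋂ a ∈ s, {x : E d | ⟪a.1, x⟫ < a.2} := by
    ext x; simp [halfspaces]
  rw [this]
  exact isOpen_biInter_finset fun a _ => isOpen_lt (by fun_prop) continuous_const

theorem closure_halfspaces_subset (s : Finset (E d × ℝ)) :
    closure (halfspaces s) ⊆ {x | ∀ a ∈ s, ⟪a.1, x⟫ ≤ a.2} := by
  refine closure_minimal (fun x hx a ha => (hx a ha).le) ?_
  have : {x : E d | ∀ a ∈ s, ⟪a.1, x⟫ ≤ a.2} = ⋂ a ∈ s, {x : E d | ⟪a.1, x⟫ ≤ a.2} := by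
    ext x; simp
  rw [this]
  exact isClosed_biInter fun a _ => isClosed_le (by fun_prop) continuous_const

theorem measurableSet_face (s : Finset (E d × ℝ)) (a : E d × ℝ) : MeasurableSet (face s a) := by
  have : face s a = {x : E d | ⟪a.1, x⟫ = a.2} ∩ ⋂ b ∈ s.filter (· ≠ a),
      {x : E d | ⟪b.1, x⟫ < b.2} := by
    ext x; simp [face]
  rw [this]
  exact (measurableSet_hyperplane a.1 a.2).inter (isOpen_biInter_finset fun a _ =>
    isOpen_lt (by fun_prop) continuous_const).measurableSet

/-- Points close to a face in an inward direction lie in the polytope. -/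
theorem eventually_mem_halfspaces {s : Finset (E d × ℝ)} {a : E d × ℝ} {x v : E d}
    (hx : x ∈ face s a) (hv : ⟪a.1, v⟫ < 0) :
    ∀ᶠ ε in 𝓝[>] (0 : ℝ), x + ε • v ∈ halfspaces s := by
  have hev : ∀ b ∈ s, ∀ᶠ ε in 𝓝[>] (0 : ℝ), ⟪b.1, x + ε • v⟫ < b.2 := by
    intro b hb
    by_cases hba : b = a
    · subst hba
      filter_upwards [self_mem_nhdsWithin] with ε (hε : 0 < ε)
      rw [inner_add_right, inner_smul_right, hx.1]
      nlinarith
    · have hc : Continuous fun ε : ℝ => ⟪b.1, x + ε • v⟫ := by fun_prop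
      have := hc.tendsto 0
      simp only [zero_smul, add_zero] at this
      exact nhdsWithin_le_nhds (this.eventually (gt_mem_nhds (hx.2 b hb hba)))
  exact (Filter.eventually_all_finset s).2 hev

theorem tendsto_add_smul_nhdsGT (x v : E d) :
    Tendsto (fun ε : ℝ => x + ε • v) (𝓝[>] 0) (𝓝 x) := by
  have hc : Continuous fun ε : ℝ => x + ε • v := by fun_prop
  have h1 := (hc.tendsto 0).mono_left (nhdsWithin_le_nhds (s := Set.Ioi 0))
  simpa only [zero_smul, add_zero] using h1

theorem face_subset_closure {s : Finset (E d × ℝ)} {a : E d × ℝ} (ha : ‖a.1‖ = 1) :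
    face s a ⊆ closure (halfspaces s) := fun x hx =>
  mem_closure_of_tendsto (tendsto_add_smul_nhdsGT x (-a.1)) (eventually_mem_halfspaces hx (by
    rw [inner_neg_right, real_inner_self_eq_norm_sq, ha]; norm_num))

/-- Distinct constraints with equal normals have disjoint hyperplanes; with opposite normals, a
common point would make the polytope empty. All other pairs are transversal. -/
theorem surf_inter_faces_eq_zero {s : Finset (E (n + 1) × ℝ)} (hs : ∀ a ∈ s, ‖a.1‖ = 1)
    (hne : (halfspaces s).Nonempty) {a b : E (n + 1) × ℝ} (ha : a ∈ s) (hb : b ∈ s)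
    (hab : b ≠ a) :
    surf (n + 1) ({x | ⟪a.1, x⟫ = a.2} ∩ {x | ⟪b.1, x⟫ = b.2}) = 0 := by
  have hempty : b.1 = a.1 ∨ b.1 = -a.1 →
      ({x : E (n + 1) | ⟪a.1, x⟫ = a.2} ∩ {x | ⟪b.1, x⟫ = b.2}) = ∅ := by
    intro h
    rw [Set.eq_empty_iff_forall_notMem]
    rintro x ⟨hx1, hx2⟩
    simp only [Set.mem_ofPred_eq] at hx1 hx2
    obtain ⟨z, hz⟩ := hne
    have hz1 := hz a ha
    have hz2 := hz b hb
    rcases h with h | h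
    · rw [h, hx1] at hx2
      exact hab (Prod.ext h hx2.symm)
    · rw [h, inner_neg_left] at hx2 hz2
      linarith
  by_cases h1 : b.1 = a.1
  · rw [hempty (Or.inl h1), measure_empty]
  by_cases h2 : b.1 = -a.1
  · rw [hempty (Or.inr h2), measure_empty]
  exact surf_inter_hyperplanes_eq_zero (hs a ha) (hs b hb) h1 h2 _ _

/-- The scaled distance to the hyperplane `b`. -/
noncomputable def level (ε : ℝ) (b : E d × ℝ) (x : E d) : ℝ := (b.2 - ⟪b.1, x⟫) / ε

/-- A smooth cutoff function for the polytope. -/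
noncomputable def cutoff (s : Finset (E d × ℝ)) (ε : ℝ) (x : E d) : ℝ := ∏ b ∈ s, ramp (level ε b x)

/-- The part of the normal derivative of the cutoff function coming from the hyperplane `a`. -/
noncomputable def layer (s : Finset (E d × ℝ)) (ε : ℝ) (a : E d × ℝ) (x : E d) : ℝ :=
  (∏ b ∈ s.erase a, ramp (level ε b x)) * deriv ramp (level ε a x)

theorem contDiff_level (ε : ℝ) (b : E d × ℝ) : ContDiff ℝ ∞ (level ε b) := by
  unfold level
  exact (contDiff_const.sub (contDiff_const.inner ℝ contDiff_id)).div_const ε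

theorem contDiff_cutoff (s : Finset (E d × ℝ)) (ε : ℝ) : ContDiff ℝ ∞ (cutoff s ε) :=
  contDiff_prod fun b _ => contDiff_ramp.comp (contDiff_level ε b)

theorem continuous_layer (s : Finset (E d × ℝ)) (ε : ℝ) (a : E d × ℝ) :
    Continuous (layer s ε a) :=
  (continuous_finsetProd _ fun b _ => (contDiff_ramp.comp (contDiff_level ε b)).continuous).mul
    (continuous_deriv_ramp.comp (contDiff_level ε a).continuous)

theorem fderiv_cutoff_single (s : Finset (E d × ℝ)) (ε : ℝ) (x : E d) (k : Fin d) :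
    fderiv ℝ (cutoff s ε) x (EuclideanSpace.single k 1) =
      - ε⁻¹ * ∑ a ∈ s, layer s ε a x * a.1 k := by
  have h1 : ∀ b ∈ s, HasFDerivAt (fun x => ramp (level ε b x))
      (deriv ramp (level ε b x) • (-ε⁻¹ • innerSL ℝ b.1 : E d →L[ℝ] ℝ)) x := by
    intro b _
    have h2 : HasFDerivAt (level ε b) (-ε⁻¹ • innerSL ℝ b.1 : E d →L[ℝ] ℝ) x := by
      have h3 := ((innerSL ℝ b.1).hasFDerivAt (x := x)).const_sub b.2 |>.const_mul ε⁻¹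
      have h4 : level ε b = fun y => ε⁻¹ * (b.2 - innerSL ℝ b.1 y) := by
        funext y; simp [level, div_eq_inv_mul]
      rw [h4]
      simpa using h3
    exact ((contDiff_ramp.differentiable (by simp)) _).hasDerivAt.comp_hasFDerivAt x h2
  have h5 := HasFDerivAt.finsetProd h1
  have h6 : cutoff s ε = fun x => ∏ b ∈ s, ramp (level ε b x) := rfl
  rw [h6, h5.fderiv, sum_apply, Finset.mul_sum]
  refine Finset.sum_congr rfl fun a _ => ?_
  simp [layer, EuclideanSpace.inner_single_right]
  ring

/-- Since `ramp` vanishes up to 1, a nonzero product keeps every slack at least ε. This makes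
multiples of the cutoff compactly supported inside a bounded polytope. -/
theorem cutoff_ne_zero {s : Finset (E d × ℝ)} {ε : ℝ} (hε : 0 < ε) {x : E d}
    (h : cutoff s ε x ≠ 0) : ∀ b ∈ s, ε ≤ b.2 - ⟪b.1, x⟫ := by
  intro b hb
  by_contra! hlt
  refine h (Finset.prod_eq_zero hb (ramp_eq_zero ?_))
  rw [level, div_le_one hε]; exact hlt.le

theorem layer_ne_zero {s : Finset (E d × ℝ)} {ε : ℝ} (hε : 0 < ε) {a : E d × ℝ} {x : E d}
    (h : layer s ε a x ≠ 0) : ∀ b ∈ s, ε ≤ b.2 - ⟪b.1, x⟫ := by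
  intro b hb
  by_contra! hlt
  by_cases hba : b = a
  · subst hba
    refine h (mul_eq_zero_of_right _ (deriv_ramp_eq_zero_left ?_))
    rwa [level, div_lt_one hε]
  · refine h (mul_eq_zero_of_left (Finset.prod_eq_zero (Finset.mem_erase.2 ⟨hba, hb⟩)
      (ramp_eq_zero ?_)) _)
    rw [level, div_le_one hε]; exact hlt.le

theorem cutoff_mem_Icc (s : Finset (E d × ℝ)) (ε : ℝ) (x : E d) :
    cutoff s ε x ∈ Set.Icc (0 : ℝ) 1 :=
  ⟨Finset.prod_nonneg fun _ _ => ramp_nonneg _,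
    Finset.prod_le_one (fun _ _ => ramp_nonneg _) fun _ _ => ramp_le_one _⟩

theorem tendsto_cutoff {s : Finset (E d × ℝ)} {x : E d} (hx : x ∈ halfspaces s) :
    Tendsto (fun ε => cutoff s ε x) (𝓝[>] 0) (𝓝 1) := by
  refine tendsto_const_nhds.congr' ?_
  have hev : ∀ b ∈ s, ∀ᶠ ε in 𝓝[>] (0 : ℝ), ramp (level ε b x) = 1 := by
    intro b hb
    have hpos : 0 < (b.2 - ⟪b.1, x⟫) / 2 := by linarith [hx b hb]
    filter_upwards [self_mem_nhdsWithin, nhdsWithin_le_nhds (gt_mem_nhds hpos)] with ε hε hε'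
    refine ramp_eq_one ?_
    rw [level, le_div_iff₀ hε]; linarith
  filter_upwards [(Filter.eventually_all_finset s).2 hev] with ε hε
  exact (Finset.prod_eq_one hε).symm

/-- Continuous functions supported where all distances to the hyperplanes are at least `ε` have
compact support in a bounded polytope. -/
theorem compact_support_of_ne_zero {s : Finset (E d × ℝ)} {ε : ℝ} (hε : 0 < ε)
    (hb : Bornology.IsBounded (halfspaces s)) {φ : E d → ℝ}
    (hφ : ∀ x, φ x ≠ 0 → ∀ b ∈ s, ε ≤ b.2 - ⟪b.1, x⟫) :
    HasCompactSupport φ ∧ tsupport φ ⊆ halfspaces s := by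
  have hcl : IsClosed {x : E d | ∀ b ∈ s, ε ≤ b.2 - ⟪b.1, x⟫} := by
    have : {x : E d | ∀ b ∈ s, ε ≤ b.2 - ⟪b.1, x⟫} =
        ⋂ b ∈ s, {x : E d | ε ≤ b.2 - ⟪b.1, x⟫} := by ext x; simp
    rw [this]
    exact isClosed_biInter fun a _ => isClosed_le continuous_const (by fun_prop)
  have hsub : {x : E d | ∀ b ∈ s, ε ≤ b.2 - ⟪b.1, x⟫} ⊆ halfspaces s :=
    fun x hx b hb => by linarith [hx b hb]
  have hts : tsupport φ ⊆ {x : E d | ∀ b ∈ s, ε ≤ b.2 - ⟪b.1, x⟫} := closure_minimal hφ hcl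
  exact ⟨(Metric.isCompact_of_isClosed_isBounded hcl (hb.subset hsub)).of_isClosed_subset
    (isClosed_tsupport _) hts, hts.trans hsub⟩

end Green

/-! ### The limit of the cutoff argument -/

section Green

variable {n : ℕ}

theorem measurable_indicator_of_continuousOn {d : ℕ} {Ω : Set (E d)} (hΩ : IsOpen Ω)
    {f : E d → ℝ} (hf : ContinuousOn f Ω) : Measurable (Ω.indicator f) := by
  classical
  rw [← Set.piecewise_eq_indicator]
  exact hf.measurable_piecewise continuousOn_const hΩ.measurableSet

/-- The limit of the integrals over thin layers along a face is the integral over the face. -/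
theorem tendsto_integral_layer {s : Finset (E (n + 1) × ℝ)} (hs : ∀ a ∈ s, ‖a.1‖ = 1)
    (hb : Bornology.IsBounded (halfspaces s)) (hne : (halfspaces s).Nonempty)
    {a : E (n + 1) × ℝ} (ha : a ∈ s) {Ω : Set (E (n + 1))} (hΩ : IsOpen Ω)
    (hKΩ : halfspaces s ⊆ Ω) {q g : E (n + 1) → ℝ} (hq : Continuous q) (hg : ContinuousOn g Ω)
    {C : ℝ} (hC : ∀ x ∈ Ω, |g x| ≤ C)
    (hq0 : ∀ᵐ x ∂((surf (n + 1)).restrict (closure (halfspaces s) ∩ frontier Ω)), q x = 0) :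
    Tendsto (fun ε => ∫ x in Ω, ε⁻¹ * (layer s ε a x * (q x * g x))) (𝓝[>] 0)
      (𝓝 (∫ x in face s a ∩ Ω, q x * g x ∂(surf (n + 1)))) := by
  obtain ⟨ι, hι⟩ := exists_isFrame (hs a ha)
  have hC0 : 0 ≤ C := by
    obtain ⟨z, hz⟩ := hne
    exact (abs_nonneg _).trans (hC z (hKΩ hz))
  -- Extension by zero off Ω is measurable, but it need not be continuous at ∂Ω; only the bound by
  -- |q| C is available there.
  set f : E (n + 1) → ℝ := Ω.indicator fun x => q x * g x with hf
  have hfm : Measurable f := measurable_indicator_of_continuousOn hΩ (hq.continuousOn.mul hg)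
  obtain ⟨R, hR⟩ := hb.exists_norm_le
  obtain ⟨Q, hQ⟩ := (Metric.isCompact_of_isClosed_isBounded isClosed_closure
    hb.closure).exists_bound_of_continuousOn hq.continuousOn
  have hfle : ∀ x, |f x| ≤ |q x| * C := by
    intro x
    by_cases hx : x ∈ Ω
    · rw [hf, Set.indicator_of_mem hx, abs_mul]
      gcongr
      exact hC x hx
    · rw [hf, Set.indicator_of_notMem hx, abs_zero]; positivity
  have hQC : ∀ x ∈ halfspaces s, |f x| ≤ Q * C := fun x hx =>
    (hfle x).trans (by gcongr; exact hQ x (subset_closure hx))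
  -- In these coordinates the scaled distance to the hyperplane `a` is the first variable, so the
  -- layer of width of order ε becomes the fixed slab 1 ≤ t ≤ 2, and the Jacobian absorbs the factor
  -- ε⁻¹.
  let Φ : ℝ → ℝ × E n → E (n + 1) := fun ε z => (a.2 - ε * z.1) • a.1 + ι z.2
  have hΦ : ∀ ε, Continuous (Φ ε) := fun ε => by simp only [Φ]; fun_prop
  have hΦ0 : ∀ z, Tendsto (fun ε => Φ ε z) (𝓝[>] 0) (𝓝 (a.2 • a.1 + ι z.2)) := by
    intro z
    have hc : Continuous fun ε => Φ ε z := by simp only [Φ]; fun_prop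
    have := (hc.tendsto 0).mono_left (nhdsWithin_le_nhds (s := Set.Ioi 0))
    simpa [Φ] using this
  have hlev : ∀ ε > 0, ∀ z, level ε a (Φ ε z) = z.1 := by
    intro ε hε z
    rw [level, hι.inner_param, sub_sub_cancel, mul_div_cancel_left₀ _ hε.ne']
  have hint : ∀ ε ∈ Set.Ioi (0 : ℝ), ∫ x in Ω, ε⁻¹ * (layer s ε a x * (q x * g x)) =
      ∫ z, layer s ε a (Φ ε z) * f (Φ ε z) := by
    intro ε hε
    have h1 : ∫ x in Ω, ε⁻¹ * (layer s ε a x * (q x * g x)) =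
        ∫ x, ε⁻¹ * (layer s ε a x * f x) := by
      rw [← integral_indicator hΩ.measurableSet]
      refine integral_congr_ae (Eventually.of_forall fun x => ?_)
      by_cases hx : x ∈ Ω <;> simp [f, hx]
    rw [h1, integral_const_mul, hι.integral_layer a.2 hε, ← mul_assoc,
      inv_mul_cancel₀ (ne_of_gt hε), one_mul]
  -- The limit integrand is a product: the normal factor `deriv ramp` has integral one and the
  -- tangential factor gives the face integral.
  have hlim : ∫ z : ℝ × E n, deriv ramp z.1 *
      ((face s a ∩ Ω).indicator (fun x => q x * g x) (a.2 • a.1 + ι z.2)) =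
      ∫ x in face s a ∩ Ω, q x * g x ∂(surf (n + 1)) := by
    rw [hι.setIntegral_surf ((measurableSet_face s a).inter hΩ.measurableSet)
      (fun x hx => hx.1.1), Measure.volume_eq_prod,
      integral_prod_mul (fun t => deriv ramp t) (fun y : E n =>
        (face s a ∩ Ω).indicator (fun x => q x * g x) (a.2 • a.1 + ι y)),
      integral_deriv_ramp, one_mul]
  rw [← hlim]
  refine Tendsto.congr' (eventually_of_mem self_mem_nhdsWithin fun ε hε => (hint ε hε).symm) ?_
  -- Where the layer is nonzero the point lies in the bounded polytope, so |y| ≤ R and |f| ≤ QC; the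
  -- remaining ramp factors are at most one.
  refine tendsto_integral_filter_of_dominated_convergence
    (fun z => |deriv ramp z.1| * (Metric.closedBall (0 : E n) R).indicator (fun _ => Q * C) z.2)
    ?_ ?_ ?_ ?_
  · refine Eventually.of_forall fun ε => ?_
    exact ((continuous_layer s ε a).comp (hΦ ε)).aestronglyMeasurable.mul
      (hfm.comp (hΦ ε).measurable).aestronglyMeasurable
  · refine eventually_of_mem self_mem_nhdsWithin fun ε (hε : 0 < ε) =>
      Eventually.of_forall fun z => ?_
    have hnn : 0 ≤ |deriv ramp z.1| *
        (Metric.closedBall (0 : E n) R).indicator (fun _ => Q * C) z.2 := by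
      refine mul_nonneg (abs_nonneg _) (Set.indicator_nonneg (fun _ _ => ?_) _)
      obtain ⟨w, hw⟩ := hne
      exact (abs_nonneg _).trans (hQC w hw)
    by_cases hl : layer s ε a (Φ ε z) = 0
    · rw [hl, zero_mul, norm_zero]; exact hnn
    have hmem : Φ ε z ∈ halfspaces s := fun b hb' => by
      linarith [layer_ne_zero hε hl b hb']
    have hz2 : z.2 ∈ Metric.closedBall (0 : E n) R :=
      mem_closedBall_zero_iff.2 ((hι.norm_le _ _).trans (hR _ hmem))
    rw [Set.indicator_of_mem hz2, norm_mul, Real.norm_eq_abs, Real.norm_eq_abs, layer, abs_mul,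
      hlev ε hε]
    refine mul_le_mul ?_ (hQC _ hmem) (abs_nonneg _) (abs_nonneg _)
    refine mul_le_of_le_one_left (abs_nonneg _) ?_
    rw [abs_of_nonneg (Finset.prod_nonneg fun _ _ => ramp_nonneg _)]
    exact Finset.prod_le_one (fun _ _ => ramp_nonneg _) fun _ _ => ramp_le_one _
  · refine Integrable.mul_prod (f := fun t => |deriv ramp t|) ?_ ?_
    · exact (continuous_deriv_ramp.integrable_of_hasCompactSupport
        hasCompactSupport_deriv_ramp).abs
    · rw [integrable_indicator_iff measurableSet_closedBall]
      exact integrableOn_const measure_closedBall_lt_top.ne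
  · have hgood1 : ∀ b ∈ s, ∀ᵐ y : E n, b ≠ a → ⟪b.1, a.2 • a.1 + ι y⟫ ≠ b.2 := by
      intro b hb'
      by_cases hba : b = a
      · exact Eventually.of_forall fun _ h => absurd hba h
      have h0 := surf_inter_faces_eq_zero hs hne ha hb' hba
      rw [hι.surf_apply ((measurableSet_hyperplane _ _).inter (measurableSet_hyperplane _ _))
        Set.inter_subset_left] at h0
      filter_upwards [measure_eq_zero_iff_ae_notMem.1 h0] with y hy _ h
      exact hy ⟨hι.inner_param _ _, h⟩
    have hgood2 := hι.ae_of_ae_surf (c := a.2)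
      (isClosed_closure.inter isClosed_frontier).measurableSet hq0
    have hgood : ∀ᵐ y : E n, (∀ b ∈ s, b ≠ a → ⟪b.1, a.2 • a.1 + ι y⟫ ≠ b.2) ∧
        (a.2 • a.1 + ι y ∈ closure (halfspaces s) ∩ frontier Ω → q (a.2 • a.1 + ι y) = 0) :=
      ((Filter.eventually_all_finset s).2 hgood1).and hgood2
    have hprod : ∀ᵐ z : ℝ × E n, (∀ b ∈ s, b ≠ a → ⟪b.1, a.2 • a.1 + ι z.2⟫ ≠ b.2) ∧
        (a.2 • a.1 + ι z.2 ∈ closure (halfspaces s) ∩ frontier Ω →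
          q (a.2 • a.1 + ι z.2) = 0) := by
      rw [Measure.volume_eq_prod]
      exact Measure.quasiMeasurePreserving_snd.ae hgood
    filter_upwards [hprod] with z hz
    set x₀ := a.2 • a.1 + ι z.2 with hx₀
    by_cases hface : x₀ ∈ face s a
    · have hone : ∀ᶠ ε in 𝓝[>] (0 : ℝ), layer s ε a (Φ ε z) = deriv ramp z.1 := by
        have hev : ∀ b ∈ s.erase a, ∀ᶠ ε in 𝓝[>] (0 : ℝ), ramp (level ε b (Φ ε z)) = 1 := by
          intro b hb'
          rw [Finset.mem_erase] at hb'
          have hpos := hface.2 b hb'.2 hb'.1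
          have h1 : Tendsto (fun ε => b.2 - ⟪b.1, Φ ε z⟫) (𝓝[>] 0) (𝓝 (b.2 - ⟪b.1, x₀⟫)) :=
            tendsto_const_nhds.sub (tendsto_const_nhds.inner (hΦ0 z))
          have h2 : (b.2 - ⟪b.1, x₀⟫) / 2 < b.2 - ⟪b.1, x₀⟫ := half_lt_self (by linarith)
          have h3 : 0 < (b.2 - ⟪b.1, x₀⟫) / 4 := by linarith
          filter_upwards [self_mem_nhdsWithin, h1.eventually (lt_mem_nhds h2),
            nhdsWithin_le_nhds (gt_mem_nhds h3)] with ε hε h4 h5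
          refine ramp_eq_one ?_
          rw [level, le_div_iff₀ hε]; linarith
        filter_upwards [self_mem_nhdsWithin, (Filter.eventually_all_finset _).2 hev] with ε hε h6
        rw [layer, Finset.prod_eq_one h6, one_mul, hlev ε hε]
      have hfl : Tendsto (fun ε => f (Φ ε z)) (𝓝[>] 0)
          (𝓝 ((face s a ∩ Ω).indicator (fun x => q x * g x) x₀)) := by
        by_cases hxΩ : x₀ ∈ Ω
        · rw [Set.indicator_of_mem (show x₀ ∈ face s a ∩ Ω from ⟨hface, hxΩ⟩)]
          have h1 : ContinuousAt (fun x => q x * g x) x₀ :=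
            hq.continuousAt.mul (hg.continuousAt (hΩ.mem_nhds hxΩ))
          refine (h1.tendsto.comp (hΦ0 z)).congr' ?_
          filter_upwards [(hΦ0 z).eventually (hΩ.mem_nhds hxΩ)] with ε hε
          have hε' : Φ ε z ∈ Ω := hε
          simp [f, hε']
        -- A face point outside Ω lies on ∂Ω, where q vanishes almost everywhere. As g is bounded,
        -- the product tends to zero even if g has no limit there.
        · rw [Set.indicator_of_notMem (fun h : x₀ ∈ face s a ∩ Ω => hxΩ h.2)]
          have hcl : x₀ ∈ closure (halfspaces s) := face_subset_closure (hs a ha) hface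
          have hfr : x₀ ∈ frontier Ω :=
            ⟨closure_mono hKΩ hcl, by rwa [hΩ.interior_eq]⟩
          have hq00 : q x₀ = 0 := hz.2 ⟨hcl, hfr⟩
          have h1 : Tendsto (fun ε => |q (Φ ε z)| * C) (𝓝[>] 0) (𝓝 0) := by
            have := (((hq.tendsto x₀).comp (hΦ0 z)).abs.mul_const C)
            simpa [hq00] using this
          exact squeeze_zero_norm (fun ε => hfle _) h1
      refine (tendsto_const_nhds.mul hfl).congr' ?_
      filter_upwards [hone] with ε hε
      rw [hε]
    -- Off the face, and outside a null set, another constraint is strictly violated; it stays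
    -- violated for small ε, and the layer vanishes.
    · rw [Set.indicator_of_notMem (fun h : x₀ ∈ face s a ∩ Ω => hface h.1), mul_zero]
      refine tendsto_const_nhds.congr' ?_
      have hex : ∃ b ∈ s, b ≠ a ∧ b.2 < ⟪b.1, x₀⟫ := by
        by_contra! hcon
        exact hface ⟨hι.inner_param _ _, fun b hb' hba =>
          lt_of_le_of_ne (hcon b hb' hba) (hz.1 b hb' hba)⟩
      obtain ⟨b, hb', hba, hlt⟩ := hex
      have h1 : Tendsto (fun ε => ⟪b.1, Φ ε z⟫) (𝓝[>] 0) (𝓝 ⟪b.1, x₀⟫) :=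
        tendsto_const_nhds.inner (hΦ0 z)
      filter_upwards [self_mem_nhdsWithin, h1.eventually (lt_mem_nhds hlt)] with ε hε h2
      by_cases hl : layer s ε a (Φ ε z) = 0
      · rw [hl, zero_mul]
      · have := layer_ne_zero hε hl b hb'
        have hε' : (0 : ℝ) < ε := hε
        linarith

/-- Green's formula on a convex polytope for a field which is continuous and bounded on a
neighbourhood `Ω` of the polytope, has a bounded weak divergence in `Ω`, and is multiplied with a
polynomial which vanishes on the boundary of `Ω`. -/
theorem green_polytope {s : Finset (E (n + 1) × ℝ)} (hs : ∀ a ∈ s, ‖a.1‖ = 1)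
    (hb : Bornology.IsBounded (halfspaces s)) (hne : (halfspaces s).Nonempty)
    {Ω : Set (E (n + 1))} (hΩ : IsOpen Ω) (hΩb : Bornology.IsBounded Ω)
    (hKΩ : halfspaces s ⊆ Ω) (q : MvPolynomial (Fin (n + 1)) ℝ) {g : E (n + 1) → E (n + 1)}
    (hg : ContinuousOn g Ω) {C : ℝ} (hC : ∀ x ∈ Ω, ‖g x‖ ≤ C)
    {h : Fin (n + 1) → E (n + 1) → ℝ} (hgh : ∀ k, HasWeakPartial Ω k (fun x => g x k) (h k))
    (hhL : ∀ k, MemLinf Ω (h k))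
    (hq0 : ∀ᵐ x ∂((surf (n + 1)).restrict (closure (halfspaces s) ∩ frontier Ω)),
      val q x = 0) :
    ∫ x in halfspaces s, (⟪g x, grad q x⟫ + (∑ k, h k x) * val q x) =
      ∑ a ∈ s, ∫ x in face s a ∩ Ω, val q x * ⟪g x, a.1⟫ ∂(surf (n + 1)) := by
  set K := halfspaces s with hK
  have hKo : IsOpen K := isOpen_halfspaces s
  have hgk : ∀ k, ContinuousOn (fun x => g x k) Ω := fun k =>
    (EuclideanSpace.proj k : E (n + 1) →L[ℝ] ℝ).continuous.comp_continuousOn hg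
  let F : E (n + 1) → ℝ := fun x => ⟪g x, grad q x⟫ + (∑ k, h k x) * val q x
  have hcs : ∀ ε > 0, ∀ r : E (n + 1) → ℝ,
      HasCompactSupport (fun x => r x * cutoff s ε x) ∧
        tsupport (fun x => r x * cutoff s ε x) ⊆ K := fun ε hε r =>
    compact_support_of_ne_zero hε hb fun x hx => cutoff_ne_zero hε (right_ne_zero_of_mul hx)
  have hKint : IntegrableOn F K := by
    have h1 : IntegrableOn (fun x => ⟪g x, grad q x⟫) K := by
      obtain ⟨G, hG⟩ := (Metric.isCompact_of_isClosed_isBounded isClosed_closure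
        hb.closure).exists_bound_of_continuousOn (continuous_grad q).continuousOn
      refine IntegrableOn.of_bound hb.measure_lt_top
        (((hg.mono hKΩ).inner (continuous_grad q).continuousOn).aestronglyMeasurable
          hKo.measurableSet) (C * G) (ae_restrict_of_forall_mem hKo.measurableSet fun x hx => ?_)
      exact (norm_inner_le_norm _ _).trans (mul_le_mul (hC x (hKΩ hx)) (hG x (subset_closure hx))
        (norm_nonneg _) ((norm_nonneg _).trans (hC x (hKΩ hx))))
    have h2 : ∀ k, IntegrableOn (fun x => h k x * val q x) K := fun k => by
      have h3 := ((hhL k).integrableOn hΩb).mono_set hKΩ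
      obtain ⟨G, hG⟩ := (Metric.isCompact_of_isClosed_isBounded isClosed_closure
        hb.closure).exists_bound_of_continuousOn (continuous_val q).continuousOn
      exact Integrable.mul_bdd (c := G) h3 (continuous_val q).aestronglyMeasurable
        (ae_restrict_of_forall_mem hKo.measurableSet fun x hx => hG x (subset_closure hx))
    refine h1.add ?_
    simp only [Finset.sum_mul]
    exact integrable_finsetSum _ fun k _ => h2 k
  -- The weak derivatives are tested with q times the cutoff. Differentiating the cutoff yields the
  -- layers with weights -ε⁻¹ a.1 k, which sum over k to the normal component of g.
  have hident : ∀ ε > 0, ∫ x in K, cutoff s ε x * F x =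
      ∑ a ∈ s, ∫ x in Ω, ε⁻¹ * (layer s ε a x * (val q x * ⟪g x, a.1⟫)) := by
    intro ε hε
    have hk : ∀ k, ∫ x in Ω, (g x k * (val (MvPolynomial.pderiv k q) x * cutoff s ε x) +
        h k x * (val q x * cutoff s ε x)) =
        ∑ a ∈ s, ∫ x in Ω, g x k * (ε⁻¹ * a.1 k * (val q x * layer s ε a x)) := by
      intro k
      have hφ : ContDiff ℝ ∞ fun x => val q x * cutoff s ε x :=
        (contDiff_val q).mul (contDiff_cutoff s ε)
      obtain ⟨hφc, hφs⟩ := hcs ε hε (val q)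
      have h1 := (hgh k).2.2 _ hφ hφc (hφs.trans hKΩ)
      have hfd : ∀ x, fderiv ℝ (fun x => val q x * cutoff s ε x) x
          (EuclideanSpace.single k 1) = val (MvPolynomial.pderiv k q) x * cutoff s ε x -
            ∑ a ∈ s, ε⁻¹ * a.1 k * (val q x * layer s ε a x) := by
        intro x
        have hd1 := ((contDiff_val q).differentiable (by simp)) x
        have hd2 := ((contDiff_cutoff s ε).differentiable (by simp)) x
        rw [fderiv_fun_mul hd1 hd2]
        simp only [add_apply, smul_apply, smul_eq_mul,
          fderiv_val_single, fderiv_cutoff_single, Finset.mul_sum, neg_mul, Finset.sum_neg_distrib,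
          mul_neg]
        rw [add_comm, mul_comm (cutoff s ε x), ← sub_eq_add_neg]
        congr 1
        exact Finset.sum_congr rfl fun a _ => by ring
      have hi1 : IntegrableOn (fun x => g x k *
          (val (MvPolynomial.pderiv k q) x * cutoff s ε x)) Ω :=
        (integrable_mul_of_locallyIntegrableOn (hgh k).1
          ((continuous_val _).mul (contDiff_cutoff s ε).continuous) (hcs ε hε _).1
          ((hcs ε hε _).2.trans hKΩ)).integrableOn
      have hi2 : IntegrableOn (fun x => h k x * (val q x * cutoff s ε x)) Ω :=
        (integrable_mul_of_locallyIntegrableOn (hgh k).2.1 hφ.continuous hφc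
          (hφs.trans hKΩ)).integrableOn
      have hi3 : ∀ a ∈ s, IntegrableOn (fun x => g x k *
          (ε⁻¹ * a.1 k * (val q x * layer s ε a x))) Ω := fun a _ => by
        have hsup := compact_support_of_ne_zero (φ := fun x =>
          ε⁻¹ * a.1 k * (val q x * layer s ε a x)) hε hb fun x hx =>
            layer_ne_zero hε (right_ne_zero_of_mul (right_ne_zero_of_mul hx))
        exact (integrable_mul_of_locallyIntegrableOn (hgh k).1
          (continuous_const.mul ((continuous_val q).mul (continuous_layer s ε a))) hsup.1
          (hsup.2.trans hKΩ)).integrableOn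
      simp only [hfd, mul_sub, Finset.mul_sum] at h1
      rw [integral_sub hi1 (integrable_finsetSum _ hi3), integral_finsetSum _ hi3] at h1
      rw [integral_add hi1 hi2]
      linarith
    have hsum : ∑ k, ∫ x in Ω, (g x k * (val (MvPolynomial.pderiv k q) x * cutoff s ε x) +
        h k x * (val q x * cutoff s ε x)) = ∫ x in K, cutoff s ε x * F x := by
      have hi : ∀ k, IntegrableOn (fun x => g x k *
          (val (MvPolynomial.pderiv k q) x * cutoff s ε x) +
            h k x * (val q x * cutoff s ε x)) Ω := fun k =>
        ((integrable_mul_of_locallyIntegrableOn (hgh k).1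
          ((continuous_val _).mul (contDiff_cutoff s ε).continuous) (hcs ε hε _).1
          ((hcs ε hε _).2.trans hKΩ)).add (integrable_mul_of_locallyIntegrableOn (hgh k).2.1
          ((continuous_val q).mul (contDiff_cutoff s ε).continuous) (hcs ε hε _).1
          ((hcs ε hε _).2.trans hKΩ))).integrableOn
      rw [← integral_finsetSum _ fun k _ => hi k]
      have hpt : ∀ x, ∑ k, (g x k * (val (MvPolynomial.pderiv k q) x * cutoff s ε x) +
          h k x * (val q x * cutoff s ε x)) = cutoff s ε x * F x := by
        intro x
        simp only [F, PiLp.inner_apply, grad_apply, Finset.sum_mul, mul_add, Finset.mul_sum,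
          Finset.sum_add_distrib, RCLike.inner_apply, conj_trivial]
        congr 1 <;> exact Finset.sum_congr rfl fun k _ => by ring
      simp only [hpt]
      refine (setIntegral_eq_of_subset_of_forall_sdiff_eq_zero hΩ.measurableSet hKΩ
        fun x hx => ?_)
      rw [mul_eq_zero]
      left
      by_contra hne0
      exact hx.2 fun b hb' => by linarith [cutoff_ne_zero hε hne0 b hb']
    rw [← hsum, Finset.sum_congr rfl fun k _ => hk k, Finset.sum_comm]
    refine Finset.sum_congr rfl fun a ha => ?_
    rw [← integral_finsetSum]
    · refine integral_congr_ae (Eventually.of_forall fun x => ?_)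
      simp only [PiLp.inner_apply, Finset.mul_sum, RCLike.inner_apply, conj_trivial]
      exact Finset.sum_congr rfl fun k _ => by ring
    · intro k _
      have hsup := compact_support_of_ne_zero (φ := fun x =>
        ε⁻¹ * a.1 k * (val q x * layer s ε a x)) hε hb fun x hx =>
          layer_ne_zero hε (right_ne_zero_of_mul (right_ne_zero_of_mul hx))
      exact (integrable_mul_of_locallyIntegrableOn (hgh k).1
        (continuous_const.mul ((continuous_val q).mul (continuous_layer s ε a))) hsup.1
        (hsup.2.trans hKΩ)).integrableOn
  have hleft : Tendsto (fun ε => ∫ x in K, cutoff s ε x * F x) (𝓝[>] 0) (𝓝 (∫ x in K, F x)) := by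
    refine tendsto_integral_filter_of_dominated_convergence (fun x => |F x|)
      (Eventually.of_forall fun ε => (contDiff_cutoff s ε).continuous.aestronglyMeasurable.mul
        hKint.aestronglyMeasurable) (Eventually.of_forall fun ε => Eventually.of_forall fun x => ?_)
      hKint.abs (ae_restrict_of_forall_mem hKo.measurableSet fun x hx => ?_)
    · rw [norm_mul, Real.norm_of_nonneg (cutoff_mem_Icc s ε x).1, Real.norm_eq_abs]
      exact mul_le_of_le_one_left (abs_nonneg _) (cutoff_mem_Icc s ε x).2
    · simpa using (tendsto_cutoff hx).mul_const (F x)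
  have hright : Tendsto (fun ε => ∑ a ∈ s, ∫ x in Ω,
      ε⁻¹ * (layer s ε a x * (val q x * ⟪g x, a.1⟫))) (𝓝[>] 0)
      (𝓝 (∑ a ∈ s, ∫ x in face s a ∩ Ω, val q x * ⟪g x, a.1⟫ ∂(surf (n + 1)))) := by
    refine tendsto_finsetSum _ fun a ha => ?_
    refine tendsto_integral_layer hs hb hne ha hΩ hKΩ (continuous_val q)
      (hg.inner continuousOn_const) (C := C) (fun x hx => ?_) hq0
    have := norm_inner_le_norm (𝕜 := ℝ) (g x) a.1
    rw [hs a ha, mul_one, Real.norm_eq_abs] at this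
    exact this.trans (hC x hx)
  refine tendsto_nhds_unique (hleft.congr' ?_) hright
  exact eventually_of_mem self_mem_nhdsWithin fun ε hε => hident ε hε

end Green

/-! ### Geometry of meshes -/

section MeshGeometry

variable {d n m : ℕ}

/-- The hyperplane with unit normal `ν` and offset `c` separates `A` from `B`. -/
structure Separates (ν : E d) (c : ℝ) (A B : Set (E d)) : Prop where
  norm_eq : ‖ν‖ = 1
  le : ∀ x ∈ A, ⟪ν, x⟫ ≤ c
  ge : ∀ x ∈ B, c ≤ ⟪ν, x⟫

theorem Separates.closure {ν : E d} {c : ℝ} {A B : Set (E d)} (h : Separates ν c A B) :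
    Separates ν c (closure A) (closure B) where
  norm_eq := h.norm_eq
  le := closure_minimal (t := {x | ⟪ν, x⟫ ≤ c}) h.le (isClosed_le (by fun_prop) continuous_const)
  ge := closure_minimal (t := {x | c ≤ ⟪ν, x⟫}) h.ge (isClosed_le continuous_const (by fun_prop))

theorem Separates.neg {ν : E d} {c : ℝ} {A B : Set (E d)} (h : Separates ν c A B) :
    Separates (-ν) (-c) B A where
  norm_eq := by rw [norm_neg, h.norm_eq]
  le x hx := by rw [inner_neg_left]; exact neg_le_neg (h.ge x hx)
  ge x hx := by rw [inner_neg_left]; exact neg_le_neg (h.le x hx)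

theorem convex_halfspaces (s : Finset (E d × ℝ)) : Convex ℝ (halfspaces s) := by
  have : halfspaces s = ⋂ a ∈ s, {x : E d | innerₗ (E d) a.1 x < a.2} := by
    ext x; simp [halfspaces]
  rw [this]
  exact convex_iInter₂ fun a _ => convex_halfSpace_lt (innerₗ (E d) a.1).isLinear a.2

/-- Hahn–Banach gives a functional that is strict on the open set; as both sets are nonempty it is
nonzero, and its Riesz vector can be normalised. -/
theorem exists_separates {A B : Set (E d)} (hA : Convex ℝ A) (hAo : IsOpen A)
    (hAn : A.Nonempty) (hB : Convex ℝ B) (hBn : B.Nonempty) (hAB : Disjoint A B) :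
    ∃ ν c, Separates ν c A B := by
  obtain ⟨f, u, hfA, hfB⟩ := geometric_hahn_banach_open hA hAo hB hAB
  have hf : ∀ x, ⟪(InnerProductSpace.toDual ℝ (E d)).symm f, x⟫ = f x := fun x => by simp
  set w := (InnerProductSpace.toDual ℝ (E d)).symm f with hw
  have hw0 : 0 < ‖w‖ := by
    rw [norm_pos_iff]
    intro h0
    obtain ⟨x, hx⟩ := hAn
    obtain ⟨y, hy⟩ := hBn
    have h1 := hfA x hx
    have h2 := hfB y hy
    rw [← hf, h0, inner_zero_left] at h1 h2
    linarith
  refine ⟨‖w‖⁻¹ • w, ‖w‖⁻¹ * u, ?_, fun x hx => ?_, fun x hx => ?_⟩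
  · rw [norm_smul, norm_inv, norm_norm, inv_mul_cancel₀ hw0.ne']
  · rw [inner_smul_left, hf]
    exact mul_le_mul_of_nonneg_left (hfA x hx).le (by simp)
  · rw [inner_smul_left, hf]
    exact mul_le_mul_of_nonneg_left (hfB x hx) (by simp)

theorem separates_unitNormal {A B : Set (E d)} (h : ∃ ν c, Separates ν c A B) :
    ∃ c, Separates (unitNormal A B) c A B := by
  have h' : ∃ n : E d, ‖n‖ = 1 ∧ ∃ c : ℝ, (∀ x ∈ A, ⟪n, x⟫ ≤ c) ∧ ∀ x ∈ B, c ≤ ⟪n, x⟫ := by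
    obtain ⟨ν, c, hν⟩ := h
    exact ⟨ν, hν.norm_eq, c, hν.le, hν.ge⟩
  rw [unitNormal, dif_pos h']
  obtain ⟨h1, c, h2, h3⟩ := h'.choose_spec
  exact ⟨c, h1, h2, h3⟩

/-- At a point in the relative interior of a face, the separating hyperplane is the one of the
face. -/
theorem Separates.eq_of_mem_face {s : Finset (E d × ℝ)} {a : E d × ℝ} (ha : ‖a.1‖ = 1)
    {ν : E d} {c : ℝ} {B : Set (E d)} (h : Separates ν c (halfspaces s) B) {x : E d}
    (hx : x ∈ face s a) (hxB : x ∈ _root_.closure B) : ν = a.1 ∧ c = a.2 := by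
  have hxc : ⟪ν, x⟫ = c :=
    le_antisymm (h.closure.le x (face_subset_closure ha hx)) (h.closure.ge x hxB)
  -- For distinct unit vectors, ν - a.1 points into the polytope at the face yet increases ⟪ν, ·⟫
  -- beyond c, contradicting separation.
  have hν : ν = a.1 := by
    by_contra hne
    have h1 : 0 < ‖ν - a.1‖ ^ 2 := by
      have := norm_pos_iff.2 (sub_ne_zero.2 hne); positivity
    rw [norm_sub_sq_real, h.norm_eq, ha] at h1
    have h2 : ⟪a.1, ν - a.1⟫ < 0 := by
      rw [inner_sub_right, real_inner_self_eq_norm_sq, ha, real_inner_comm]; linarith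
    obtain ⟨ε, hε, hε0⟩ := ((eventually_mem_halfspaces hx h2).and self_mem_nhdsWithin).exists
    have h3 := h.le _ hε
    rw [inner_add_right, inner_smul_right, hxc, inner_sub_right, real_inner_self_eq_norm_sq,
      h.norm_eq] at h3
    have hε0' : (0 : ℝ) < ε := hε0
    nlinarith
  exact ⟨hν, by rw [← hxc, hν, hx.1]⟩

/-- A small move against ν stays in the open set, which excludes equality. -/
theorem lt_inner_of_isOpen {B : Set (E d)} (hB : IsOpen B) {ν : E d} (hν : ‖ν‖ = 1) {c : ℝ}
    (h : ∀ x ∈ B, c ≤ ⟪ν, x⟫) {x : E d} (hx : x ∈ B) : c < ⟪ν, x⟫ := by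
  obtain ⟨ε, hε, hε0⟩ := (((tendsto_add_smul_nhdsGT x (-ν)).eventually
    (hB.mem_nhds hx)).and self_mem_nhdsWithin).exists
  have h1 := h _ hε
  rw [inner_add_right, inner_smul_right, inner_neg_right, real_inner_self_eq_norm_sq, hν] at h1
  have hε0' : (0 : ℝ) < ε := hε0
  linarith

/-- Constraints with zero normal hold everywhere because they hold at one point of K, so they can be
dropped; the others are divided by the norm of their normal. -/
theorem IsOpenPolytope.exists_halfspaces {K : Set (E d)} (h : IsOpenPolytope K) :
    ∃ s : Finset (E d × ℝ), (∀ a ∈ s, ‖a.1‖ = 1) ∧ K = halfspaces s := by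
  classical
  obtain ⟨⟨z, hz⟩, -, s, rfl⟩ := h
  refine ⟨(s.filter fun a => a.1 ≠ 0).image fun a => (‖a.1‖⁻¹ • a.1, ‖a.1‖⁻¹ * a.2), ?_, ?_⟩
  · intro a ha
    obtain ⟨b, hb, rfl⟩ := Finset.mem_image.1 ha
    have := norm_ne_zero_iff.2 (Finset.mem_filter.1 hb).2
    simp [norm_smul, inv_mul_cancel₀ this]
  · ext x
    simp only [halfspaces, Set.mem_ofPred_eq, Finset.mem_image, Finset.mem_filter]
    constructor
    · rintro h _ ⟨b, ⟨hb, hb0⟩, rfl⟩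
      have := norm_pos_iff.2 hb0
      rw [inner_smul_left]
      exact mul_lt_mul_of_pos_left (h b hb) (by simpa using hb0)
    · intro h b hb
      by_cases hb0 : b.1 = 0
      · have := hz b hb
        rwa [hb0, inner_zero_left] at this ⊢
      · have h1 := h _ ⟨b, ⟨hb, hb0⟩, rfl⟩
        rw [inner_smul_left] at h1
        exact lt_of_mul_lt_mul_left h1 (by simp)

theorem facet_comm (Ω : Set (E d)) (K : Fin m → Set (E d)) (i j : Fin m) :
    facet Ω K i j = facet Ω K j i := by
  rw [facet, facet, Set.inter_comm (closure (K i))]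

theorem measurableSet_facet {Ω : Set (E d)} (hΩ : IsOpen Ω) (K : Fin m → Set (E d))
    (i j : Fin m) : MeasurableSet (facet Ω K i j) :=
  (isClosed_closure.inter isClosed_closure).measurableSet.inter hΩ.measurableSet

variable {Ω : Set (E (n + 1))} {K : Fin m → Set (E (n + 1))}

theorem IsMesh.isOpen {d : ℕ} {Ω : Set (E d)} {K : Fin m → Set (E d)} (hK : IsMesh Ω K)
    (i : Fin m) : IsOpen (K i) := by
  obtain ⟨s, -, hs⟩ := (hK.polytope i).exists_halfspaces
  rw [hs]; exact isOpen_halfspaces s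

theorem IsMesh.isBounded {d : ℕ} {Ω : Set (E d)} {K : Fin m → Set (E d)} (hK : IsMesh Ω K)
    (i : Fin m) : Bornology.IsBounded (K i) := (hK.polytope i).2.1

theorem IsMesh.separates {d : ℕ} {Ω : Set (E d)} {K : Fin m → Set (E d)} (hK : IsMesh Ω K)
    {i j : Fin m} (hij : i ≠ j) : ∃ c, Separates (unitNormal (K i) (K j)) c (K i) (K j) := by
  obtain ⟨s, -, hs⟩ := (hK.polytope i).exists_halfspaces
  obtain ⟨t, -, ht⟩ := (hK.polytope j).exists_halfspaces
  refine separates_unitNormal (exists_separates ?_ (hK.isOpen i) (hK.polytope i).1 ?_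
    (hK.polytope j).1 (hK.disjoint i j hij))
  · rw [hs]; exact convex_halfspaces s
  · rw [ht]; exact convex_halfspaces t

theorem IsMesh.norm_unitNormal {d : ℕ} {Ω : Set (E d)} {K : Fin m → Set (E d)}
    (hK : IsMesh Ω K) {i j : Fin m} (hij : i ≠ j) : ‖unitNormal (K i) (K j)‖ = 1 :=
  (hK.separates hij).choose_spec.norm_eq

theorem IsMesh.surf_facet_lt_top (hΩ : IsOpen Ω) (hK : IsMesh Ω K) {i j : Fin m} (hij : i ≠ j) :
    surf (n + 1) (facet Ω K i j) < ⊤ := by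
  obtain ⟨c, hc⟩ := hK.separates hij
  refine surf_lt_top_of_bounded (c := c) hc.norm_eq (measurableSet_facet hΩ K i j)
    (fun x hx => ?_) ((hK.isBounded i).closure.subset fun x hx => hx.1.1)
  exact le_antisymm (hc.closure.le x hx.1.1) (hc.closure.ge x hx.1.2)

/-- Bounded continuous functions are integrable over the facets. -/
theorem IsMesh.integrableOn_facet (hΩ : IsOpen Ω) (hK : IsMesh Ω K) {i j : Fin m} (hij : i ≠ j)
    {f : E (n + 1) → ℝ} (hf : ContinuousOn f Ω) {C : ℝ}
    (hC : ∀ x ∈ closure (K i) ∩ Ω, ‖f x‖ ≤ C) :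
    IntegrableOn f (facet Ω K i j) (surf (n + 1)) :=
  IntegrableOn.of_bound (hK.surf_facet_lt_top hΩ hij)
    ((hf.mono fun _ hx => hx.2).aestronglyMeasurable (measurableSet_facet hΩ K i j)) C
    (ae_restrict_of_forall_mem (measurableSet_facet hΩ K i j) fun x hx => hC x ⟨hx.1.1, hx.2⟩)

theorem IsMesh.notMem_of_mem_closure {d : ℕ} {Ω : Set (E d)} {K : Fin m → Set (E d)}
    (hK : IsMesh Ω K) {i j : Fin m} (hij : i ≠ j) {x : E d} (hx : x ∈ closure (K j)) :
    x ∉ K i := fun hxi =>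
  (((hK.disjoint i j hij).closure_right (hK.isOpen i))).le_bot ⟨hxi, hx⟩

variable {s : Fin m → Finset (E (n + 1) × ℝ)}

/-- Almost every point of the facets of the element `i` lies in the relative interior of a face. -/
theorem IsMesh.ae_mem_face (hK : IsMesh Ω K) (hs : ∀ i, ∀ a ∈ s i, ‖a.1‖ = 1)
    (hKs : ∀ i, K i = halfspaces (s i)) (i : Fin m) :
    ∀ᵐ x ∂(surf (n + 1)), ∀ j, i ≠ j → x ∈ facet Ω K i j → ∃ a ∈ s i, x ∈ face (s i) a := by
  have h1 : ∀ a ∈ s i, ∀ b ∈ s i, ∀ᵐ x ∂(surf (n + 1)),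
      b ≠ a → ¬ (⟪a.1, x⟫ = a.2 ∧ ⟪b.1, x⟫ = b.2) := by
    intro a ha b hb
    by_cases hba : b = a
    · exact Eventually.of_forall fun x h => absurd hba h
    · have h0 := surf_inter_faces_eq_zero (hs i) (by rw [← hKs]; exact (hK.polytope i).1) ha hb hba
      filter_upwards [measure_eq_zero_iff_ae_notMem.1 h0] with x hx _ h
      exact hx ⟨h.1, h.2⟩
  filter_upwards [(Filter.eventually_all_finset (s i)).2 fun a ha =>
    (Filter.eventually_all_finset (s i)).2 (h1 a ha)] with x hx j hij hxF
  have hcl : ∀ b ∈ s i, ⟪b.1, x⟫ ≤ b.2 :=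
    closure_halfspaces_subset (s i) (by rw [← hKs]; exact hxF.1.1)
  have hnot : x ∉ halfspaces (s i) := by
    rw [← hKs]; exact hK.notMem_of_mem_closure hij hxF.1.2
  simp only [halfspaces, Set.mem_ofPred_eq, not_forall, not_lt] at hnot
  obtain ⟨a, ha, hax⟩ := hnot
  have hax' := le_antisymm (hcl a ha) hax
  exact ⟨a, ha, hax', fun b hb hba => lt_of_le_of_ne (hcl b hb) fun h =>
    hx a ha b hb hba ⟨hax', h⟩⟩

theorem IsMesh.normal_eq_of_mem_face (hK : IsMesh Ω K) (hs : ∀ i, ∀ a ∈ s i, ‖a.1‖ = 1)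
    (hKs : ∀ i, K i = halfspaces (s i)) {i j : Fin m} (hij : i ≠ j) {a : E (n + 1) × ℝ}
    (ha : a ∈ s i) {x : E (n + 1)} (hx : x ∈ face (s i) a) (hxj : x ∈ closure (K j)) :
    unitNormal (K i) (K j) = a.1 ∧ unitNormal (K j) (K i) = -a.1 ∧ ∀ y ∈ K j, a.2 < ⟪a.1, y⟫ := by
  obtain ⟨c, hc⟩ := hK.separates hij
  obtain ⟨c', hc'⟩ := hK.separates hij.symm
  have hc2 := hc'.neg
  have h1 : Separates (unitNormal (K i) (K j)) c (halfspaces (s i)) (K j) := hKs i ▸ hc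
  have h2 : Separates (-unitNormal (K j) (K i)) (-c') (halfspaces (s i)) (K j) := hKs i ▸ hc2
  obtain ⟨h3, h4⟩ := h1.eq_of_mem_face (hs i a ha) hx hxj
  obtain ⟨h5, -⟩ := h2.eq_of_mem_face (hs i a ha) hx hxj
  refine ⟨h3, by rw [← h5, neg_neg], fun y hy => ?_⟩
  exact lt_inner_of_isOpen (hK.isOpen j) (hs i a ha) (fun z hz => by
    rw [← h3, ← h4]; exact hc.ge z hz) hy

/-- The two normals are separate choices and need not be opposite on a null facet. Almost every
facet point lies in the relative interior of a face, where separation is unique and identifies both.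
-/
theorem IsMesh.ae_unitNormal_comm (hK : IsMesh Ω K) {i j : Fin m} (hij : i ≠ j) :
    ∀ᵐ x ∂(surf (n + 1)), x ∈ facet Ω K i j →
      unitNormal (K j) (K i) = -unitNormal (K i) (K j) := by
  choose s hs hKs using fun i => (hK.polytope i).exists_halfspaces
  filter_upwards [hK.ae_mem_face hs hKs i] with x hx hxF
  obtain ⟨a, ha, hxa⟩ := hx j hij hxF
  obtain ⟨h1, h2, -⟩ := hK.normal_eq_of_mem_face hs hKs hij ha hxa hxF.1.2
  rw [h1, h2]

/-- Almost every point of a face belongs to the closure of at most one other element. -/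
theorem IsMesh.ae_unique_neighbor (hK : IsMesh Ω K) (hs : ∀ i, ∀ a ∈ s i, ‖a.1‖ = 1)
    (hKs : ∀ i, K i = halfspaces (s i)) (i : Fin m) :
    ∀ᵐ x ∂(surf (n + 1)), ∀ a ∈ s i, ∀ j k, i ≠ j → i ≠ k → x ∈ face (s i) a →
      x ∈ closure (K j) → x ∈ closure (K k) → j = k := by
  refine (Filter.eventually_all_finset (s i)).2 fun a ha => ae_all_iff.2 fun j =>
    ae_all_iff.2 fun k => ?_
  by_cases hjk : j = k
  · exact Eventually.of_forall fun _ _ _ _ _ _ => hjk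
  obtain ⟨c, hc⟩ := hK.separates hjk
  set ν := unitNormal (K j) (K k)
  have hon : ∀ x, x ∈ closure (K j) → x ∈ closure (K k) → ⟪ν, x⟫ = c := fun x hj hk =>
    le_antisymm (hc.closure.le x hj) (hc.closure.ge x hk)
  -- If the hyperplane separating the neighbours is parallel to the face it is the face's own
  -- hyperplane. Both neighbours lie strictly beyond it, so it cannot separate them.
  by_cases h1 : ν = a.1
  · refine Eventually.of_forall fun x hij hik hx hxj hxk => ?_
    obtain ⟨y, hy⟩ := (hK.polytope j).1
    have h2 := (hK.normal_eq_of_mem_face hs hKs hij ha hx hxj).2.2 y hy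
    have h3 := hc.le y hy
    rw [← hon x hxj hxk, h1, hx.1] at h3
    linarith
  by_cases h2 : ν = -a.1
  · refine Eventually.of_forall fun x hij hik hx hxj hxk => ?_
    obtain ⟨y, hy⟩ := (hK.polytope k).1
    have h3 := (hK.normal_eq_of_mem_face hs hKs hik ha hx hxk).2.2 y hy
    have h4 := hc.ge y hy
    rw [← hon x hxj hxk, h2, inner_neg_left, inner_neg_left, hx.1] at h4
    linarith
  -- Otherwise the two hyperplanes are transversal, and common points of both closures on the face
  -- form a null set.
  have h0 := surf_inter_hyperplanes_eq_zero (hs i a ha) hc.norm_eq h1 h2 a.2 c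
  filter_upwards [measure_eq_zero_iff_ae_notMem.1 h0] with x hx _ _ hxa hxj hxk
  exact absurd ⟨hxa.1, hon x hxj hxk⟩ hx

/-- Small outward moves from the face remain in Ω, which the closed elements cover, but leave the
closure of element i. The finite union of the other closures is closed, hence contains x itself. -/
theorem IsMesh.exists_neighbor (hΩ : IsOpen Ω) (hK : IsMesh Ω K)
    (hs : ∀ i, ∀ a ∈ s i, ‖a.1‖ = 1) (hKs : ∀ i, K i = halfspaces (s i)) {i : Fin m}
    {a : E (n + 1) × ℝ} (ha : a ∈ s i) {x : E (n + 1)} (hx : x ∈ face (s i) a) (hxΩ : x ∈ Ω) :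
    ∃ j, i ≠ j ∧ x ∈ facet Ω K i j := by
  have hcl : IsClosed (⋃ j ∈ (Finset.univ.filter (i ≠ ·) : Finset (Fin m)), closure (K j)) :=
    Set.Finite.isClosed_biUnion (Finset.finite_toSet _) fun _ _ => isClosed_closure
  have hev : ∀ᶠ ε in 𝓝[>] (0 : ℝ), x + ε • a.1 ∈
      ⋃ j ∈ (Finset.univ.filter (i ≠ ·) : Finset (Fin m)), closure (K j) := by
    filter_upwards [(tendsto_add_smul_nhdsGT x a.1).eventually (hΩ.mem_nhds hxΩ),
      self_mem_nhdsWithin] with ε hε (hε0 : 0 < ε)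
    have h1 : x + ε • a.1 ∈ closure Ω := subset_closure hε
    rw [hK.cover] at h1
    obtain ⟨j, hj⟩ := Set.mem_iUnion.1 h1
    refine Set.mem_biUnion (x := j) (Finset.mem_coe.2 (Finset.mem_filter.2
      ⟨Finset.mem_univ _, ?_⟩)) hj
    rintro rfl
    rw [hKs] at hj
    have h2 := closure_halfspaces_subset (s i) hj a ha
    rw [inner_add_right, inner_smul_right, real_inner_self_eq_norm_sq, hs i a ha, hx.1] at h2
    linarith
  have h3 := hcl.mem_of_tendsto (tendsto_add_smul_nhdsGT x a.1) hev
  obtain ⟨j, hj, hxj⟩ := Set.mem_iUnion₂.1 h3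
  refine ⟨j, (Finset.mem_filter.1 hj).2, ⟨?_, hxj⟩, hxΩ⟩
  rw [hKs]
  exact face_subset_closure (hs i a ha) hx

/-- The fluxes of a field through the faces of an element are its fluxes through the facets. -/
theorem IsMesh.sum_face_eq_sum_facet (hΩ : IsOpen Ω) (hK : IsMesh Ω K)
    (hs : ∀ i, ∀ a ∈ s i, ‖a.1‖ = 1) (hKs : ∀ i, K i = halfspaces (s i)) (i : Fin m)
    {q : E (n + 1) → ℝ} (hq : Continuous q) {g : E (n + 1) → E (n + 1)} (hg : ContinuousOn g Ω)
    {C : ℝ} (hC : ∀ x ∈ closure (K i) ∩ Ω, |q x| * ‖g x‖ ≤ C) :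
    ∑ a ∈ s i, ∫ x in face (s i) a ∩ Ω, q x * ⟪g x, a.1⟫ ∂(surf (n + 1)) =
      ∑ j with i ≠ j, ∫ x in facet Ω K i j, q x * ⟪g x, unitNormal (K i) (K j)⟫
        ∂(surf (n + 1)) := by
  have hmface : ∀ a, MeasurableSet (face (s i) a ∩ Ω) := fun a =>
    (measurableSet_face _ _).inter hΩ.measurableSet
  have hcont : ∀ v : E (n + 1), ContinuousOn (fun x => q x * ⟪g x, v⟫) Ω := fun v =>
    hq.continuousOn.mul (hg.inner continuousOn_const)
  have hbd : ∀ v : E (n + 1), ‖v‖ = 1 → ∀ x ∈ closure (K i) ∩ Ω, ‖q x * ⟪g x, v⟫‖ ≤ C := by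
    intro v hv x hx
    refine le_trans ?_ (hC x hx)
    rw [norm_mul, Real.norm_eq_abs]
    gcongr
    simpa [hv] using norm_inner_le_norm (𝕜 := ℝ) (g x) v
  have hsub : ∀ a ∈ s i, face (s i) a ⊆ closure (K i) := fun a ha => by
    rw [hKs]; exact face_subset_closure (hs i a ha)
  have hi1 : ∀ a ∈ s i, IntegrableOn (fun x => q x * ⟪g x, a.1⟫) (face (s i) a ∩ Ω)
      (surf (n + 1)) := fun a ha =>
    IntegrableOn.of_bound (surf_lt_top_of_bounded (c := a.2) (hs i a ha) (hmface a)
      (fun x hx => hx.1.1) ((hK.isBounded i).closure.subset fun x hx => hsub a ha hx.1))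
      (((hcont a.1).mono Set.inter_subset_right).aestronglyMeasurable (hmface a)) C
      (ae_restrict_of_forall_mem (hmface a) fun x hx =>
        hbd a.1 (hs i a ha) x ⟨hsub a ha hx.1, hx.2⟩)
  have hi2 : ∀ j ∈ Finset.univ.filter (i ≠ ·),
      IntegrableOn (fun x => q x * ⟪g x, unitNormal (K i) (K j)⟫) (facet Ω K i j)
      (surf (n + 1)) := fun j hj => by
    have hij := (Finset.mem_filter.1 hj).2
    exact hK.integrableOn_facet hΩ hij (hcont _) (hbd _ (hK.norm_unitNormal hij))
  have e1 : ∀ a, ∫ x in face (s i) a ∩ Ω, q x * ⟪g x, a.1⟫ ∂(surf (n + 1)) =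
      ∫ x, (face (s i) a ∩ Ω).indicator (fun x => q x * ⟪g x, a.1⟫) x ∂(surf (n + 1)) :=
    fun a => (integral_indicator (hmface a)).symm
  have e2 : ∀ j, ∫ x in facet Ω K i j, q x * ⟪g x, unitNormal (K i) (K j)⟫ ∂(surf (n + 1)) =
      ∫ x, (facet Ω K i j).indicator (fun x => q x * ⟪g x, unitNormal (K i) (K j)⟫) x
        ∂(surf (n + 1)) :=
    fun j => (integral_indicator (measurableSet_facet hΩ K i j)).symm
  simp only [e1, e2]
  rw [← integral_finsetSum _ fun a ha => (integrable_indicator_iff (hmface a)).2 (hi1 a ha),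
    ← integral_finsetSum _ fun j hj =>
      (integrable_indicator_iff (measurableSet_facet hΩ K i j)).2 (hi2 j hj)]
  -- The integrands agree almost everywhere: each sum has at most one nonzero term, since a face
  -- point inside Ω lies on one face and has one neighbour.
  refine integral_congr_ae ?_
  filter_upwards [hK.ae_mem_face hs hKs i, hK.ae_unique_neighbor hs hKs i] with x hx1 hx2
  by_cases hex : ∃ a ∈ s i, x ∈ face (s i) a ∩ Ω
  · obtain ⟨a, ha, hxa⟩ := hex
    obtain ⟨j, hij, hxj⟩ := hK.exists_neighbor hΩ hs hKs ha hxa.1 hxa.2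
    rw [Finset.sum_eq_single_of_mem a ha, Finset.sum_eq_single_of_mem j
      (Finset.mem_filter.2 ⟨Finset.mem_univ _, hij⟩), Set.indicator_of_mem hxa,
      Set.indicator_of_mem hxj, (hK.normal_eq_of_mem_face hs hKs hij ha hxa.1 hxj.1.2).1]
    · intro k hk hkj
      refine Set.indicator_of_notMem (fun hxk => hkj ?_) _
      exact hx2 a ha k j (Finset.mem_filter.1 hk).2 hij hxa.1 hxk.1.2 hxj.1.2
    · intro b hb hba
      refine Set.indicator_of_notMem (fun hxb => ?_) _
      have := hxa.1.2 b hb hba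
      rw [hxb.1.1] at this
      exact lt_irrefl _ this
  · rw [Finset.sum_eq_zero, Finset.sum_eq_zero]
    · intro j hj
      refine Set.indicator_of_notMem (fun hxj => hex ?_) _
      obtain ⟨a, ha, hxa⟩ := hx1 j (Finset.mem_filter.1 hj).2 hxj
      exact ⟨a, ha, hxa, hxj.2⟩
    · intro a ha
      exact Set.indicator_of_notMem (fun hxa => hex ⟨a, ha, hxa⟩) _

theorem sum_ne_eq_sum_lt (I : Fin m → Fin m → ℝ) :
    ∑ i, ∑ j with i ≠ j, I i j = ∑ e : Fin m × Fin m with e.1 < e.2, (I e.1 e.2 + I e.2 e.1) := by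
  have h1 : ∑ i, ∑ j with i ≠ j, I i j = ∑ e : Fin m × Fin m with e.1 ≠ e.2, I e.1 e.2 := by
    simp only [Finset.sum_filter, Fintype.sum_prod_type]
  have h2 : ∑ e : Fin m × Fin m with e.1 < e.2, I e.2 e.1 =
      ∑ e : Fin m × Fin m with e.2 < e.1, I e.1 e.2 := by
    refine Finset.sum_equiv (Equiv.prodComm _ _) (fun e => by simp) (fun e _ => rfl)
  rw [h1, Finset.sum_add_distrib, h2, ← Finset.sum_union]
  · refine Finset.sum_congr ?_ fun _ _ => rfl
    ext e
    simp [lt_or_lt_iff_ne]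
  · rw [Finset.disjoint_filter]
    exact fun e _ h => h.not_gt

/-- Green's formula for piecewise polynomials on a mesh. -/
theorem IsMesh.green (hΩ : IsOpen Ω) (hΩb : Bornology.IsBounded Ω) (hK : IsMesh Ω K)
    (q : PW (n + 1) m) {g : E (n + 1) → E (n + 1)} (hg : ContinuousOn g Ω) {C : ℝ}
    (hC : ∀ x ∈ Ω, ‖g x‖ ≤ C) {h : Fin (n + 1) → E (n + 1) → ℝ}
    (hgh : ∀ k, HasWeakPartial Ω k (fun x => g x k) (h k)) (hhL : ∀ k, MemLinf Ω (h k))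
    (hq0 : ∀ i, ∀ᵐ x ∂((surf (n + 1)).restrict (closure (K i) ∩ frontier Ω)),
      val (q i) x = 0) :
    ∑ i, ∫ x in K i, (⟪g x, grad (q i) x⟫ + (∑ k, h k x) * val (q i) x) =
      facetSum Ω K fun i j x => ⟪g x, unitNormal (K i) (K j)⟫ * (val (q i) x - val (q j) x) := by
  choose s hs hKs using fun i => (hK.polytope i).exists_halfspaces
  have hbd : ∀ i j : Fin m, ∃ B, ∀ x ∈ closure (K i) ∩ Ω, |val (q j) x| * ‖g x‖ ≤ B := by
    intro i j
    obtain ⟨Q, hQ⟩ := (Metric.isCompact_of_isClosed_isBounded isClosed_closure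
      (hK.isBounded i).closure).exists_bound_of_continuousOn (continuous_val (q j)).continuousOn
    exact ⟨Q * C, fun x hx => mul_le_mul (hQ x hx.1) (hC x hx.2) (norm_nonneg _)
      ((norm_nonneg _).trans (hQ x hx.1))⟩
  have h1 : ∀ i, ∫ x in K i, (⟪g x, grad (q i) x⟫ + (∑ k, h k x) * val (q i) x) =
      ∑ j with i ≠ j, ∫ x in facet Ω K i j, val (q i) x * ⟪g x, unitNormal (K i) (K j)⟫
        ∂(surf (n + 1)) := by
    intro i
    obtain ⟨B, hB⟩ := hbd i i
    rw [← hK.sum_face_eq_sum_facet hΩ hs hKs i (continuous_val _) hg hB, hKs i]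
    refine green_polytope (hs i) ?_ ?_ hΩ hΩb ?_ (q i) hg hC hgh hhL ?_
    · rw [← hKs]; exact hK.isBounded i
    · rw [← hKs]; exact (hK.polytope i).1
    · rw [← hKs]; exact hK.subset i
    · rw [← hKs]; exact hq0 i
  simp only [h1]
  rw [sum_ne_eq_sum_lt, facetSum]
  refine Finset.sum_congr rfl fun e he => ?_
  have hij : e.1 ≠ e.2 := (Finset.mem_filter.1 he).2.ne
  have hint : ∀ j, IntegrableOn (fun x => val (q j) x * ⟪g x, unitNormal (K e.1) (K e.2)⟫)
      (facet Ω K e.1 e.2) (surf (n + 1)) := by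
    intro j
    obtain ⟨B, hB⟩ := hbd e.1 j
    refine hK.integrableOn_facet hΩ hij ((continuous_val _).continuousOn.mul
      (hg.inner continuousOn_const)) (C := B) fun x hx => le_trans ?_ (hB x hx)
    rw [norm_mul, Real.norm_eq_abs]
    gcongr
    simpa [hK.norm_unitNormal hij] using
      norm_inner_le_norm (𝕜 := ℝ) (g x) (unitNormal (K e.1) (K e.2))
  -- Seen from the second element the normal is reversed, so the two fluxes combine to the jump.
  have h2 : ∫ x in facet Ω K e.2 e.1, val (q e.2) x * ⟪g x, unitNormal (K e.2) (K e.1)⟫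
      ∂(surf (n + 1)) = - ∫ x in facet Ω K e.1 e.2, val (q e.2) x *
        ⟪g x, unitNormal (K e.1) (K e.2)⟫ ∂(surf (n + 1)) := by
    rw [facet_comm Ω K e.2 e.1, ← integral_neg]
    refine setIntegral_congr_ae (measurableSet_facet hΩ K _ _) ?_
    filter_upwards [hK.ae_unitNormal_comm hij] with x hx hxF
    rw [hx hxF, inner_neg_right, mul_neg]
  rw [h2, ← sub_eq_add_neg, ← integral_sub (hint _) (hint _)]
  refine integral_congr_ae (Eventually.of_forall fun x => ?_)
  ring

end MeshGeometry

/-! ### Bounded continuous functions and bilinear forms -/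

section Forms

variable {d n m : ℕ}

/-- Continuity and boundedness on a set. -/
def BddContOn {F : Type*} [NormedAddCommGroup F] (Ω : Set (E d)) (f : E d → F) : Prop :=
  ContinuousOn f Ω ∧ ∃ C, ∀ x ∈ Ω, ‖f x‖ ≤ C

section

variable {F : Type*} [NormedAddCommGroup F] {Ω : Set (E d)}

theorem BddContOn.of_continuous (hΩb : Bornology.IsBounded Ω) {f : E d → F} (hf : Continuous f) :
    BddContOn Ω f := by
  obtain ⟨C, hC⟩ := (Metric.isCompact_of_isClosed_isBounded isClosed_closure
    hΩb.closure).exists_bound_of_continuousOn hf.continuousOn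
  exact ⟨hf.continuousOn, C, fun x hx => hC x (subset_closure hx)⟩

theorem BddContOn.add {f g : E d → F} (hf : BddContOn Ω f) (hg : BddContOn Ω g) :
    BddContOn Ω fun x => f x + g x := by
  obtain ⟨hf, C, hC⟩ := hf
  obtain ⟨hg, D, hD⟩ := hg
  exact ⟨hf.add hg, C + D, fun x hx => (norm_add_le _ _).trans (add_le_add (hC x hx) (hD x hx))⟩

theorem BddContOn.sub {f g : E d → F} (hf : BddContOn Ω f) (hg : BddContOn Ω g) :
    BddContOn Ω fun x => f x - g x := by
  obtain ⟨hf, C, hC⟩ := hf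
  obtain ⟨hg, D, hD⟩ := hg
  exact ⟨hf.sub hg, C + D, fun x hx => (norm_sub_le _ _).trans (add_le_add (hC x hx) (hD x hx))⟩

theorem BddContOn.mul {f g : E d → ℝ} (hf : BddContOn Ω f) (hg : BddContOn Ω g) :
    BddContOn Ω fun x => f x * g x := by
  obtain ⟨hf, C, hC⟩ := hf
  obtain ⟨hg, D, hD⟩ := hg
  exact ⟨hf.mul hg, C * D, fun x hx => by
    rw [norm_mul]
    exact mul_le_mul (hC x hx) (hD x hx) (norm_nonneg _) ((norm_nonneg _).trans (hC x hx))⟩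

theorem BddContOn.inner [InnerProductSpace ℝ F] {f g : E d → F} (hf : BddContOn Ω f)
    (hg : BddContOn Ω g) : BddContOn Ω fun x => ⟪f x, g x⟫ := by
  obtain ⟨hf, C, hC⟩ := hf
  obtain ⟨hg, D, hD⟩ := hg
  exact ⟨ContinuousOn.inner hf hg, C * D, fun x hx => (norm_inner_le_norm _ _).trans
    (mul_le_mul (hC x hx) (hD x hx) (norm_nonneg _) ((norm_nonneg _).trans (hC x hx)))⟩

theorem BddContOn.norm {f : E d → F} (hf : BddContOn Ω f) : BddContOn Ω fun x => ‖f x‖ := by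
  obtain ⟨hf, C, hC⟩ := hf
  exact ⟨hf.norm, C, fun x hx => by rw [norm_norm]; exact hC x hx⟩

theorem BddContOn.const (c : F) : BddContOn Ω fun _ => c :=
  ⟨continuousOn_const, ‖c‖, fun _ _ => le_rfl⟩

theorem BddContOn.integrableOn {f : E d → ℝ} (hf : BddContOn Ω f) {K : Set (E d)}
    (hKm : MeasurableSet K) (hKb : Bornology.IsBounded K) (hKΩ : K ⊆ Ω) :
    IntegrableOn f K volume := by
  obtain ⟨hf, C, hC⟩ := hf
  exact IntegrableOn.of_bound hKb.measure_lt_top ((hf.mono hKΩ).aestronglyMeasurable hKm) C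
    (ae_restrict_of_forall_mem hKm fun x hx => hC x (hKΩ hx))

theorem BddContOn.integrableOn_elem {K : Fin m → Set (E d)} (hK : IsMesh Ω K) {f : E d → ℝ}
    (hf : BddContOn Ω f) (i : Fin m) : IntegrableOn f (K i) volume :=
  hf.integrableOn (hK.isOpen i).measurableSet (hK.isBounded i) (hK.subset i)

end

theorem BddContOn.integrableOn_facet {Ω : Set (E (n + 1))} {K : Fin m → Set (E (n + 1))}
    (hΩ : IsOpen Ω) (hK : IsMesh Ω K) {f : E (n + 1) → ℝ} (hf : BddContOn Ω f) {i j : Fin m}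
    (hij : i ≠ j) : IntegrableOn f (facet Ω K i j) (surf (n + 1)) :=
  hK.integrableOn_facet hΩ hij hf.1 (C := hf.2.choose) fun x hx => hf.2.choose_spec x hx.2

/-- Bilinearity of a real-valued map. -/
structure IsBilin {V : Type*} [AddCommGroup V] [Module ℝ V] (f : V → V → ℝ) : Prop where
  add_left : ∀ u v w, f (u + v) w = f u w + f v w
  smul_left : ∀ (c : ℝ) u w, f (c • u) w = c * f u w
  add_right : ∀ u v w, f u (v + w) = f u v + f u w
  smul_right : ∀ (c : ℝ) u w, f u (c • w) = c * f u w

section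

variable {V : Type*} [AddCommGroup V] [Module ℝ V] {f g : V → V → ℝ}

/-- The bilinear map of a bilinear form. -/
def IsBilin.toLin (hf : IsBilin f) : V →ₗ[ℝ] V →ₗ[ℝ] ℝ :=
  LinearMap.mk₂ ℝ f hf.add_left hf.smul_left hf.add_right hf.smul_right

theorem IsBilin.add (hf : IsBilin f) (hg : IsBilin g) : IsBilin fun u v => f u v + g u v where
  add_left u v w := by rw [hf.add_left, hg.add_left]; ring
  smul_left c u w := by rw [hf.smul_left, hg.smul_left]; ring
  add_right u v w := by rw [hf.add_right, hg.add_right]; ring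
  smul_right c u w := by rw [hf.smul_right, hg.smul_right]; ring

theorem IsBilin.const_mul (hf : IsBilin f) (a : ℝ) : IsBilin fun u v => a * f u v where
  add_left u v w := by rw [hf.add_left]; ring
  smul_left c u w := by rw [hf.smul_left]; ring
  add_right u v w := by rw [hf.add_right]; ring
  smul_right c u w := by rw [hf.smul_right]; ring

theorem IsBilin.sub (hf : IsBilin f) (hg : IsBilin g) : IsBilin fun u v => f u v - g u v := by
  simpa [sub_eq_add_neg] using hf.add (hg.const_mul (-1))

theorem IsBilin.sum {ι : Type*} (s : Finset ι) {f : ι → V → V → ℝ}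
    (hf : ∀ i ∈ s, IsBilin (f i)) : IsBilin fun u v => ∑ i ∈ s, f i u v where
  add_left u v w := by
    rw [← Finset.sum_add_distrib]; exact Finset.sum_congr rfl fun i hi => (hf i hi).add_left u v w
  smul_left c u w := by
    rw [Finset.mul_sum]; exact Finset.sum_congr rfl fun i hi => (hf i hi).smul_left c u w
  add_right u v w := by
    rw [← Finset.sum_add_distrib]; exact Finset.sum_congr rfl fun i hi => (hf i hi).add_right u v w
  smul_right c u w := by
    rw [Finset.mul_sum]; exact Finset.sum_congr rfl fun i hi => (hf i hi).smul_right c u w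

theorem IsBilin.integral {α : Type*} [MeasurableSpace α] {μ : Measure α} {f : α → V → V → ℝ}
    (hf : ∀ x, IsBilin (f x)) (hi : ∀ u v, Integrable (fun x => f x u v) μ) :
    IsBilin fun u v => ∫ x, f x u v ∂μ where
  add_left u v w := by rw [← integral_add (hi u w) (hi v w)]; simp only [(hf _).add_left]
  smul_left c u w := by rw [← integral_const_mul]; simp only [(hf _).smul_left]
  add_right u v w := by rw [← integral_add (hi u v) (hi u w)]; simp only [(hf _).add_right]
  smul_right c u w := by rw [← integral_const_mul]; simp only [(hf _).smul_right]

end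

section

variable {Ω : Set (E d)} {K : Fin m → Set (E d)}

theorem continuous_jump (K : Fin m → Set (E d)) (w : PW d m) (i j : Fin m) :
    Continuous (jump K w i j) :=
  ((continuous_val _).smul continuous_const).add ((continuous_val _).smul continuous_const)

theorem continuous_ujump (w : PW d m) (i j : Fin m) : Continuous (ujump w i j) :=
  (continuous_val _).sub (continuous_val _)

theorem continuous_avg (w : PW d m) (i j : Fin m) : Continuous (avg w i j) :=
  ((continuous_val _).add (continuous_val _)).div_const 2

theorem continuous_avgGrad (w : PW d m) (i j : Fin m) : Continuous (avgGrad w i j) :=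
  ((continuous_grad _).add (continuous_grad _)).const_smul (1 / 2 : ℝ)

theorem jump_add (w v : PW d m) (i j : Fin m) (x : E d) :
    jump K (w + v) i j x = jump K w i j x + jump K v i j x := by
  simp only [jump, Pi.add_apply, val_add, add_smul]; module

theorem jump_smul (c : ℝ) (w : PW d m) (i j : Fin m) (x : E d) :
    jump K (c • w) i j x = c • jump K w i j x := by
  simp only [jump, Pi.smul_apply, val_smul]; module

theorem ujump_add (w v : PW d m) (i j : Fin m) (x : E d) :
    ujump (w + v) i j x = ujump w i j x + ujump v i j x := by
  simp only [ujump, Pi.add_apply, val_add]; ring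

theorem ujump_smul (c : ℝ) (w : PW d m) (i j : Fin m) (x : E d) :
    ujump (c • w) i j x = c * ujump w i j x := by
  simp only [ujump, Pi.smul_apply, val_smul]; ring

theorem avg_add (w v : PW d m) (i j : Fin m) (x : E d) :
    avg (w + v) i j x = avg w i j x + avg v i j x := by
  simp only [avg, Pi.add_apply, val_add]; ring

theorem avg_smul (c : ℝ) (w : PW d m) (i j : Fin m) (x : E d) :
    avg (c • w) i j x = c * avg w i j x := by
  simp only [avg, Pi.smul_apply, val_smul]; ring

theorem avgGrad_add (w v : PW d m) (i j : Fin m) (x : E d) :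
    avgGrad (w + v) i j x = avgGrad w i j x + avgGrad v i j x := by
  simp only [avgGrad, Pi.add_apply, grad_add]; module

theorem avgGrad_smul (c : ℝ) (w : PW d m) (i j : Fin m) (x : E d) :
    avgGrad (c • w) i j x = c • avgGrad w i j x := by
  simp only [avgGrad, Pi.smul_apply, grad_smul]; module

theorem isBilin_ip (hK : IsMesh Ω K) (hΩb : Bornology.IsBounded Ω) :
    IsBilin (ip K) := by
  refine IsBilin.sum _ fun i _ => IsBilin.integral (fun x => ?_) fun w v =>
    (BddContOn.of_continuous hΩb ((continuous_val (w i)).mul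
      (continuous_val (v i)))).integrableOn_elem hK i
  constructor <;> intros <;> simp only [Pi.add_apply, Pi.smul_apply, val_add, val_smul] <;> ring

end

section

variable {Ω : Set (E (n + 1))} {K : Fin m → Set (E (n + 1))}

theorem isBilin_facetSum (hΩ : IsOpen Ω) (hK : IsMesh Ω K)
    {f : PW (n + 1) m → PW (n + 1) m → Fin m → Fin m → E (n + 1) → ℝ}
    (hf : ∀ i j x, IsBilin fun w v => f w v i j x)
    (hi : ∀ w v i j, BddContOn Ω (f w v i j)) : IsBilin fun w v => facetSum Ω K (f w v) :=
  IsBilin.sum _ fun e he => IsBilin.integral (hf e.1 e.2) fun w v =>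
    (hi w v e.1 e.2).integrableOn_facet hΩ hK (Finset.mem_filter.1 he).2.ne

/-- The integrand of the interior penalty form on the facets. -/
noncomputable def aFacet (K : Fin m → Set (E d)) (hF : Fin m → Fin m → ℝ) (σ : ℝ) (w v : PW d m) (i j : Fin m)
    (x : E d) : ℝ :=
  ⟪jump K w i j x, avgGrad v i j x⟫ + ⟪jump K v i j x, avgGrad w i j x⟫ -
    σ / hF i j * ⟪jump K w i j x, jump K v i j x⟫

theorem continuous_aFacet {d : ℕ} (K : Fin m → Set (E d)) (hF : Fin m → Fin m → ℝ) (σ : ℝ)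
    (w v : PW d m) (i j : Fin m) : Continuous (aFacet K hF σ w v i j) :=
  (((continuous_jump K w i j).inner (continuous_avgGrad v i j)).add
    ((continuous_jump K v i j).inner (continuous_avgGrad w i j))).sub
      (continuous_const.mul ((continuous_jump K w i j).inner (continuous_jump K v i j)))

theorem isBilin_aForm (hΩ : IsOpen Ω) (hΩb : Bornology.IsBounded Ω) (hK : IsMesh Ω K)
    (hF : Fin m → Fin m → ℝ) (σ : ℝ) : IsBilin (aForm Ω K hF σ) := by
  refine IsBilin.sub (IsBilin.sum _ fun i _ => IsBilin.integral (fun x => ?_) fun w v =>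
    (BddContOn.of_continuous hΩb ((continuous_grad (w i)).inner
      (continuous_grad (v i)))).integrableOn_elem hK i)
    (isBilin_facetSum hΩ hK (fun i j x => ?_) fun w v i j =>
      BddContOn.of_continuous hΩb (continuous_aFacet K hF σ w v i j))
  · constructor <;> intros <;> simp [grad_add, grad_smul, inner_add_left, inner_add_right,
      inner_smul_left, inner_smul_right]
  · constructor <;> intros <;> simp only [jump_add, jump_smul, avgGrad_add, avgGrad_smul,
      inner_add_left, inner_add_right, inner_smul_left, inner_smul_right, conj_trivial] <;> ring

/-- The integrand of the upwind form on the facets, for a given drift field. -/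
noncomputable def bFacet (K : Fin m → Set (E d)) (G : E d → E d) (μ : ℝ) (w v : PW d m) (i j : Fin m)
    (x : E d) : ℝ :=
  ⟪G x, unitNormal (K i) (K j)⟫ * avg w i j x * ujump v i j x -
    μ / 2 * |⟪G x, unitNormal (K i) (K j)⟫| * ujump w i j x * ujump v i j x

theorem bddContOn_bFacet {d : ℕ} {Ω : Set (E d)} (hΩb : Bornology.IsBounded Ω)
    (K : Fin m → Set (E d)) {G : E d → E d} (hG : BddContOn Ω G) (μ : ℝ) (w v : PW d m)
    (i j : Fin m) : BddContOn Ω (bFacet K G μ w v i j) := by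
  have hGn := hG.inner (BddContOn.const (Ω := Ω) (unitNormal (K i) (K j)))
  have hu : ∀ w : PW d m, BddContOn Ω (ujump w i j) := fun w =>
    BddContOn.of_continuous hΩb (continuous_ujump w i j)
  exact ((hGn.mul (BddContOn.of_continuous hΩb (continuous_avg w i j))).mul (hu v)).sub
    ((((BddContOn.const (μ / 2)).mul hGn.norm).mul (hu w)).mul (hu v))

theorem isBilin_bForm (hΩ : IsOpen Ω) (hΩb : Bornology.IsBounded Ω) (hK : IsMesh Ω K)
    {ψ : E (n + 1) → ℝ} (hG : BddContOn Ω (weakGrad Ω ψ)) (μ : ℝ) :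
    IsBilin (bForm Ω K ψ μ) := by
  refine IsBilin.sub (IsBilin.sum _ fun i _ => IsBilin.integral (fun x => ?_) fun w v =>
    ((BddContOn.of_continuous hΩb (continuous_val (w i))).mul (hG.inner
      (BddContOn.of_continuous hΩb (continuous_grad (v i))))).integrableOn_elem hK i)
    (isBilin_facetSum hΩ hK (fun i j x => ?_) fun w v i j => bddContOn_bFacet hΩb K hG μ w v i j)
  · constructor <;> intros <;> simp only [Pi.add_apply, Pi.smul_apply, val_add, val_smul,
      grad_add, grad_smul, inner_add_right, inner_smul_right] <;> ring
  · constructor <;> intros <;> simp only [ujump_add, ujump_smul, avg_add, avg_smul] <;> ring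

theorem isBilin_AForm (hΩ : IsOpen Ω) (hΩb : Bornology.IsBounded Ω) (hK : IsMesh Ω K)
    (hF : Fin m → Fin m → ℝ) {ψ : E (n + 1) → ℝ} (hG : BddContOn Ω (weakGrad Ω ψ))
    (σ μ τ : ℝ) : IsBilin (AForm Ω K hF ψ σ μ τ) :=
  (isBilin_ip hK hΩb).add
    (((isBilin_aForm hΩ hΩb hK hF σ).add (isBilin_bForm hΩ hΩb hK hG μ)).const_mul τ)

theorem facetSum_add (hΩ : IsOpen Ω) (hK : IsMesh Ω K) {f g : Fin m → Fin m → E (n + 1) → ℝ}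
    (hf : ∀ i j, BddContOn Ω (f i j)) (hg : ∀ i j, BddContOn Ω (g i j)) :
    facetSum Ω K (fun i j x => f i j x + g i j x) = facetSum Ω K f + facetSum Ω K g := by
  rw [facetSum, facetSum, facetSum, ← Finset.sum_add_distrib]
  exact Finset.sum_congr rfl fun e he => integral_add
    ((hf _ _).integrableOn_facet hΩ hK (Finset.mem_filter.1 he).2.ne)
    ((hg _ _).integrableOn_facet hΩ hK (Finset.mem_filter.1 he).2.ne)

theorem facetSum_const_mul {d : ℕ} (Ω : Set (E d)) (K : Fin m → Set (E d)) (c : ℝ)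
    (f : Fin m → Fin m → E d → ℝ) :
    facetSum Ω K (fun i j x => c * f i j x) = c * facetSum Ω K f := by
  simp only [facetSum, integral_const_mul, Finset.mul_sum]

theorem facetSum_mono (hΩ : IsOpen Ω) (hK : IsMesh Ω K) {f g : Fin m → Fin m → E (n + 1) → ℝ}
    (hf : ∀ i j, BddContOn Ω (f i j)) (hg : ∀ i j, BddContOn Ω (g i j))
    (h : ∀ i j, i ≠ j → ∀ x, f i j x ≤ g i j x) : facetSum Ω K f ≤ facetSum Ω K g :=
  Finset.sum_le_sum fun e he => integral_mono
    ((hf _ _).integrableOn_facet hΩ hK (Finset.mem_filter.1 he).2.ne)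
    ((hg _ _).integrableOn_facet hΩ hK (Finset.mem_filter.1 he).2.ne)
    (h e.1 e.2 (Finset.mem_filter.1 he).2.ne)

theorem facetSum_nonneg {d : ℕ} {Ω : Set (E d)} {K : Fin m → Set (E d)}
    {f : Fin m → Fin m → E d → ℝ} (h : ∀ i j, i ≠ j → ∀ x, 0 ≤ f i j x) : 0 ≤ facetSum Ω K f :=
  Finset.sum_nonneg fun e he => integral_nonneg (h e.1 e.2 (Finset.mem_filter.1 he).2.ne)

/-! ### Positivity of the forms -/

theorem bddContOn_weakGrad {d : ℕ} {Ω : Set (E d)} (hΩ : IsOpen Ω)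
    (hΩb : Bornology.IsBounded Ω) {ψ : E d → ℝ} (hψ : MemW2inf Ω ψ) :
    BddContOn Ω (weakGrad Ω ψ) := by
  choose hc hC _ using fun i => hψ.weakPartial_spec hΩ hΩb i
  choose C hC using hC
  refine ⟨(PiLp.continuous_toLp 2 (fun _ : Fin d => ℝ)).comp_continuousOn
    (continuousOn_pi.2 hc), ∑ i, C i, fun x hx => ?_⟩
  have h1 : weakGrad Ω ψ x = ∑ k, weakPartial Ω k ψ x • (EuclideanSpace.single k 1 : E d) := by
    ext k; simp [weakGrad, Finset.sum_apply, Pi.single_apply]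
  rw [h1]
  refine (norm_sum_le _ _).trans (Finset.sum_le_sum fun k _ => ?_)
  simpa [norm_smul] using hC k x hx

/-- The upwind form on the diagonal. -/
theorem bForm_self (hΩ : IsOpen Ω) (hΩb : Bornology.IsBounded Ω) (hK : IsMesh Ω K) {p : ℕ}
    {ψ : E (n + 1) → ℝ} (hψ : MemW2inf Ω ψ) (μ : ℝ) {w : PW (n + 1) m} (hw : w ∈ V Ω K p) :
    bForm Ω K ψ μ w w = -(1 / 2) * (∑ i, ∫ x in K i, weakLaplacian Ω ψ x * val (w i) x ^ 2) +
      μ / 2 * facetSum Ω K fun i j x =>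
        |⟪weakGrad Ω ψ x, unitNormal (K i) (K j)⟫| * ujump w i j x ^ 2 := by
  have hG := bddContOn_weakGrad hΩ hΩb hψ
  have hL : ∀ k, MemLinf Ω (weakPartial Ω k (weakPartial Ω k ψ)) := fun k =>
    ((hψ.weakPartial_spec hΩ hΩb k).2.2 k).2
  -- Green's formula is applied to w², whose gradient is 2w∇w and whose trace on ∂Ω vanishes with
  -- that of w.
  have hgreen := hK.green hΩ hΩb (fun i => w i * w i) hG.1 hG.2.choose_spec
    (h := fun k => weakPartial Ω k (weakPartial Ω k ψ))
    (fun k => ((hψ.weakPartial_spec hΩ hΩb k).2.2 k).1) hL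
    (fun i => by
      filter_upwards [(hw i).2] with x hx
      rw [val_mul, hx, mul_zero])
  have hi1 : ∀ i, IntegrableOn (fun x => val (w i) x * ⟪weakGrad Ω ψ x, grad (w i) x⟫) (K i) :=
    fun i => ((BddContOn.of_continuous hΩb (continuous_val (w i))).mul (hG.inner
      (BddContOn.of_continuous hΩb (continuous_grad (w i))))).integrableOn_elem hK i
  have hi2 : ∀ i, IntegrableOn (fun x => weakLaplacian Ω ψ x * val (w i) x ^ 2) (K i) := by
    intro i
    have h1 : IntegrableOn (weakLaplacian Ω ψ) (K i) := by
      unfold weakLaplacian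
      exact integrable_finsetSum _ fun k _ => ((hL k).integrableOn hΩb).mono_set (hK.subset i)
    obtain ⟨-, C, hC⟩ := BddContOn.of_continuous hΩb ((continuous_val (w i)).pow 2)
    exact Integrable.mul_bdd (c := C) h1 ((continuous_val (w i)).pow 2).aestronglyMeasurable
      (ae_restrict_of_forall_mem (hK.isOpen i).measurableSet fun x hx => hC x (hK.subset i hx))
  have h2 : ∀ i, ∫ x in K i, (⟪weakGrad Ω ψ x, grad (w i * w i) x⟫ +
      (∑ k, weakPartial Ω k (weakPartial Ω k ψ) x) * val (w i * w i) x) =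
      2 * (∫ x in K i, val (w i) x * ⟪weakGrad Ω ψ x, grad (w i) x⟫) +
        ∫ x in K i, weakLaplacian Ω ψ x * val (w i) x ^ 2 := by
    intro i
    rw [← integral_const_mul, ← integral_add ((hi1 i).const_mul 2) (hi2 i)]
    refine integral_congr_ae (Eventually.of_forall fun x => ?_)
    simp only [grad_mul_self, val_mul, inner_smul_right, weakLaplacian]
    ring
  simp only [h2, Finset.sum_add_distrib, ← Finset.mul_sum] at hgreen
  have hGn : ∀ i j, BddContOn Ω fun x => ⟪weakGrad Ω ψ x, unitNormal (K i) (K j)⟫ := fun i j =>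
    hG.inner (BddContOn.const _)
  -- Since {w}⌊w⌋ = ½⌊w²⌋, the central flux is exactly half of the facet term in Green's formula.
  have h3 : (facetSum Ω K fun i j x =>
      ⟪weakGrad Ω ψ x, unitNormal (K i) (K j)⟫ * avg w i j x * ujump w i j x -
        μ / 2 * |⟪weakGrad Ω ψ x, unitNormal (K i) (K j)⟫| * ujump w i j x * ujump w i j x) =
      1 / 2 * (facetSum Ω K fun i j x => ⟪weakGrad Ω ψ x, unitNormal (K i) (K j)⟫ *
        (val (w i * w i) x - val (w j * w j) x)) + -(μ / 2) * facetSum Ω K fun i j x =>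
        |⟪weakGrad Ω ψ x, unitNormal (K i) (K j)⟫| * ujump w i j x ^ 2 := by
    rw [← facetSum_const_mul, ← facetSum_const_mul, ← facetSum_add hΩ hK]
    · congr 1
      funext i j x
      simp only [avg, ujump, val_mul]; ring
    · exact fun i j => (BddContOn.const _).mul ((hGn i j).mul (BddContOn.of_continuous hΩb
        ((continuous_val _).sub (continuous_val _))))
    · exact fun i j => (BddContOn.const _).mul ((hGn i j).norm.mul (BddContOn.of_continuous hΩb
        ((continuous_ujump w i j).pow 2)))
  rw [bForm, h3, ← hgreen]
  ring

/-- A vanishing integral of a continuous nonnegative function forces it to vanish on the open set,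
and then the polynomial is zero. -/
theorem setIntegral_val_sq_pos {U : Set (E d)} (hU : IsOpen U) (hne : U.Nonempty)
    (hb : Bornology.IsBounded U) {q : MvPolynomial (Fin d) ℝ} (hq : q ≠ 0) :
    0 < ∫ x in U, val q x * val q x := by
  have hc : Continuous fun x => val q x * val q x := (continuous_val q).mul (continuous_val q)
  have hnn : 0 ≤ fun x => val q x * val q x := fun x => mul_self_nonneg _
  have hi : IntegrableOn (fun x => val q x * val q x) U :=
    integrableOn_of_continuous hc hU.measurableSet hb hb.measure_lt_top.ne
  refine lt_of_le_of_ne (integral_nonneg hnn) fun h => hq ?_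
  have h1 := (integral_eq_zero_iff_of_nonneg hnn hi).1 h.symm
  have h2 := Measure.eqOn_open_of_ae_eq h1 hU hc.continuousOn continuousOn_const
  exact eq_zero_of_val_eq_zero_on_open hU hne fun x hx => mul_self_eq_zero.1 (h2 hx)

theorem ip_self_pos {Ω : Set (E d)} {K : Fin m → Set (E d)} (hK : IsMesh Ω K) {w : PW d m}
    (hw : w ≠ 0) : 0 < ip K w w := by
  obtain ⟨i, hi⟩ := Function.ne_iff.1 hw
  refine Finset.sum_pos' (fun j _ => integral_nonneg fun x => mul_self_nonneg _)
    ⟨i, Finset.mem_univ _, setIntegral_val_sq_pos (hK.isOpen i) (hK.polytope i).1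
      (hK.isBounded i) hi⟩

/-- In positive dimension a nonempty open element contains two distinct points, so both one-sided
diameters are positive. -/
theorem IsFacetMeshSize.pos {K : Fin m → Set (E (n + 1))} (hK : IsMesh Ω K)
    {hF : Fin m → Fin m → ℝ} (hh : IsFacetMeshSize K hF) (i j : Fin m) : 0 < hF i j := by
  have hdiam : ∀ i, 0 < Metric.diam (K i) := by
    intro i
    obtain ⟨x, hx⟩ := (hK.polytope i).1
    obtain ⟨ε, hε, hball⟩ := Metric.isOpen_iff.1 (hK.isOpen i) x hx
    let y : E (n + 1) := x + EuclideanSpace.single 0 (ε / 2)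
    have hy : dist y x = ε / 2 := by simp [y, abs_of_pos hε]
    have := Metric.dist_le_diam_of_mem (hK.isBounded i)
      (hball (Metric.mem_ball.2 (by rw [hy]; linarith))) hx
    linarith
  exact (lt_min (hdiam i) (hdiam j)).trans_le (hh i j).1

theorem sipNormSq_nonneg (hK : IsMesh Ω K) {hF : Fin m → Fin m → ℝ}
    (hh : IsFacetMeshSize K hF) {σ : ℝ} (hσ : 0 ≤ σ) (w : PW (n + 1) m) :
    0 ≤ sipNormSq Ω K hF σ w :=
  add_nonneg (Finset.sum_nonneg fun _ _ => integral_nonneg fun _ => sq_nonneg _)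
    (facetSum_nonneg fun i j _ _ => mul_nonneg (div_nonneg hσ (hh.pos hK i j).le) (sq_nonneg _))

theorem memLinf_weakLaplacian {d : ℕ} {Ω : Set (E d)} (hΩ : IsOpen Ω)
    (hΩb : Bornology.IsBounded Ω) {ψ : E d → ℝ} (hψ : MemW2inf Ω ψ) :
    MemLinf Ω (weakLaplacian Ω ψ) :=
  memLp_finsetSum (p := ⊤) (μ := volume.restrict Ω) Finset.univ
    fun k _ => ((hψ.weakPartial_spec hΩ hΩb k).2.2 k).2

/-- The form of the scheme is positive definite. -/
theorem AForm_self_pos (hΩ : IsOpen Ω) (hΩb : Bornology.IsBounded Ω) (hK : IsMesh Ω K)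
    {hF : Fin m → Fin m → ℝ} (hh : IsFacetMeshSize K hF) {p : ℕ} {σ₀ : ℝ} (hσ₀ : 0 < σ₀)
    (hthr : IsSIPThreshold Ω K hF p σ₀) {σ : ℝ} (hσ : σ₀ ≤ σ) {μ : ℝ} (hμ : 0 < μ)
    {ψ : E (n + 1) → ℝ} (hψ : MemW2inf Ω ψ) {τ : ℝ} (hτ : 0 < τ)
    (hlap : (∀ᵐ x ∂(volume.restrict Ω), weakLaplacian Ω ψ x ≤ 0) ∨
      τ * normLinf Ω (weakLaplacian Ω ψ) < 2) {w : PW (n + 1) m} (hw : w ∈ V Ω K p)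
    (hw0 : w ≠ 0) : 0 < AForm Ω K hF ψ σ μ τ w w := by
  obtain ⟨C, hC, hco⟩ := hthr
  have ha : 0 ≤ aForm Ω K hF σ w w :=
    (mul_nonneg hC.le (sipNormSq_nonneg hK hh (hσ₀.le.trans hσ) w)).trans (hco σ hσ w hw)
  have hip := ip_self_pos hK hw0
  have hfs : 0 ≤ μ / 2 * facetSum Ω K fun i j x =>
      |⟪weakGrad Ω ψ x, unitNormal (K i) (K j)⟫| * ujump w i j x ^ 2 :=
    mul_nonneg (by positivity) (facetSum_nonneg fun i j _ x => by positivity)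
  have hb := bForm_self hΩ hΩb hK hψ μ hw
  set S := ∑ i, ∫ x in K i, weakLaplacian Ω ψ x * val (w i) x ^ 2 with hS
  have hLb := (memLinf_weakLaplacian hΩ hΩb hψ)
  have hτa : 0 ≤ τ * aForm Ω K hF σ w w := mul_nonneg hτ.le ha
  have hτf := mul_nonneg hτ.le hfs
  -- The Laplacian contributes -τS/2 to the diagonal, and the penalty and upwind parts are
  -- nonnegative. Thus S ≤ 0 or S ≤ ‖Δψ‖ (w,w) with τ‖Δψ‖ < 2 suffices.
  suffices h : τ * S < 2 * ip K w w by
    rw [AForm, hb]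
    linarith
  rcases hlap with h | h
  · have hS0 : S ≤ 0 := by
      refine Finset.sum_nonpos fun i _ => integral_nonpos_of_ae ?_
      filter_upwards [ae_restrict_of_ae_restrict_of_subset (hK.subset i) h] with x hx
      exact mul_nonpos_of_nonpos_of_nonneg hx (sq_nonneg _)
    nlinarith
  · have hSle : S ≤ normLinf Ω (weakLaplacian Ω ψ) * ip K w w := by
      rw [hS, ip, Finset.mul_sum]
      refine Finset.sum_le_sum fun i _ => ?_
      rw [← integral_const_mul]
      have hi : IntegrableOn (fun x => val (w i) x * val (w i) x) (K i) :=
        (BddContOn.of_continuous hΩb ((continuous_val (w i)).mul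
          (continuous_val (w i)))).integrableOn_elem hK i
      have hae : ∀ᵐ x ∂(volume.restrict (K i)), weakLaplacian Ω ψ x * val (w i) x ^ 2 ≤
          normLinf Ω (weakLaplacian Ω ψ) * (val (w i) x * val (w i) x) := by
        filter_upwards [ae_restrict_of_ae_restrict_of_subset (hK.subset i) hLb.ae_abs_le]
          with x hx
        rw [← sq]
        exact mul_le_mul_of_nonneg_right ((le_abs_self _).trans hx) (sq_nonneg _)
      have hi2 : IntegrableOn (fun x => weakLaplacian Ω ψ x * val (w i) x ^ 2) (K i) := by
        obtain ⟨-, C, hC⟩ := BddContOn.of_continuous hΩb ((continuous_val (w i)).pow 2)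
        exact Integrable.mul_bdd (c := C) ((hLb.integrableOn hΩb).mono_set (hK.subset i))
          ((continuous_val (w i)).pow 2).aestronglyMeasurable
          (ae_restrict_of_forall_mem (hK.isOpen i).measurableSet
            fun x hx => hC x (hK.subset i hx))
      exact integral_mono_ae hi2 (hi.const_mul _) hae
    nlinarith

end

end Forms

section Threshold

variable {n m : ℕ} {Ω : Set (E (n + 1))} {K : Fin m → Set (E (n + 1))}

/-! ### Coercivity thresholds -/

/-- Inverse trace inequality on a finite-dimensional space of polynomials. -/
theorem exists_trace_bound (hΩ : IsOpen Ω) (hΩb : Bornology.IsBounded Ω) (hK : IsMesh Ω K)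
    (W : Submodule ℝ (MvPolynomial (Fin (n + 1)) ℝ)) [FiniteDimensional ℝ W] {i j : Fin m}
    (hij : i ≠ j) (l : Fin m) :
    ∃ c ≥ 0, ∀ q ∈ W, ∫ x in facet Ω K i j, val q x * val q x ∂(surf (n + 1)) ≤
      c * ∫ x in K l, val q x * val q x := by
  have hbil : ∀ x : E (n + 1), IsBilin fun q r : W => val q.1 x * val r.1 x := fun x => by
    constructor <;> intros <;> simp only [Submodule.coe_add, Submodule.coe_smul, val_add,
      val_smul] <;> ring
  have hbdd : ∀ q r : W, BddContOn Ω fun x => val q.1 x * val r.1 x := fun q r =>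
    BddContOn.of_continuous hΩb ((continuous_val _).mul (continuous_val _))
  have h1 := IsBilin.integral hbil fun q r => (hbdd q r).integrableOn_facet hΩ hK hij
  have h2 := IsBilin.integral hbil fun q r => (hbdd q r).integrableOn_elem hK l
  -- The L² form on the element is positive definite on W, so it dominates the facet form; no
  -- scaling of the constant with the mesh size is needed.
  obtain ⟨c, hc, h⟩ := exists_quadratic_bound h1.toLin h2.toLin fun q hq =>
    setIntegral_val_sq_pos (hK.isOpen l) (hK.polytope l).1 (hK.isBounded l) (by simpa using hq)
  exact ⟨c, hc, fun q hq => h ⟨q, hq⟩⟩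

theorem norm_grad_sq (q : MvPolynomial (Fin (n + 1)) ℝ) (x : E (n + 1)) :
    ‖grad q x‖ ^ 2 =
      ∑ k, val (MvPolynomial.pderiv k q) x * val (MvPolynomial.pderiv k q) x := by
  rw [EuclideanSpace.norm_sq_eq]
  simp [grad_apply, sq]

/-- Inverse trace inequality for gradients. -/
theorem exists_grad_trace_bound (hΩ : IsOpen Ω) (hΩb : Bornology.IsBounded Ω) (hK : IsMesh Ω K)
    (p : ℕ) {i j : Fin m} (hij : i ≠ j) (l : Fin m) :
    ∃ c ≥ 0, ∀ q : MvPolynomial (Fin (n + 1)) ℝ, q.totalDegree ≤ p →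
      ∫ x in facet Ω K i j, ‖grad q x‖ ^ 2 ∂(surf (n + 1)) ≤ c * ∫ x in K l, ‖grad q x‖ ^ 2 := by
  -- The bound is used on the image of the degree-p polynomials under ∂ₖ, so that the right-hand
  -- side contains only the gradient and not q itself.
  choose c hc h using fun k : Fin (n + 1) => exists_trace_bound hΩ hΩb hK
    ((MvPolynomial.restrictTotalDegree (Fin (n + 1)) ℝ p).map
      (MvPolynomial.pderiv k).toLinearMap) hij l
  refine ⟨∑ k, c k, Finset.sum_nonneg fun k _ => hc k, fun q hq => ?_⟩
  have hbdd : ∀ k, BddContOn Ω fun x =>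
      val (MvPolynomial.pderiv k q) x * val (MvPolynomial.pderiv k q) x := fun k =>
    BddContOn.of_continuous hΩb ((continuous_val _).mul (continuous_val _))
  simp only [norm_grad_sq]
  rw [integral_finsetSum _ fun k _ => (hbdd k).integrableOn_facet hΩ hK hij,
    integral_finsetSum _ fun k _ => (hbdd k).integrableOn_elem hK l, Finset.mul_sum]
  refine Finset.sum_le_sum fun k _ => (h k _ ⟨q, ?_, rfl⟩).trans ?_
  · exact (MvPolynomial.mem_restrictTotalDegree _ _ _).2 hq
  · exact mul_le_mul_of_nonneg_right (Finset.single_le_sum (fun k _ => hc k) (Finset.mem_univ k))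
      (integral_nonneg fun _ => mul_self_nonneg _)

/-- Young's inequality splits the consistency terms into half of the jump penalty and a multiple of
the traces of the gradients; a large penalty makes that multiple small enough to be absorbed by half
of the element gradients. -/
theorem exists_isSIPThreshold (hΩ : IsOpen Ω) (hΩb : Bornology.IsBounded Ω) (hK : IsMesh Ω K)
    {hF : Fin m → Fin m → ℝ} (hh : IsFacetMeshSize K hF) (p : ℕ) :
    ∃ σ₀ > 0, IsSIPThreshold Ω K hF p σ₀ := by
  have hex : ∀ i j l : Fin m, ∃ c ≥ 0, ∀ q : MvPolynomial (Fin (n + 1)) ℝ, q.totalDegree ≤ p →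
      i ≠ j → ∫ x in facet Ω K i j, ‖grad q x‖ ^ 2 ∂(surf (n + 1)) ≤
        c * ∫ x in K l, ‖grad q x‖ ^ 2 := by
    intro i j l
    by_cases hij : i = j
    · exact ⟨0, le_rfl, fun _ _ h => absurd hij h⟩
    · obtain ⟨c, hc, h⟩ := exists_grad_trace_bound hΩ hΩb hK p hij l
      exact ⟨c, hc, fun q hq _ => h q hq⟩
  choose c hc hcb using hex
  let H : ℝ := 1 + ∑ i, ∑ j, hF i j
  have hpos : ∀ i j, 0 < hF i j := hh.pos hK
  have hHle : ∀ i j, hF i j ≤ H := by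
    intro i j
    have h1 : hF i j ≤ ∑ j, hF i j :=
      Finset.single_le_sum (fun j _ => (hpos i j).le) (Finset.mem_univ j)
    have h2 : ∑ j, hF i j ≤ ∑ i, ∑ j, hF i j :=
      Finset.single_le_sum (f := fun i => ∑ j, hF i j)
        (fun i _ => Finset.sum_nonneg fun j _ => (hpos i j).le) (Finset.mem_univ i)
    simp only [H]; linarith
  have hH : 0 < H := by
    have : 0 ≤ ∑ i, ∑ j, hF i j :=
      Finset.sum_nonneg fun i _ => Finset.sum_nonneg fun j _ => (hpos i j).le
    simp only [H]; linarith
  let D : ℝ := ∑ e : Fin m × Fin m with e.1 < e.2, (c e.1 e.2 e.1 + c e.1 e.2 e.2)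
  have hD : 0 ≤ D := Finset.sum_nonneg fun e _ => add_nonneg (hc _ _ _) (hc _ _ _)
  -- H bounds all facet mesh sizes and D is the total trace constant. This Young weight makes H D /
  -- (2κ) at most 1/2; the added 1 keeps it positive.
  let κ : ℝ := H * D + 1
  have hκ : 0 < κ := by positivity
  refine ⟨2 * κ, by positivity, 1 / 2, by norm_num, fun σ hσ w hw => ?_⟩
  set Γ := ∑ i, ∫ x in K i, ‖grad (w i) x‖ ^ 2 with hΓ
  have hΓi : ∀ i, ∫ x in K i, ‖grad (w i) x‖ ^ 2 ≤ Γ := fun i =>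
    Finset.single_le_sum (f := fun i => ∫ x in K i, ‖grad (w i) x‖ ^ 2)
      (fun i _ => integral_nonneg fun x => sq_nonneg _) (Finset.mem_univ i)
  have hΓ0 : 0 ≤ Γ := Finset.sum_nonneg fun i _ => integral_nonneg fun x => sq_nonneg _
  have hgc : ∀ i, BddContOn Ω fun x => ‖grad (w i) x‖ ^ 2 := fun i =>
    BddContOn.of_continuous hΩb ((continuous_grad (w i)).norm.pow 2)
  have htrace : (facetSum Ω K fun i j x => ‖grad (w i) x‖ ^ 2 + ‖grad (w j) x‖ ^ 2) ≤ D * Γ := by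
    rw [facetSum, Finset.sum_mul]
    refine Finset.sum_le_sum fun e he => ?_
    have hij := (Finset.mem_filter.1 he).2.ne
    rw [integral_add ((hgc _).integrableOn_facet hΩ hK hij)
      ((hgc _).integrableOn_facet hΩ hK hij), add_mul]
    refine add_le_add ?_ ?_
    · exact (hcb _ _ _ _ (hw e.1).1 hij).trans
        (mul_le_mul_of_nonneg_left (hΓi e.1) (hc _ _ _))
    · exact (hcb _ _ _ _ (hw e.2).1 hij).trans
        (mul_le_mul_of_nonneg_left (hΓi e.2) (hc _ _ _))
  have hjc : ∀ i j, BddContOn Ω fun x => σ / hF i j * ‖jump K w i j x‖ ^ 2 := fun i j =>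
    BddContOn.of_continuous hΩb (continuous_const.mul ((continuous_jump K w i j).norm.pow 2))
  have hpt : ∀ i j, i ≠ j → ∀ x, aFacet K hF σ w w i j x ≤
      -(1 / 2) * (σ / hF i j * ‖jump K w i j x‖ ^ 2) +
        H / (2 * κ) * (‖grad (w i) x‖ ^ 2 + ‖grad (w j) x‖ ^ 2) := by
    intro i j _ x
    set J := jump K w i j x
    set A := avgGrad w i j x
    have hA : ‖A‖ ^ 2 ≤ 1 / 2 * (‖grad (w i) x‖ ^ 2 + ‖grad (w j) x‖ ^ 2) := by
      have h1 : ‖A‖ ≤ 1 / 2 * (‖grad (w i) x‖ + ‖grad (w j) x‖) := by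
        simp only [A, avgGrad]
        rw [norm_smul]
        norm_num
        exact norm_add_le _ _
      calc ‖A‖ ^ 2 ≤ (1 / 2 * (‖grad (w i) x‖ + ‖grad (w j) x‖)) ^ 2 := by gcongr
        _ ≤ _ := by nlinarith [sq_nonneg (‖grad (w i) x‖ - ‖grad (w j) x‖)]
    have hhp := hpos i j
    have hJA : 2 * ⟪J, A⟫ ≤ κ / hF i j * ‖J‖ ^ 2 + hF i j / κ * ‖A‖ ^ 2 := by
      have h1 := real_inner_le_norm J A
      have h2 : 0 ≤ hF i j / κ * (κ / hF i j * ‖J‖ - ‖A‖) ^ 2 := by positivity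
      have h3 : hF i j / κ * (κ / hF i j * ‖J‖ - ‖A‖) ^ 2 =
          κ / hF i j * ‖J‖ ^ 2 - 2 * (‖J‖ * ‖A‖) + hF i j / κ * ‖A‖ ^ 2 := by
        field_simp; ring
      linarith
    have h4 : hF i j / κ * ‖A‖ ^ 2 ≤
        H / (2 * κ) * (‖grad (w i) x‖ ^ 2 + ‖grad (w j) x‖ ^ 2) := by
      calc hF i j / κ * ‖A‖ ^ 2 ≤
          H / κ * (1 / 2 * (‖grad (w i) x‖ ^ 2 + ‖grad (w j) x‖ ^ 2)) := by
            gcongr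
            exact hHle i j
        _ = _ := by field_simp
    -- Here σ ≥ 2κ enters: the Young term uses at most half of the penalty.
    have h5 : κ / hF i j * ‖J‖ ^ 2 ≤ 1 / 2 * (σ / hF i j * ‖J‖ ^ 2) := by
      rw [← mul_assoc, ← mul_div_assoc]
      gcongr
      linarith
    have h6 : aFacet K hF σ w w i j x = 2 * ⟪J, A⟫ - σ / hF i j * ‖J‖ ^ 2 := by
      rw [aFacet, real_inner_self_eq_norm_sq]; ring
    rw [h6]
    linarith
  have hsum : facetSum Ω K (aFacet K hF σ w w) ≤
      -(1 / 2) * (facetSum Ω K fun i j x => σ / hF i j * ‖jump K w i j x‖ ^ 2) +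
        H / (2 * κ) * (D * Γ) := by
    refine (facetSum_mono hΩ hK (fun i j => BddContOn.of_continuous hΩb
      (continuous_aFacet K hF σ w w i j)) (fun i j => ((BddContOn.const _).mul (hjc i j)).add
        ((BddContOn.const _).mul ((hgc i).add (hgc j)))) hpt).trans ?_
    rw [facetSum_add hΩ hK (fun i j => (BddContOn.const _).mul (hjc i j))
      (fun i j => (BddContOn.const _).mul ((hgc i).add (hgc j))), facetSum_const_mul,
      facetSum_const_mul]
    gcongr
  have hκΓ : H / (2 * κ) * (D * Γ) ≤ 1 / 2 * Γ := by
    rw [← mul_assoc]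
    refine mul_le_mul_of_nonneg_right ?_ hΓ0
    rw [div_mul_eq_mul_div, div_le_iff₀ (by positivity)]
    simp only [κ]; linarith
  have haf : aForm Ω K hF σ w w = Γ - facetSum Ω K (aFacet K hF σ w w) := by
    rw [hΓ]
    simp only [← real_inner_self_eq_norm_sq]
    rfl
  rw [haf, sipNormSq]
  linarith

/-! ### The scheme -/

/-- The space `V_p` as a submodule. -/
def VSub {d : ℕ} (Ω : Set (E d)) (K : Fin m → Set (E d)) (p : ℕ) : Submodule ℝ (PW d m) where
  carrier := V Ω K p
  zero_mem' i := ⟨by simp, Eventually.of_forall fun x => by simp [val]⟩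
  add_mem' {u v} hu hv i := by
    refine ⟨(MvPolynomial.totalDegree_add _ _).trans (max_le (hu i).1 (hv i).1), ?_⟩
    filter_upwards [(hu i).2, (hv i).2] with x h1 h2
    rw [Pi.add_apply, val_add, h1, h2, add_zero]
  smul_mem' c {u} hu i := by
    refine ⟨(MvPolynomial.totalDegree_smul_le _ _).trans (hu i).1, ?_⟩
    filter_upwards [(hu i).2] with x h1
    rw [Pi.smul_apply, val_smul, h1, mul_zero]

instance finiteDimensional_VSub {d : ℕ} (Ω : Set (E d)) (K : Fin m → Set (E d)) (p : ℕ) :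
    FiniteDimensional ℝ (VSub Ω K p) := by
  let f : VSub Ω K p →ₗ[ℝ] Fin m → MvPolynomial.restrictTotalDegree (Fin d) ℝ p :=
    { toFun := fun w i => ⟨w.1 i, (MvPolynomial.mem_restrictTotalDegree _ _ _).2 (w.2 i).1⟩
      map_add' := fun _ _ => rfl
      map_smul' := fun _ _ => rfl }
  refine FiniteDimensional.of_injective f fun u v h => Subtype.ext (funext fun i => ?_)
  exact congrArg Subtype.val (congrFun h i)

/-- One step of the scheme is uniquely solvable. -/
theorem existsUnique_step (hΩ : IsOpen Ω) (hΩb : Bornology.IsBounded Ω) (hK : IsMesh Ω K)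
    {hF : Fin m → Fin m → ℝ} (hh : IsFacetMeshSize K hF) {p : ℕ} {σ₀ : ℝ} (hσ₀ : 0 < σ₀)
    (hthr : IsSIPThreshold Ω K hF p σ₀) {σ : ℝ} (hσ : σ₀ ≤ σ) {μ : ℝ} (hμ : 0 < μ)
    {ψ : E (n + 1) → ℝ} (hψ : MemW2inf Ω ψ) {τ : ℝ} (hτ : 0 < τ)
    (hlap : (∀ᵐ x ∂(volume.restrict Ω), weakLaplacian Ω ψ x ≤ 0) ∨
      τ * normLinf Ω (weakLaplacian Ω ψ) < 2) (L : Fin m → Finset (E (n + 1))) {M : ℝ}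
    (hM : 0 ≤ M) (u₀ : PW (n + 1) m) :
    ∃! u, u ∈ Vplus Ω K p L M ∧ ∀ v ∈ Vplus Ω K p L M,
      AForm Ω K hF ψ σ μ τ u (v - u) ≥ ip K u₀ (v - u) := by
  have hbil := isBilin_AForm hΩ hΩb hK hF (bddContOn_weakGrad hΩ hΩb hψ) σ μ τ
  let ι := (VSub Ω K p).subtype
  -- Node evaluations are indexed by pairs of an element and one of its nodes, since a point shared
  -- by several elements carries several values.
  let l : {z : Fin m × E (n + 1) // z.2 ∈ L z.1} → VSub Ω K p →ₗ[ℝ] ℝ := fun z =>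
    { toFun := fun w => val (w.1 z.1.1) z.1.2
      map_add' := fun u v => val_add _ _ _
      map_smul' := fun c u => val_smul _ _ _ }
  obtain ⟨u, ⟨hu, hu'⟩, huniq⟩ := existsUnique_variational_inequality_box
    (hbil.toLin.compl₁₂ ι ι) (fun v hv => AForm_self_pos hΩ hΩb hK hh hσ₀ hthr hσ hμ hψ hτ hlap
      v.2 fun h => hv (Subtype.ext h)) (((isBilin_ip hK hΩb).toLin u₀).comp ι) l hM
  refine ⟨u.1, ⟨⟨u.2, fun i x hx => hu ⟨(i, x), hx⟩⟩, fun v hv => ?_⟩, fun y hy => ?_⟩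
  · exact hu' ⟨v, hv.1⟩ fun z => hv.2 z.1.1 z.1.2 z.2
  · have := huniq ⟨y, hy.1.1⟩ ⟨fun z => hy.1.2 z.1.1 z.1.2 z.2, fun v hv =>
      hy.2 v.1 ⟨v.2, fun i x hx => hv ⟨(i, x), hx⟩⟩⟩
    exact congrArg Subtype.val this

/-- Sequences defined by a uniquely solvable recursion exist and are unique. -/
theorem existsUnique_recursion {α : Type*} {R : α → α → Prop} (h : ∀ a, ∃! b, R a b) (N : ℕ)
    (a : α) : ∃! U : Fin (N + 1) → α, U 0 = a ∧ ∀ k : Fin N, R (U k.castSucc) (U k.succ) := by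
  choose S hS hSu using h
  refine ⟨fun k => S^[k] a, ⟨rfl, fun k => ?_⟩, fun U hU => ?_⟩
  · simp only [Fin.val_succ, Fin.val_castSucc, Function.iterate_succ_apply']
    exact hS _
  · funext k
    induction k using Fin.induction with
    | zero => simpa using hU.1
    | succ k ih =>
      rw [hSu _ _ (hU.2 k), ih]
      simp only [Fin.val_succ, Fin.val_castSucc, Function.iterate_succ_apply']

end Threshold

end DGDrift

/-! ### Threshold and time stepping combined -/

theorem mainTheorem1
    (d : ℕ) (hd : 1 ≤ d) (hd3 : d ≤ 3)
    (Ω : Set (DGDrift.E d)) (hΩ : IsOpen Ω) (hΩb : Bornology.IsBounded Ω)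
    (m : ℕ) (K : Fin m → Set (DGDrift.E d)) (hK : DGDrift.IsMesh Ω K)
    (hF : Fin m → Fin m → ℝ) (hhF : DGDrift.IsFacetMeshSize K hF) (p : ℕ) :
    (∃ σ₀ > 0, DGDrift.IsSIPThreshold Ω K hF p σ₀) ∧
    ∀ σ₀ > 0, DGDrift.IsSIPThreshold Ω K hF p σ₀ →
      ∀ σ ≥ σ₀, ∀ μ > 0,
      ∀ ψ : DGDrift.E d → ℝ, DGDrift.MemW2inf Ω ψ →
      ∀ τ > 0,
        ((∀ᵐ x ∂(volume.restrict Ω), DGDrift.weakLaplacian Ω ψ x ≤ 0) ∨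
          τ * DGDrift.normLinf Ω (DGDrift.weakLaplacian Ω ψ) < 2) →
      ∀ L : Fin m → Finset (DGDrift.E d), (∀ i, DGDrift.IsLagrangeNodes p (K i) (L i)) →
      ∀ u₀ : DGDrift.E d → ℝ, DGDrift.MemLinf Ω u₀ → (∀ᵐ x ∂(volume.restrict Ω), 0 ≤ u₀ x) →
      ∀ N : ℕ, ∀ uh0 ∈ DGDrift.V Ω K p,
        ∃! U : Fin (N + 1) → DGDrift.PW d m,
          DGDrift.IsSchemeSolution Ω K hF ψ σ μ τ p L (DGDrift.normLinf Ω u₀) N uh0 U := by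
  -- Positive dimension lets hyperplanes be parametrized by `E n` and makes `surf (n + 1)` the
  -- n-dimensional surface measure.
  obtain ⟨n, rfl⟩ : ∃ n, d = n + 1 := ⟨d - 1, by omega⟩
  refine ⟨DGDrift.exists_isSIPThreshold hΩ hΩb hK hhF p, ?_⟩
  intro σ₀ hσ₀ hthr σ hσ μ hμ ψ hψ τ hτ hlap L _ u₀ _ _ N uh0 _
  -- The upper nodal bound is a `toReal` and hence nonnegative, so the zero function is admissible.
  have hstep := DGDrift.existsUnique_step hΩ hΩb hK hhF hσ₀ hthr hσ hμ hψ hτ hlap L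
    (M := DGDrift.normLinf Ω u₀) ENNReal.toReal_nonneg
  exact DGDrift.existsUnique_recursion hstep N uh0
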